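/- **Model.** A network is a finite simple graph $G=(V,E)$ whose nodes number their incident edges (ports) arbitrarily. In a deterministic CONGEST algorithm with $B$-bit messages all nodes run the same deterministic program; in every synchronous round each node sends one $B$-bit message through each port, receives one through each port, and performs arbitrary local computation. $G^k$ is the graph on $V$ in which distinct $u,v$ are adjacent iff $d_G(u,v)\le k$. A $(c,d)$ network decomposition of a graph $H$ is a partition of its vertices into blocks (colors) $V_1,\dots,V_c$ such that every connected component (cluster) of every $H[V_i]$ has diameter at most $d$ in $H[V_i]$. (For $H=G^k$ the clusters need not be connected in $G$.) Computing it means that every node outputs its color and a cluster identifier that is the given identifier of some node of the cluster and differs between different clusters. $\log^* S$ is the number of times $\log_2$ has to be applied to $S$ until the value is at most $1$. **Theorem.** There are a function $g:\mathbb N\to\mathbb N$ with $g(N)=2^{O(\sqrt{\log N})}$ and a deterministic CONGEST algorithm with $O(S)$-bit messages ($N$, $S$, $k$ and, in (3), $r$ are known to all nodes) such that for all $N,S$ and all $k\ge 1$: 1. In every $N$-node network $G$ with distinct $S$-bit identifiers, where each node initially knows only its own identifier and its degree, the algorithm computes a $(g(N),g(N))$ network decomposition of $G^k$ in $k\,g(N)\log^*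 S$ rounds. 2. Afterwards, one round of communication within the clusters of $G^k$, that is, a convergecast and a broadcast in all clusters simultaneously, can be simulated in $k\cdot 2^{O(\sqrt{\log N})}$ rounds on $G$ with $O(S)$-bit messages: for every $a$ and every commutative monoid $M$ with $|M|\le 2^{aS}$, if every node $v$ holds a value $x_v\in M$, then after $a\,k\,g(N)$ rounds every node $v$ knows $\prod_{u\in C} x_u$, where $C$ is the cluster of $v$. 3. Suppose that, instead, the nodes of a network $G$ with any number of nodes are initially partitioned into $N$ clusters, each with a center such that every node of the cluster is joined to the center by a path of length at most $r$ inside the cluster ($r\ge 1$), that the centers have distinct $S$-bit identifiers, and that each node initially knows only the identifier of the center of its cluster, whether it is this center, and its degree. Then the algorithm computes a $(g(N), r\,g(N))$ network decomposition of $G^k$ in $k\,r\,g(N)\log^* S$ rounds, each of whose clusters is a union of initial clusters and is identified by the center identifier of one of them. -/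

import Mathlib

/-- The iterated binary logarithm: how often `log₂` has to be applied to `n` until the value is at
most `1`. (Rounding up after each application does not change the count, since the thresholds
`1, 2, 4, 16, …` are integers.) -/
def logStar (n : ℕ) : ℕ :=
  if n ≤ 1 then 0 else logStar (Nat.clog 2 n) + 1
termination_by n
decreasing_by
  have h : Nat.clog 2 n ≤ n - 1 :=
    Nat.clog_le_of_le_pow (by have := @Nat.lt_two_pow_self (n - 1); omega)
  omega

/-- `g(N) = 2^{O(√log N)}`. -/
def IsTwoPowBigOSqrtLog (g : ℕ → ℕ) : Prop :=
  ∃ C : ℝ, ∀ᶠ N : ℕ in Filter.atTop, (g N : ℝ) ≤ 2 ^ (C * √(Real.logb 2 N))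

/-! ### The synchronous message passing model with `B`-bit messages -/

/-- The neighbours of every node `v` are numbered `0, …, deg v - 1` in an arbitrary way. -/
structure PortNumbering {V : Type} (G : SimpleGraph V) where
  deg : V → ℕ
  nbr : ∀ v, Fin (deg v) ≃ G.neighborSet v

/-- A deterministic CONGEST algorithm with `B`-bit messages. All nodes run the same program. A node
starts with a local input and the number of its ports. In each round it sends one `B`-bit message
through each port, receives one through each port, and updates its state; local computation is not
restricted. -/
structure CongestAlgorithm (Input Output : Type) (B : ℕ) where
  State : Type
  init : Input → (deg : ℕ) → State
  send : State → (port : ℕ) → BitVec B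
  receive : State → (deg : ℕ) → (Fin deg → BitVec B) → State
  output : State → Output

namespace CongestAlgorithm

variable {Input Output : Type} {B : ℕ} {V : Type} {G : SimpleGraph V}

/-- The states of all nodes after `t` rounds. What `v` receives through port `i` is what its `i`-th
neighbour `u` sends through the port of `u` that leads to `v`. -/
def run (A : CongestAlgorithm Input Output B) (P : PortNumbering G) (x : V → Input) :
    ℕ → V → A.State
  | 0, v => A.init (x v) (P.deg v)
  | t + 1, v => A.receive (run A P x t v) (P.deg v) fun i =>
      A.send (run A P x t (P.nbr v i))
        ((P.nbr (P.nbr v i)).symm ⟨v, (P.nbr v i).2.symm⟩)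

/-- The outputs of all nodes after `t` rounds. -/
def result (A : CongestAlgorithm Input Output B) (P : PortNumbering G) (x : V → Input)
    (t : ℕ) (v : V) : Output :=
  A.output (A.run P x t v)

end CongestAlgorithm

/-! ### Network decompositions -/

/-- The `k`-th power of `G`: two distinct nodes are adjacent if their distance in `G` is at
most `k`. -/
def powerGraph {V : Type} (G : SimpleGraph V) (k : ℕ) : SimpleGraph V where
  Adj u v := u ≠ v ∧ G.edist u v ≤ k
  symm := ⟨fun u v h => ⟨h.1.symm, by rw [SimpleGraph.edist_comm]; exact h.2⟩⟩
  loopless := ⟨fun _ h => h.1 rfl⟩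

/-- The disjoint union of the induced subgraphs `H[V_i]`, where the block `V_i` consists of the
nodes of color `i`. -/
def blockGraph {V : Type} (H : SimpleGraph V) (color : V → ℕ) : SimpleGraph V where
  Adj u v := H.Adj u v ∧ color u = color v
  symm := ⟨fun _ _ h => ⟨h.1.symm, h.2.symm⟩⟩
  loopless := ⟨fun _ h => h.1.ne rfl⟩

/-- The clusters are the connected components of the graphs `H[V_i]`. -/
def SameCluster {V : Type} (H : SimpleGraph V) (color : V → ℕ) (u v : V) : Prop :=
  (blockGraph H color).Reachable u v

open Classical in
/-- The cluster of the node `v`. -/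
noncomputable def clusterOf {V : Type} [Fintype V] (H : SimpleGraph V) (color : V → ℕ) (v : V) :
    Finset V :=
  Finset.univ.filter (SameCluster H color v)

/-- `color` is a `(c, d)` network decomposition of `H`: the nodes are partitioned into `c` blocks
`V_i`, and each connected component of each `H[V_i]` has diameter at most `d`. -/
structure IsNetworkDecomposition {V : Type} (H : SimpleGraph V) (c d : ℕ) (color : V → ℕ) :
    Prop where
  color_lt : ∀ v, color v < c
  diam_le : ∀ u v, SameCluster H color u v → (blockGraph H color).dist u v ≤ d

/-- The nodes hold a `(c, d)` network decomposition of `H`: each node outputs its color and an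
identifier of its cluster. Different clusters have different identifiers, and the identifier of a
cluster is one of the identifiers `ident w` that its nodes `w` were given. -/
structure OutputsDecomposition {V : Type} {S : ℕ} (H : SimpleGraph V) (c d : ℕ)
    (ident : V → BitVec S) (out : V → ℕ × BitVec S) : Prop where
  decomposition : IsNetworkDecomposition H c d fun v => (out v).1
  label_eq_iff : ∀ u v, (out u).2 = (out v).2 ↔ SameCluster H (fun w => (out w).1) u v
  label_mem : ∀ v, ∃ w, SameCluster H (fun w => (out w).1) v w ∧ (out v).2 = ident w

/-- A partition of the nodes of `G` into clusters with centers, where `center v` is the center of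
the cluster of `v`; every node is reached from the center of its cluster by a path of length at
most `r` inside the cluster. -/
structure IsClustering {V : Type} (G : SimpleGraph V) (r : ℕ) (center : V → V) : Prop where
  center_center : ∀ v, center (center v) = center v
  radius_le : ∀ v, ∃ p : G.Walk (center v) v, p.length ≤ r ∧ ∀ w ∈ p.support, center w = center v

open Classical in
/-- The initial knowledge of a node, given a clustering: the identifier of the center of its
cluster, and whether it is this center itself. -/
noncomputable def clusterInput {V : Type} {S : ℕ} (ident : V → BitVec S) (center : V → V) (v : V) :
    BitVec S × Bool :=
  (ident (center v), decide (center v = v))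

/-! The construction works on clusters. Let `s = scale N`, which is about `√(log N)`, and `d =
2^(s+1)`. There are `s` levels. Each divides the number of active clusters by at least `2^s`
(`level_config`), and since `N < 2^(s*s)`, none is active at the end (`decompose_apply`).

On one level, an active cluster takes as out-neighbors the `d` smallest labels of active clusters
that are near, that is, contain a node at distance at most `k` from it; a cluster is near to itself.
Clusters with at least `d^2` in-neighbors are heavy; by double counting they are at most a `1/d`
fraction (`ncard_heavy_mul_le`). A cluster is free if no heavy cluster is near, and free clusters
conflict if they share an out-neighbor. A free cluster has at most `d * d^2` conflicts, so Linial's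
polynomial color reduction colors the conflict graph with `2^O(s)` colors in `O(log* S)` steps,
starting from the labels (`coloring_config`). Processing the colors greedily gives an independent
set that is maximal among the free clusters with `d` out-neighbors (`join_config`). The
out-neighborhoods of its members are disjoint, so its size is again at most a `1/d` fraction
(`ncard_joined_mul_le`).

Heavy and chosen clusters then absorb what is near, twice (`grow_config`). The first growth reaches
all clusters that are not free and all out-neighbors of chosen clusters; the second reaches the
remaining free clusters with `d` out-neighbors. A survivor is therefore free and has every near
active cluster, itself included, as an out-neighbor. Two near survivors conflict and have different
colors, so survivors can retire with their conflict color, taken from a palette reserved for the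
level.

Clusters of `G^k` need not be connected in `G`. `ClusterInv` therefore records for every label a
connected set of relaying nodes. A level multiplies its radius by at most `16` and adds at most two
labels per node, so the total overhead is `2^O(s)`. Messages stay short because flooding keeps only
the `D` smallest items, which commutes with taking unions (`trunc_trunc_union`); ordering items by
thresholds makes the kept ones exactly those that are needed (`confRound_config`).

Every procedure is an exact function on networks (`NetMap`) together with a round bound
(`Realizable`), so correctness and running time are proved separately. Aggregation uses one breadth
first search tree per label among its relays. -/

/-! ### Network transformations that can be computed in a given number of rounds -/

/-- A transformation of the local data of the nodes of a network. -/
abbrev NetMap (α β : Type) := ∀ V : Type, SimpleGraph V → (V → α) → V → β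

namespace CongestAlgorithm

variable {α β γ : Type} {B : ℕ}

/-- Change the input and the output of an algorithm by local functions. -/
def dimap {α' β' : Type} (A : CongestAlgorithm α β B) (f : α' → α) (h : β → β') :
    CongestAlgorithm α' β' B where
  State := A.State
  init x deg := A.init (f x) deg
  send := A.send
  receive := A.receive
  output s := h (A.output s)

theorem run_dimap {α' β' : Type} (A : CongestAlgorithm α β B) (f : α' → α) (h : β → β') {V : Type}
    {G : SimpleGraph V} (P : PortNumbering G) (x : V → α') (t : ℕ) :
    (A.dimap f h).run P x t = A.run P (fun v => f (x v)) t := by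
  induction t with
  | zero => rfl
  | succ t ih => funext v; simp only [run, ih]; rfl

theorem result_dimap {α' β' : Type} (A : CongestAlgorithm α β B) (f : α' → α) (h : β → β')
    {V : Type} {G : SimpleGraph V} (P : PortNumbering G) (x : V → α') (t : ℕ) :
    (A.dimap f h).result P x t = fun v => h (A.result P (fun v => f (x v)) t v) := by
  funext v
  simp only [result, run_dimap]
  rfl

/-- The algorithm that does not communicate. -/
def idle (f : α → β) : CongestAlgorithm α β B where
  State := α
  init x _ := x
  send _ _ := 0
  receive s _ _ := s
  output := f

theorem result_idle (f : α → β) {V : Type} {G : SimpleGraph V} (P : PortNumbering G) (x : V → α)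
    (t : ℕ) : (idle f : CongestAlgorithm α β B).result P x t = fun v => f (x v) := by
  have : (idle f : CongestAlgorithm α β B).run P x t = x := by
    induction t with
    | zero => rfl
    | succ t ih => funext v; simp only [run, ih]; rfl
  funext v
  simp only [result, this]
  rfl

/-- A state of `seq` with `n` rounds of the first algorithm still to be run. -/
def seqState (A : CongestAlgorithm α β B) (A' : CongestAlgorithm β γ B) (deg : ℕ) :
    ℕ → A.State → (ℕ × A.State) ⊕ A'.State
  | 0, s => .inr (A'.init (A.output s) deg)
  | n + 1, s => .inl (n, s)

/-- Run `A` for `T` rounds, and then `A'` on its output. -/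
def seq (A : CongestAlgorithm α β B) (A' : CongestAlgorithm β γ B) (T : ℕ) :
    CongestAlgorithm α γ B where
  State := (ℕ × A.State) ⊕ A'.State
  init x deg := seqState A A' deg T (A.init x deg)
  send s port := match s with
    | .inl (_, s) => A.send s port
    | .inr s => A'.send s port
  receive s deg m := match s with
    | .inl (n, s) => seqState A A' deg n (A.receive s deg m)
    | .inr s => .inr (A'.receive s deg m)
  output s := match s with
    | .inl (_, s) => A'.output (A'.init (A.output s) 0)
    | .inr s => A'.output s

/-- `n` counts down the rounds left to the first algorithm. At `n = 0` the state is already the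
initial state of the second one, so switching costs no round. -/
theorem run_seq_first (A : CongestAlgorithm α β B) (A' : CongestAlgorithm β γ B) {V : Type}
    {G : SimpleGraph V} (P : PortNumbering G) (x : V → α) (T t : ℕ) :
    ∀ n v, T = t + n →
      (A.seq A' T).run P x t v = seqState A A' (P.deg v) n (A.run P x t v) := by
  induction t with
  | zero => intro n v h; rw [Nat.zero_add] at h; subst h; rfl
  | succ t ih =>
    intro n v h
    have e := fun v => ih (n + 1) v (by omega)
    simp only [run, e]
    rfl

theorem run_seq_second (A : CongestAlgorithm α β B) (A' : CongestAlgorithm β γ B) {V : Type}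
    {G : SimpleGraph V} (P : PortNumbering G) (x : V → α) (T t : ℕ) (v : V) :
    (A.seq A' T).run P x (T + t) v = .inr (A'.run P (A.result P x T) t v) := by
  induction t generalizing v with
  | zero => exact run_seq_first A A' P x T T 0 v rfl
  | succ t ih =>
    rw [← Nat.add_assoc]
    simp only [run, ih]
    rfl

theorem result_seq (A : CongestAlgorithm α β B) (A' : CongestAlgorithm β γ B) {V : Type}
    {G : SimpleGraph V} (P : PortNumbering G) (x : V → α) (T t : ℕ) :
    (A.seq A' T).result P x (T + t) = A'.result P (A.result P x T) t := by
  funext v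
  simp only [result, run_seq_second]
  rfl

end CongestAlgorithm

/-- `F` is computed by an algorithm with `B`-bit messages in `T` rounds on all networks. -/
def Realizable (B T : ℕ) {α β : Type} (F : NetMap α β) : Prop :=
  ∃ A : CongestAlgorithm α β B, ∀ (V : Type) (G : SimpleGraph V) (P : PortNumbering G)
    (x : V → α), A.result P x T = F V G x

/-- A purely local transformation. -/
def NetMap.ofLocal {α β : Type} (f : α → β) : NetMap α β := fun _ _ x v => f (x v)

/-- Sequential composition. -/
def NetMap.andThen {α β γ : Type} (F : NetMap α β) (F' : NetMap β γ) : NetMap α γ :=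
  fun V G x => F' V G (F V G x)

/-- The composition of `F 0, …, F (n - 1)`. -/
def NetMap.chain {α : Type} (F : ℕ → NetMap α α) : ℕ → NetMap α α
  | 0 => fun _ _ x => x
  | n + 1 => (NetMap.chain F n).andThen (F n)

/-- The part of `s` that is sent: all of it, if it fits. -/
noncomputable def cap {E : Type} (K : ℕ) (s : Set E) : Set E :=
  open Classical in if s.ncard ≤ K then s else ∅

theorem cap_of_le {E : Type} {K : ℕ} {s : Set E} (h : s.ncard ≤ K) : cap K s = s := by
  simp [cap, h]

theorem ncard_cap_le {E : Type} (K : ℕ) (s : Set E) : (cap K s).ncard ≤ K := by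
  unfold cap
  split_ifs with h <;> simp [h]

/-- Every node broadcasts a set of at most `K` elements and learns the union of the sets of its
neighbors. -/
noncomputable def NetMap.gather {α β E : Type} (K : ℕ) (s : α → Set E) (upd : α → Set E → β) :
    NetMap α β :=
  fun _ G x v => upd (x v) {e | ∃ u, G.Adj v u ∧ e ∈ cap K (s (x u))}

namespace Realizable

variable {α β γ : Type} {B T T' : ℕ}

theorem ofLocal (f : α → β) (T : ℕ) : Realizable B T (NetMap.ofLocal f) :=
  ⟨.idle f, fun _ _ P x => CongestAlgorithm.result_idle f P x T⟩

theorem andThen {F : NetMap α β} {F' : NetMap β γ} (h : Realizable B T F)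
    (h' : Realizable B T' F') : Realizable B (T + T') (F.andThen F') := by
  obtain ⟨A, hA⟩ := h
  obtain ⟨A', hA'⟩ := h'
  refine ⟨A.seq A' T, fun V G P x => ?_⟩
  rw [CongestAlgorithm.result_seq, hA, hA', NetMap.andThen]

theorem mono {F : NetMap α β} (h : Realizable B T F) (hT : T ≤ T') : Realizable B T' F := by
  have := h.andThen (ofLocal (B := B) (fun b : β => b) (T' - T))
  rwa [Nat.add_sub_cancel' hT] at this

theorem chain {F : ℕ → NetMap α α} (h : ∀ i, Realizable B T (F i)) (n : ℕ) :
    Realizable B (n * T) (NetMap.chain F n) := by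
  induction n with
  | zero => exact (ofLocal (B := B) (fun b : α => b) 0).mono (Nat.zero_le _)
  | succ n ih => rw [Nat.succ_mul]; exact ih.andThen (h n)

end Realizable

/-- Sets of at most `K` elements of `E` can be encoded by `K * (b + 1)` messages. -/
theorem exists_set_code {E : Type} [Finite E] {B b K : ℕ} (hB : 1 ≤ B)
    (hE : Nat.card E ≤ 2 ^ (b * B)) :
    ∃ (enc : Set E → ℕ → BitVec B) (dec : (ℕ → BitVec B) → Set E),
      ∀ s : Set E, s.ncard ≤ K → ∀ f : ℕ → BitVec B,
        (∀ j < K * (b + 1), f j = enc s j) → dec f = s := by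
  classical
  have := Fintype.ofFinite E
  -- A set of at most `K` elements is listed by a function `Fin K → Option E`. There are `(|E| +
  -- 1)^K ≤ 2^((b + 1) * B * K)` of these, hence `K * (b + 1)` words of `B` bits.
  have hcard : Fintype.card (Fin K → Option E) ≤
      Fintype.card (Fin (K * (b + 1)) → BitVec B) := by
    have h1 : Fintype.card (BitVec B) = 2 ^ B := by
      rw [Fintype.card_congr (BitVec.equivFin (m := B)).toEquiv, Fintype.card_fin]
    rw [Fintype.card_fun, Fintype.card_fun, h1, Fintype.card_option, Fintype.card_fin,
      Fintype.card_fin, mul_comm K, pow_mul]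
    rw [Nat.card_eq_fintype_card] at hE
    gcongr
    have h3 : 2 ^ 1 ≤ 2 ^ B := Nat.pow_le_pow_right (by norm_num) hB
    have h4 : 1 ≤ 2 ^ (b * B) := Nat.one_le_two_pow
    rw [← pow_mul, mul_add, pow_add, mul_comm B b]
    simp only [mul_one]
    nlinarith
  obtain ⟨φ⟩ := Function.Embedding.nonempty_of_card_le hcard
  have hlist : ∀ s : Set E, s.ncard ≤ K → ∃ g : Fin K → Option E, {e | ∃ i, g i = some e} = s := by
    intro s hs
    let t := s.toFinset
    have ht : t.card ≤ K := by rwa [← Set.ncard_eq_toFinset_card']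
    refine ⟨fun i => if h : (i : ℕ) < t.card then some ((t.equivFin.symm ⟨i, h⟩ : t) : E)
      else none, ?_⟩
    ext e
    constructor
    · rintro ⟨i, hi⟩
      by_cases h : (i : ℕ) < t.card
      · simp only [h, dite_true, Option.some.injEq] at hi
        rw [← hi]
        exact Set.mem_toFinset.1 (t.equivFin.symm ⟨i, h⟩).2
      · simp [h] at hi
    · intro he
      have he' : e ∈ t := Set.mem_toFinset.2 he
      refine ⟨⟨t.equivFin ⟨e, he'⟩, lt_of_lt_of_le (Fin.is_lt _) ht⟩, ?_⟩
      simp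
  choose! g hg using hlist
  refine ⟨fun s j => if h : j < K * (b + 1) then φ (g s) ⟨j, h⟩ else 0,
    fun f => {e | ∃ i, Function.invFun φ (fun j => f j) i = some e}, fun s hs f hf => ?_⟩
  have : (fun j : Fin (K * (b + 1)) => f j) = φ (g s) := by
    funext j
    simp [hf j j.2]
  simp only [this]
  rw [Function.leftInverse_invFun φ.injective (g s), hg s hs]

namespace CongestAlgorithm

/-- The algorithm that broadcasts messages of several words. -/
noncomputable def gather {α β E : Type} {B : ℕ} (enc : Set E → ℕ → BitVec B)
    (dec : (ℕ → BitVec B) → Set E) (s : α → Set E) (upd : α → Set E → β) :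
    CongestAlgorithm α β B where
  State := α × ℕ × ℕ × (ℕ → ℕ → BitVec B)
  init x deg := (x, deg, 0, fun _ _ => 0)
  send σ _ := enc (s σ.1) σ.2.2.1
  receive σ deg m := (σ.1, deg, σ.2.2.1 + 1, fun p j =>
    if j = σ.2.2.1 then (if h : p < deg then m ⟨p, h⟩ else 0) else σ.2.2.2 p j)
  output σ := upd σ.1 {e | ∃ p < σ.2.1, e ∈ dec (σ.2.2.2 p)}

theorem run_gather {α β E : Type} {B : ℕ} (enc : Set E → ℕ → BitVec B)
    (dec : (ℕ → BitVec B) → Set E) (s : α → Set E) (upd : α → Set E → β) {V : Type}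
    {G : SimpleGraph V} (P : PortNumbering G) (x : V → α) (t : ℕ) :
    ∀ v, ∃ buf : ℕ → ℕ → BitVec B, (gather enc dec s upd).run P x t v = (x v, P.deg v, t, buf) ∧
      ∀ i : Fin (P.deg v), ∀ j < t, buf i j = enc (s (x (P.nbr v i))) j := by
  induction t with
  | zero => exact fun v => ⟨_, rfl, fun _ _ h => absurd h (Nat.not_lt_zero _)⟩
  | succ t ih =>
    choose buf h1 h2 using ih
    intro v
    simp only [run, h1]
    refine ⟨_, rfl, fun i j hj => ?_⟩
    by_cases h : j = t
    · subst h
      simp [gather]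
    · simp only [h, if_false]
      exact h2 v i j (by omega)

end CongestAlgorithm

theorem Realizable.gather {α β E : Type} [Finite E] {B b K : ℕ} (hB : 1 ≤ B)
    (hE : Nat.card E ≤ 2 ^ (b * B)) (s : α → Set E) (upd : α → Set E → β) :
    Realizable B (K * (b + 1)) (NetMap.gather K s upd) := by
  obtain ⟨enc, dec, h⟩ := exists_set_code (K := K) hB hE
  refine ⟨CongestAlgorithm.gather enc dec (fun a => cap K (s a)) upd, fun V G P x => ?_⟩
  funext v
  obtain ⟨buf, h1, h2⟩ := CongestAlgorithm.run_gather enc dec (fun a => cap K (s a)) upd P x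
    (K * (b + 1)) v
  simp only [CongestAlgorithm.result, h1]
  have key : ∀ i : Fin (P.deg v), dec (buf i) = cap K (s (x (P.nbr v i))) := fun i =>
    h _ (ncard_cap_le _ _) _ (h2 i)
  have e : {e | ∃ p < P.deg v, e ∈ dec (buf p)} =
      {e | ∃ u, G.Adj v u ∧ e ∈ cap K (s (x u))} := by
    ext e
    constructor
    · rintro ⟨p, hp, he⟩
      have := key ⟨p, hp⟩
      simp only at this
      rw [this] at he
      exact ⟨_, (P.nbr v ⟨p, hp⟩).2, he⟩
    · rintro ⟨u, hu, he⟩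
      refine ⟨(P.nbr v).symm ⟨u, hu⟩, Fin.is_lt _, ?_⟩
      rw [key]
      simpa using he
  simp only [CongestAlgorithm.gather, NetMap.gather, e]

/-! ### The `D` smallest elements of a set -/

/-- A total order on a finite type that refines the order of the keys `f`. -/
noncomputable def rank {X ω : Type} [Finite X] (f : X → ω) (e : X) : ω ×ₗ Fin (Nat.card X) :=
  toLex (f e, Finite.equivFin X e)

/-- The `D` elements of `s` with the smallest keys. -/
def trunc {X ω : Type} [Finite X] [LinearOrder ω] (D : ℕ) (f : X → ω) (s : Set X) : Set X :=
  {e ∈ s | {e' ∈ s | rank f e' < rank f e}.ncard < D}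

theorem ncard_labelled_le {W X : Type} [Finite W] [Finite X] {D : ℕ} (Λ : Set W) (F : W → Set X)
    (hF : ∀ l ∈ Λ, (F l).ncard ≤ D) : {p : W × X | p.1 ∈ Λ ∧ p.2 ∈ F p.1}.ncard ≤ Λ.ncard * D := by
  classical
  have := Fintype.ofFinite W
  have := Fintype.ofFinite X
  have e : {p : W × X | p.1 ∈ Λ ∧ p.2 ∈ F p.1} =
      (Λ.toFinset.biUnion fun l => (F l).toFinset.image fun a => (l, a) : Finset (W × X)) := by
    ext ⟨l, a⟩
    simp [and_comm]
  rw [e, Set.ncard_coe_finset, Set.ncard_eq_toFinset_card']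
  refine Finset.card_biUnion_le_card_mul _ _ _ fun l hl => Finset.card_image_le.trans ?_
  rw [← Set.ncard_eq_toFinset_card']
  exact hF l (Set.mem_toFinset.1 hl)

section trunc

variable {X ω : Type} [Finite X]

theorem rank_injective (f : X → ω) : Function.Injective (rank f) := by
  intro a b h
  have := congrArg (fun p => (ofLex p).2) h
  exact (Finite.equivFin X).injective this

variable [LinearOrder ω] {D : ℕ} {f : X → ω} {s t : Set X}

theorem key_le_of_rank_lt {a b : X} (h : rank f a < rank f b) : f a ≤ f b := by
  rcases Prod.Lex.lt_iff.1 h with h | h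
  · exact le_of_lt h
  · exact le_of_eq h.1

theorem trunc_subset (D : ℕ) (f : X → ω) (s : Set X) : trunc D f s ⊆ s := fun _ h => h.1

theorem ncard_trunc_le (D : ℕ) (f : X → ω) (s : Set X) : (trunc D f s).ncard ≤ D := by
  by_cases hne : (trunc D f s).Nonempty
  · obtain ⟨e, he, hmax⟩ := Set.exists_max_image (trunc D f s) (rank f) (Set.toFinite _) hne
    have h1 : trunc D f s ⊆ insert e {e' ∈ s | rank f e' < rank f e} := by
      intro a ha
      by_cases hae : a = e
      · exact Or.inl hae
      · exact Or.inr ⟨ha.1, lt_of_le_of_ne (hmax a ha) fun h => hae (rank_injective f h)⟩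
    have h2 := Set.ncard_le_ncard h1 (Set.toFinite _)
    have h3 := Set.ncard_insert_le e {e' ∈ s | rank f e' < rank f e}
    have h4 := he.2
    omega
  · rw [Set.not_nonempty_iff_eq_empty.1 hne]; simp

theorem trunc_eq_self (h : s.ncard ≤ D) : trunc D f s = s := by
  refine Set.Subset.antisymm (trunc_subset _ _ _) fun e he => ⟨he, lt_of_lt_of_le ?_ h⟩
  refine Set.ncard_lt_ncard ⟨fun a ha => ha.1, fun hs => ?_⟩ (Set.toFinite _)
  exact lt_irrefl _ (hs he).2

theorem mem_trunc_of_rank_lt {a b : X} (ha : a ∈ s) (hb : b ∈ trunc D f s)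
    (h : rank f a < rank f b) : a ∈ trunc D f s := by
  refine ⟨ha, lt_of_le_of_lt (Set.ncard_le_ncard ?_ (Set.toFinite _)) hb.2⟩
  exact fun c hc => ⟨hc.1, hc.2.trans h⟩

/-- The first dropped element has at least `D` predecessors in `s`, and all of them are kept. -/
theorem le_ncard_trunc (h : D ≤ s.ncard) : D ≤ (trunc D f s).ncard := by
  by_cases hne : (s \ trunc D f s).Nonempty
  · obtain ⟨e, he, hmin⟩ := Set.exists_min_image _ (rank f) (Set.toFinite _) hne
    have h1 : D ≤ {e' ∈ s | rank f e' < rank f e}.ncard := by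
      by_contra hlt
      exact he.2 ⟨he.1, not_le.1 hlt⟩
    refine h1.trans (Set.ncard_le_ncard ?_ (Set.toFinite _))
    intro a ha
    by_contra hn
    exact not_le_of_gt ha.2 (hmin a ⟨ha.1, hn⟩)
  · have : s ⊆ trunc D f s := by
      intro a ha
      by_contra hn
      exact hne ⟨a, ha, hn⟩
    exact h.trans (Set.ncard_le_ncard this (Set.toFinite _))

/-- If fewer than `D` elements below a threshold are kept, then none of them was dropped. -/
theorem mem_trunc_of_ncard_lt {P : X → Prop} (hP : ∀ a b, f a ≤ f b → P b → P a)
    (h : {e ∈ trunc D f s | P e}.ncard < D) {e : X} (he : e ∈ s) (hPe : P e) :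
    e ∈ trunc D f s := by
  by_contra hn
  have h1 : D ≤ {e' ∈ s | rank f e' < rank f e}.ncard := by
    by_contra hlt
    exact hn ⟨he, not_le.1 hlt⟩
  have h2 := le_ncard_trunc (f := f) h1
  refine absurd (h2.trans (Set.ncard_le_ncard ?_ (Set.toFinite _))) (not_le.2 h)
  intro a ha
  have ha' := ha.1
  refine ⟨⟨ha'.1, lt_of_le_of_lt (Set.ncard_le_ncard ?_ (Set.toFinite _)) ha.2⟩,
    hP a e (key_le_of_rank_lt ha'.2) hPe⟩
  exact fun c hc => ⟨⟨hc.1, hc.2.trans ha'.2⟩, hc.2⟩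

theorem mem_trunc_of_ncard_le {P : X → Prop} (hP : ∀ a b, f a ≤ f b → P b → P a)
    (h : {e ∈ s | P e}.ncard ≤ D) {e : X} (he : e ∈ s) (hPe : P e) : e ∈ trunc D f s := by
  refine ⟨he, lt_of_lt_of_le (Set.ncard_lt_ncard ⟨?_, fun hs => ?_⟩ (Set.toFinite _)) h⟩
  · exact fun a ha => ⟨ha.1, hP a e (key_le_of_rank_lt ha.2) hPe⟩
  · exact lt_irrefl _ (hs ⟨he, hPe⟩).2

theorem trunc_eq_trunc (hst : s ⊆ t) (h : trunc D f t ⊆ s) : trunc D f s = trunc D f t := by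
  ext e
  constructor
  · intro he
    refine ⟨hst he.1, ?_⟩
    by_contra hlt
    have h2 := le_ncard_trunc (f := f) (not_lt.1 hlt)
    refine absurd (h2.trans (Set.ncard_le_ncard ?_ (Set.toFinite _))) (not_le.2 he.2)
    intro a ha
    refine ⟨h ⟨ha.1.1, lt_of_le_of_lt (Set.ncard_le_ncard ?_ (Set.toFinite _)) ha.2⟩, ha.1.2⟩
    exact fun c hc => ⟨⟨hc.1, hc.2.trans ha.1.2⟩, hc.2⟩
  · intro he
    refine ⟨h he, lt_of_le_of_lt (Set.ncard_le_ncard ?_ (Set.toFinite _)) he.2⟩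
    exact fun c hc => ⟨hst hc.1, hc.2⟩

/-- An element that is dropped from some `A i` has `D` predecessors there, hence also in the union.
Relays may therefore truncate at every hop without affecting the final result. -/
theorem trunc_trunc_union {ι : Type} (p : ι → Prop) (A : ι → Set X) :
    trunc D f {e | ∃ i, p i ∧ e ∈ trunc D f (A i)} = trunc D f {e | ∃ i, p i ∧ e ∈ A i} := by
  refine trunc_eq_trunc (fun e ⟨i, hi, he⟩ => ⟨i, hi, he.1⟩) ?_
  rintro e ⟨⟨i, hi, he⟩, hlt⟩
  refine ⟨i, hi, he, lt_of_le_of_lt (Set.ncard_le_ncard ?_ (Set.toFinite _)) hlt⟩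
  exact fun a ha => ⟨⟨i, hi, ha.1⟩, ha.2⟩

theorem ncard_labelled_trunc_le {W : Type} [Finite W] (Λ : Set W) (A : W → Set X) :
    {p : W × X | p.1 ∈ Λ ∧ p.2 ∈ trunc D f (A p.1)}.ncard ≤ Λ.ncard * D :=
  ncard_labelled_le Λ _ fun _ _ => ncard_trunc_le _ _ _

end trunc

/-! ### Flooding -/

/-- There is a walk of length at most `T` from `v` to `u` within the set `U`. -/
def Within {V : Type} (G : SimpleGraph V) (U : Set V) (T : ℕ) (v u : V) : Prop :=
  ∃ p : G.Walk v u, p.length ≤ T ∧ ∀ w ∈ p.support, w ∈ U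

namespace Within

variable {V : Type} {G : SimpleGraph V} {U : Set V} {T T' : ℕ} {u v w : V}

theorem symm (h : Within G U T v u) : Within G U T u v := by
  obtain ⟨p, h1, h2⟩ := h
  exact ⟨p.reverse, by simpa using h1, fun w hw => h2 w (by simpa using hw)⟩

theorem trans (h : Within G U T u v) (h' : Within G U T' v w) : Within G U (T + T') u w := by
  obtain ⟨p, h1, h2⟩ := h
  obtain ⟨p', h1', h2'⟩ := h'
  refine ⟨p.append p', by simp; omega, fun a ha => ?_⟩
  rcases (SimpleGraph.Walk.mem_support_append_iff _ _).1 ha with ha | ha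
  · exact h2 a ha
  · exact h2' a ha

theorem mono {U' : Set V} (h : Within G U T u v) (hU : ∀ w, w ∈ U → w ∈ U') (hT : T ≤ T') :
    Within G U' T' u v := by
  obtain ⟨p, h1, h2⟩ := h
  exact ⟨p, h1.trans hT, fun w hw => hU w (h2 w hw)⟩

theorem left_mem (h : Within G U T u v) : u ∈ U := by
  obtain ⟨p, -, h2⟩ := h
  exact h2 u p.start_mem_support

theorem right_mem (h : Within G U T u v) : v ∈ U := h.symm.left_mem

theorem refl (hv : v ∈ U) (T : ℕ) : Within G U T v v :=
  ⟨.nil, by simp, by simpa using hv⟩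

theorem cons (h : G.Adj u v) (hu : u ∈ U) (h' : Within G U T v w) : Within G U (T + 1) u w := by
  obtain ⟨p, h1, h2⟩ := h'
  refine ⟨.cons h p, by simpa using h1, fun a ha => ?_⟩
  rw [SimpleGraph.Walk.support_cons, List.mem_cons] at ha
  rcases ha with rfl | ha
  · exact hu
  · exact h2 a ha

theorem zero_iff : Within G U 0 u v ↔ u = v ∧ u ∈ U := by
  constructor
  · intro h
    have hu := h.left_mem
    obtain ⟨p, h1, h2⟩ := h
    exact ⟨SimpleGraph.Walk.eq_of_length_eq_zero (Nat.le_zero.1 h1), hu⟩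
  · rintro ⟨rfl, h⟩
    exact refl h 0

/-- One round of flooding in terms of walks: either the old horizon suffices, or the first edge is
peeled off. -/
theorem succ_iff : Within G U (T + 1) u v ↔
    u ∈ U ∧ (Within G U T u v ∨ ∃ w, G.Adj u w ∧ Within G U T w v) := by
  constructor
  · intro h
    refine ⟨h.left_mem, ?_⟩
    obtain ⟨p, h1, h2⟩ := h
    cases p with
    | nil => exact Or.inl ⟨.nil, by simp, h2⟩
    | cons h p =>
      refine Or.inr ⟨_, h, p, by simpa using h1, fun a ha => h2 a ?_⟩
      rw [SimpleGraph.Walk.support_cons]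
      exact List.mem_cons_of_mem _ ha
  · rintro ⟨hu, h | ⟨w, hw, h⟩⟩
    · exact h.mono (fun _ h => h) (by omega)
    · exact cons hw hu h

theorem univ_iff_edist_le : Within G Set.univ T u v ↔ G.edist u v ≤ T := by
  constructor
  · rintro ⟨p, h1, -⟩
    exact (SimpleGraph.Walk.edist_le p).trans (by exact_mod_cast h1)
  · intro h
    obtain ⟨p, hp⟩ := SimpleGraph.exists_walk_of_edist_ne_top
      (ne_top_of_le_ne_top (ENat.natCast_ne_top T) h)
    refine ⟨p, ?_, fun _ _ => trivial⟩
    rw [← hp] at h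
    exact_mod_cast h

end Within

section flood

variable {α W X ω : Type} [Finite X] [LinearOrder ω]

/-- The data that a node holds for the labels it relays. -/
def relayed (rel : Set W) (D : ℕ) (f : X → ω) (y : Set (W × X)) : Set (W × X) :=
  {p | p.1 ∈ rel ∧ p.2 ∈ trunc D f {e | (p.1, e) ∈ y}}

/-- One round of flooding: for every label that a node relays, it learns what its neighbors that
relay this label know. -/
noncomputable def floodStep (rel : α → Set W) (D K : ℕ) (f : X → ω) :
    NetMap (α × Set (W × X)) (α × Set (W × X)) :=
  NetMap.gather K Prod.snd fun a r => (a.1, relayed (rel a.1) D f (a.2 ∪ r))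

/-- Flooding for `T` rounds. -/
noncomputable def flood (rel : α → Set W) (init : α → Set (W × X)) (D K : ℕ) (f : X → ω) (T : ℕ) :
    NetMap α (α × Set (W × X)) :=
  (NetMap.ofLocal fun a => (a, relayed (rel a) D f (init a))).andThen
    (NetMap.chain (fun _ => floodStep rel D K f) T)

theorem card_prod_le {E E' : Type} [Finite E] [Finite E'] {b b' B : ℕ}
    (h : Nat.card E ≤ 2 ^ (b * B)) (h' : Nat.card E' ≤ 2 ^ (b' * B)) :
    Nat.card (E × E') ≤ 2 ^ ((b + b') * B) := by
  rw [Nat.card_prod, add_mul, pow_add]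
  exact Nat.mul_le_mul h h'

theorem Realizable.flood [Finite W] {B b : ℕ} (hB : 1 ≤ B) (hW : Nat.card W ≤ 2 ^ (1 * B))
    (hX : Nat.card X ≤ 2 ^ (b * B)) (rel : α → Set W) (init : α → Set (W × X)) (D K : ℕ)
    (f : X → ω) (T : ℕ) :
    Realizable B (T * (K * (b + 2))) (flood rel init D K f T) := by
  have := (ofLocal (B := B) (fun a => (a, relayed (rel a) D f (init a))) 0).andThen
    (chain (fun _ => gather (K := K) hB (card_prod_le hW hX) Prod.snd
      fun (a : α × Set (W × X)) r => (a.1, relayed (rel a.1) D f (a.2 ∪ r))) T)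
  rw [Nat.zero_add] at this
  exact this.mono (le_of_eq (by ring))

/-- The assumption `hK` ensures that `cap` never discards a message. A round then forms the union
over the node and its relaying neighbors, and `trunc_trunc_union` removes the intermediate
truncations. -/
theorem flood_apply [Finite W] {V : Type} (G : SimpleGraph V) (rel : α → Set W)
    (init : α → Set (W × X)) (D K : ℕ) (f : X → ω) (T : ℕ) (x : V → α)
    (hK : ∀ v, (rel (x v)).ncard * D ≤ K) (v : V) :
    flood rel init D K f T V G x v = (x v, {p | p.1 ∈ rel (x v) ∧ p.2 ∈ trunc D f
      {e | ∃ u, Within G {w | p.1 ∈ rel (x w)} T v u ∧ (p.1, e) ∈ init (x u)}}) := by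
  induction T generalizing v with
  | zero =>
    simp only [flood, NetMap.andThen, NetMap.chain, NetMap.ofLocal, relayed, Prod.mk.injEq,
      true_and]
    ext ⟨l, e⟩
    simp only [Set.mem_ofPred_eq]
    refine and_congr_right fun hl => ?_
    have : {e | (l, e) ∈ init (x v)} =
        {e | ∃ u, Within G {w | l ∈ rel (x w)} 0 v u ∧ (l, e) ∈ init (x u)} := by
      ext e
      simp [Within.zero_iff, hl]
    rw [this]
  | succ T ih =>
    have step : flood rel init D K f (T + 1) V G x v =
        floodStep rel D K f V G (flood rel init D K f T V G x) v := rfl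
    rw [step]
    have hcap : ∀ u, cap K (flood rel init D K f T V G x u).2 =
        (flood rel init D K f T V G x u).2 := fun u => cap_of_le (by
      rw [ih]
      exact (ncard_labelled_trunc_le (rel (x u)) (fun l => {e | ∃ w,
        Within G {w | l ∈ rel (x w)} T u w ∧ (l, e) ∈ init (x w)})).trans (hK u))
    simp only [floodStep, NetMap.gather, hcap]
    simp only [ih, relayed, Prod.mk.injEq, true_and]
    ext ⟨l, e⟩
    simp only [Set.mem_ofPred_eq]
    refine and_congr_right fun hl => ?_
    set A : V → Set X := fun u =>
      {e | ∃ w, Within G {w | l ∈ rel (x w)} T u w ∧ (l, e) ∈ init (x w)} with hA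
    have e1 : {e | (l, e) ∈ {p : W × X | p.1 ∈ rel (x v) ∧ p.2 ∈ trunc D f
          {e | ∃ u, Within G {w | p.1 ∈ rel (x w)} T v u ∧ (p.1, e) ∈ init (x u)}} ∪
        {e | ∃ u, G.Adj v u ∧ e.1 ∈ rel (x u) ∧ e.2 ∈ trunc D f
          {a | ∃ w, Within G {w | e.1 ∈ rel (x w)} T u w ∧ (e.1, a) ∈ init (x w)}}} =
        {e | ∃ u, (u = v ∨ G.Adj v u) ∧ e ∈ trunc D f (A u)} := by
      ext e
      simp only [Set.mem_union, Set.mem_ofPred_eq, hl, true_and]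
      constructor
      · rintro (h | ⟨u, hu, -, h⟩)
        · exact ⟨v, Or.inl rfl, h⟩
        · exact ⟨u, Or.inr hu, h⟩
      · rintro ⟨u, rfl | hu, h⟩
        · exact Or.inl h
        · obtain ⟨w, hw, -⟩ := h.1
          exact Or.inr ⟨u, hu, hw.left_mem, h⟩
    have e2 : {e | ∃ u, (u = v ∨ G.Adj v u) ∧ e ∈ A u} =
        {e | ∃ u, Within G {w | l ∈ rel (x w)} (T + 1) v u ∧ (l, e) ∈ init (x u)} := by
      ext e
      simp only [Set.mem_ofPred_eq, hA, Within.succ_iff, hl, true_and]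
      constructor
      · rintro ⟨u, rfl | hu, w, h1, h2⟩
        · exact ⟨w, Or.inl h1, h2⟩
        · exact ⟨w, Or.inr ⟨u, hu, h1⟩, h2⟩
      · rintro ⟨w, h1 | ⟨u, hu, h1⟩, h2⟩
        · exact ⟨v, Or.inl rfl, w, h1, h2⟩
        · exact ⟨u, Or.inr hu, w, h1, h2⟩
    rw [e1, trunc_trunc_union, e2]

/-- Flooding to distance `T` in the whole network. -/
noncomputable def ballFlood (emit : α → Set X) (D : ℕ) (f : X → ω) (T : ℕ) : NetMap α (α × Set X) :=
  (flood (fun _ => (Set.univ : Set Unit)) (fun a => {p | p.2 ∈ emit a}) D D f T).andThen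
    (NetMap.ofLocal fun a => (a.1, {e | ((), e) ∈ a.2}))

theorem Realizable.ballFlood {B b : ℕ} (hB : 1 ≤ B) (hX : Nat.card X ≤ 2 ^ (b * B))
    (emit : α → Set X) (D : ℕ) (f : X → ω) (T : ℕ) :
    Realizable B (T * (D * (b + 2))) (ballFlood emit D f T) :=
  (Realizable.flood hB (by simp [Nat.one_le_two_pow]) hX _ _ D D f T).andThen (ofLocal _ 0)

theorem ballFlood_apply {V : Type} (G : SimpleGraph V) (emit : α → Set X) (D : ℕ) (f : X → ω)
    (T : ℕ) (x : V → α) (v : V) :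
    ballFlood emit D f T V G x v =
      (x v, trunc D f {e | ∃ u, G.edist v u ≤ T ∧ e ∈ emit (x u)}) := by
  simp only [ballFlood, NetMap.andThen, NetMap.ofLocal]
  rw [flood_apply G _ _ D D f T x (by simp)]
  simp [Within.univ_iff_edist_le]

end flood

/-! ### Clusters with relays -/

/-- The local data of a node: its own identifier, the label of its cluster, the labels of the
clusters for which it forwards messages, and data that is shared by the nodes of a cluster. -/
structure Node (W κ : Type) where
  me : W
  lab : W
  rel : Set W
  dat : κ

/-- The local data of all nodes, where the cluster with label `A` holds the data `K A`. -/
def config {V W κ : Type} (me lab : V → W) (rel : V → Set W) (K : W → κ) (v : V) : Node W κ :=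
  ⟨me v, lab v, rel v, K (lab v)⟩

/-- Replace the data of the cluster. -/
def Node.setDat {W κ κ' : Type} (a : Node W κ) (k : κ') : Node W κ' := ⟨a.me, a.lab, a.rel, k⟩

/-- The clusters are connected in `G^k`, with radius at most `ρ` around their leaders. The nodes that
relay a label form a connected subgraph of `G`, with radius at most `R` around the leader. Each node
relays at most `L` labels. -/
structure ClusterInv {V W : Type} (G : SimpleGraph V) (k R ρ L : ℕ) (ldr : W → V) (lab : V → W)
    (rel : V → Set W) : Prop where
  lab_mem : ∀ v, lab v ∈ rel v
  lab_ldr : ∀ v, ∀ l ∈ rel v, lab (ldr l) = l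
  relay : ∀ v, ∀ l ∈ rel v, Within G {w | l ∈ rel w} R (ldr l) v
  strong : ∀ v, Within (powerGraph G k) {w | lab w = lab v} ρ (ldr (lab v)) v
  card_le : ∀ v, (rel v).ncard ≤ L

/-- Two clusters contain nodes at distance at most `k`. -/
def Near {V W : Type} (G : SimpleGraph V) (k : ℕ) (lab : V → W) (A A' : W) : Prop :=
  ∃ v w, lab v = A ∧ lab w = A' ∧ G.edist v w ≤ k

theorem Near.symm {V W : Type} {G : SimpleGraph V} {k : ℕ} {lab : V → W} {A A' : W}
    (h : Near G k lab A A') : Near G k lab A' A := by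
  obtain ⟨v, w, h1, h2, h3⟩ := h
  exact ⟨w, v, h2, h1, by rwa [SimpleGraph.edist_comm]⟩

theorem near_self {V W : Type} {G : SimpleGraph V} {k : ℕ} {lab : V → W} (v : V) :
    Near G k lab (lab v) (lab v) := ⟨v, v, rfl, rfl, by simp⟩

theorem ClusterInv.mono {V W : Type} {G : SimpleGraph V} {k R R' ρ ρ' L L' : ℕ} {ldr : W → V}
    {lab : V → W} {rel : V → Set W} (h : ClusterInv G k R ρ L ldr lab rel) (hR : R ≤ R')
    (hρ : ρ ≤ ρ') (hL : L ≤ L') : ClusterInv G k R' ρ' L' ldr lab rel where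
  lab_mem := h.lab_mem
  lab_ldr := h.lab_ldr
  relay v l hl := (h.relay v l hl).mono (fun _ h => h) hR
  strong v := (h.strong v).mono (fun _ h => h) hρ
  card_le v := (h.card_le v).trans hL

/-- Any two relays of a label are joined through the leader, so `2 * R` rounds of flooding reach
exactly the relays. -/
theorem ClusterInv.within_iff {V W : Type} {G : SimpleGraph V} {k R ρ L : ℕ} {ldr : W → V}
    {lab : V → W} {rel : V → Set W} (h : ClusterInv G k R ρ L ldr lab rel) {l : W} {v u : V}
    (hv : l ∈ rel v) : Within G {w | l ∈ rel w} (2 * R) v u ↔ l ∈ rel u := by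
  constructor
  · exact fun h => h.right_mem
  · intro hu
    have := (h.relay v l hv).symm.trans (h.relay u l hu)
    exact this.mono (fun _ h => h) (by omega)

section clusterRound

variable {W X ω κ κ' : Type} [Finite X] [LinearOrder ω]

/-- Every cluster learns the `D` smallest elements of the sets emitted by the clusters near to
it. -/
noncomputable def clusterRound (k R L D : ℕ) (f : X → ω) (emit : W → κ → Set X)
    (upd : W → κ → Set X → κ') : NetMap (Node W κ) (Node W κ') :=
  (ballFlood (fun a : Node W κ => emit a.lab a.dat) D f k).andThen
    ((flood (fun a : Node W κ × Set X => a.1.rel) (fun a => {p | p.1 = a.1.lab ∧ p.2 ∈ a.2}) D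
        (L * D) f (2 * R)).andThen
      (NetMap.ofLocal fun a =>
        a.1.1.setDat (upd a.1.1.lab a.1.1.dat {e | (a.1.1.lab, e) ∈ a.2})))

theorem Realizable.clusterRound [Finite W] {B b : ℕ} (hB : 1 ≤ B) (hW : Nat.card W ≤ 2 ^ (1 * B))
    (hX : Nat.card X ≤ 2 ^ (b * B)) (k R L D : ℕ) (f : X → ω) (emit : W → κ → Set X)
    (upd : W → κ → Set X → κ') :
    Realizable B (k * (D * (b + 2)) + 2 * R * (L * D * (b + 2)))
      (clusterRound k R L D f emit upd) :=
  (Realizable.ballFlood hB hX _ D f k).andThen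
    ((Realizable.flood hB hW hX _ _ D (L * D) f (2 * R)).andThen (ofLocal _ 0))

/-- Flooding to distance `k` in `G` brings the items to some node of the cluster, and flooding among
the relays spreads them over the whole cluster. Every node thus obtains the same set, and the data
remain a function of the label. -/
theorem clusterRound_config [Finite W] {V : Type} {G : SimpleGraph V} {k R ρ L : ℕ} {ldr : W → V}
    {me lab : V → W} {rel : V → Set W} (h : ClusterInv G k R ρ L ldr lab rel) (D : ℕ) (f : X → ω)
    (emit : W → κ → Set X) (upd : W → κ → Set X → κ') (K : W → κ) :
    clusterRound k R L D f emit upd V G (config me lab rel K) =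
      config me lab rel fun A => upd A (K A)
        (trunc D f {e | ∃ A', Near G k lab A A' ∧ e ∈ emit A' (K A')}) := by
  funext v
  simp only [clusterRound, NetMap.andThen, NetMap.ofLocal]
  have hb := ballFlood_apply G (fun a : Node W κ => emit a.lab a.dat) D f k (config me lab rel K)
  rw [flood_apply G _ _ D (L * D) f (2 * R) _
    (fun v => by rw [hb]; exact Nat.mul_le_mul_right _ (h.card_le v))]
  simp only [hb]
  simp only [config, Node.setDat, Node.mk.injEq, true_and, Set.mem_ofPred_eq, h.lab_mem]
  congr 1
  have e1 : {e | ∃ u, Within G {w | lab v ∈ rel w} (2 * R) v u ∧ lab v = lab u ∧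
        e ∈ trunc D f {e | ∃ w, G.edist u w ≤ k ∧ e ∈ emit (lab w) (K (lab w))}} =
      {e | ∃ u, lab v = lab u ∧
        e ∈ trunc D f {e | ∃ w, G.edist u w ≤ k ∧ e ∈ emit (lab w) (K (lab w))}} := by
    ext e
    simp only [Set.mem_ofPred_eq]
    refine exists_congr fun u => ?_
    rw [h.within_iff (h.lab_mem v)]
    constructor
    · exact fun h => h.2
    · exact fun hu => ⟨by rw [hu.1]; exact h.lab_mem u, hu⟩
  have e2 : {e | ∃ u, lab v = lab u ∧
        e ∈ {e | ∃ w, G.edist u w ≤ k ∧ e ∈ emit (lab w) (K (lab w))}} =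
      {e | ∃ A', Near G k lab (lab v) A' ∧ e ∈ emit A' (K A')} := by
    ext e
    constructor
    · rintro ⟨u, hu, w, hw, he⟩
      exact ⟨lab w, ⟨u, w, hu.symm, rfl, hw⟩, he⟩
    · rintro ⟨A', ⟨u, w, h1, rfl, h3⟩, he⟩
      exact ⟨u, h1.symm, w, h3, he⟩
  exact (congrArg (trunc D f) e1).trans ((trunc_trunc_union _ _).trans (congrArg (trunc D f) e2))

end clusterRound

/-! ### Growing clusters -/

/-- The status of a cluster: it takes part in the construction (`source`), it gets a color unless it
is absorbed by another cluster (`pending`), or it has got a color (`done`). -/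
inductive Status
  | source
  | pending (c : ℕ)
  | done (c : ℕ)

section voronoi

variable {W : Type} [Finite W] [LinearOrder W]

open Classical in
/-- Every node without a region joins the region of a neighbor. -/
noncomputable def voronoiStep (α : Type) : NetMap (α × Set W) (α × Set W) :=
  NetMap.gather 1 Prod.snd fun a r => (a.1, if a.2.Nonempty then a.2 else trunc 1 id r)

open Classical in
/-- Regions of radius `T` around the nodes of the source clusters. -/
noncomputable def voronoi (T : ℕ) : NetMap (Node W Status) (Node W Status × Set W) :=
  (NetMap.ofLocal fun a => (a, if a.dat = .source then {a.lab} else ∅)).andThen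
    (NetMap.chain (fun _ => voronoiStep (Node W Status)) T)

theorem Realizable.voronoi {B : ℕ} (hB : 1 ≤ B) (hW : Nat.card W ≤ 2 ^ (1 * B)) (T : ℕ) :
    Realizable B (T * 2) (voronoi (W := W) T) := by
  have := (ofLocal (B := B) (fun a : Node W Status => (a, open Classical in
    if a.dat = .source then ({a.lab} : Set W) else ∅)) 0).andThen
    (chain (fun _ => gather (K := 1) hB hW Prod.snd
      fun (a : Node W Status × Set W) r => (a.1, open Classical in
        if a.2.Nonempty then a.2 else trunc 1 id r)) T)
  rwa [Nat.zero_add, one_mul] at this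

/-- A node enters the region of a neighbor and never leaves it, so the region of `c` contains a walk
of at most `T` edges from a source node of the cluster `c`. For `T = k` the ends of this walk, if
distinct, are adjacent in `G^k`. -/
theorem voronoi_apply {V : Type} (G : SimpleGraph V) (x : V → Node W Status) (T : ℕ) :
    ∃ reg : V → Set W, (∀ v, voronoi T V G x v = (x v, reg v)) ∧ (∀ v, (reg v).ncard ≤ 1) ∧
      (∀ v, ∀ c ∈ reg v, ∃ w, (x w).dat = .source ∧ (x w).lab = c ∧
        Within G {u | c ∈ reg u} T w v) ∧
      ∀ v w, (x w).dat = .source → G.edist v w ≤ T → (reg v).Nonempty := by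
  classical
  induction T with
  | zero =>
    refine ⟨fun v => if (x v).dat = .source then {(x v).lab} else ∅, fun v => ?_, fun v => ?_,
      fun v c hc => ?_, fun v w hw h => ?_⟩
    · simp only [voronoi, NetMap.andThen, NetMap.chain, NetMap.ofLocal]
    · dsimp only
      split_ifs <;> simp
    · have hc' := hc
      dsimp only at hc'
      split_ifs at hc' with h
      · exact ⟨v, h, hc'.symm, Within.refl (U := {u | c ∈ _}) hc 0⟩
      · exact absurd hc' (Set.notMem_empty _)
    · rw [← Within.univ_iff_edist_le, Within.zero_iff] at h
      obtain ⟨rfl, -⟩ := h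
      simp [hw]
  | succ T ih =>
    obtain ⟨reg, h1, h2, h3, h4⟩ := ih
    set rec : V → Set W := fun v => {e | ∃ u, G.Adj v u ∧ e ∈ reg u} with hrec
    have step : ∀ v, voronoi (T + 1) V G x v =
        (x v, if (reg v).Nonempty then reg v else trunc 1 id (rec v)) := by
      intro v
      have : voronoi (T + 1) V G x v = voronoiStep _ V G (voronoi T V G x) v := rfl
      rw [this]
      simp only [voronoiStep, NetMap.gather, h1, cap_of_le (h2 _)]
      rfl
    have hsub : ∀ v c, c ∈ reg v →
        c ∈ (if (reg v).Nonempty then reg v else trunc 1 id (rec v)) := by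
      intro v c hc
      rwa [if_pos ⟨c, hc⟩]
    refine ⟨fun v => if (reg v).Nonempty then reg v else trunc 1 id (rec v), step, fun v => ?_,
      fun v c hc => ?_, fun v w hw h => ?_⟩
    · dsimp only
      split_ifs
      · exact h2 v
      · exact ncard_trunc_le _ _ _
    · have hc' := hc
      dsimp only at hc'
      split_ifs at hc' with h
      · obtain ⟨w, hw1, hw2, hw3⟩ := h3 v c hc'
        exact ⟨w, hw1, hw2, hw3.mono (fun u hu => hsub u c hu) (by omega)⟩
      · obtain ⟨u, hu, hcu⟩ := hc'.1
        obtain ⟨w, hw1, hw2, hw3⟩ := h3 u c hcu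
        refine ⟨w, hw1, hw2, Within.symm (Within.cons hu hc ?_)⟩
        exact hw3.symm.mono (fun u hu => hsub u c hu) le_rfl
    · rw [← Within.univ_iff_edist_le, Within.succ_iff] at h
      rcases h.2 with h | ⟨u, hu, h⟩
      · have := h4 v w hw (Within.univ_iff_edist_le.1 h)
        obtain ⟨c, hc⟩ := this
        exact ⟨c, hsub v c hc⟩
      · by_cases hne : (reg v).Nonempty
        · simp [hne]
        · simp only [hne, if_false]
          obtain ⟨c, hc⟩ := h4 u w hw (Within.univ_iff_edist_le.1 h)
          have : 1 ≤ (rec v).ncard := (Set.ncard_pos (Set.toFinite _)).2 ⟨c, u, hu, hc⟩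
          exact (Set.ncard_pos (Set.toFinite _)).1 (le_ncard_trunc this)

end voronoi

open Classical in
/-- An element of `s`, or `a` if there is none. -/
noncomputable def pick {W : Type} (s : Set W) (a : W) : W :=
  if h : s.Nonempty then h.some else a

theorem pick_mem {W : Type} {s : Set W} (h : s.Nonempty) (a : W) : pick s a ∈ s := by
  rw [pick, dif_pos h]; exact h.some_mem

theorem pick_of_not {W : Type} {s : Set W} (h : ¬ s.Nonempty) (a : W) : pick s a = a := by
  rw [pick, dif_neg h]

open Classical in
/-- The new status of a cluster with status `k` that can join the source clusters in `s`. -/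
noncomputable def absorb {W : Type} (s : Set W) (k : Status) : Status :=
  if s.Nonempty then .source else k

section grow

variable {W : Type} [Finite W] [LinearOrder W]

/-- Every pending cluster at distance at most `k` from a source cluster is absorbed by a source
cluster. -/
noncomputable def grow (k R L : ℕ) : NetMap (Node W Status) (Node W Status) :=
  (voronoi k).andThen ((flood (fun a : Node W Status × Set W => a.1.rel)
      (fun a => {p | p.1 = a.1.lab ∧ (∃ c, a.1.dat = .pending c) ∧ p.2 ∈ a.2}) 1 L id
      (2 * R)).andThen
    (NetMap.ofLocal fun a =>
      ⟨a.1.1.me, pick {c | (a.1.1.lab, c) ∈ a.2} a.1.1.lab,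
        (fun l => pick {c | (l, c) ∈ a.2} l) '' a.1.1.rel ∪ a.1.2,
        absorb {c | (a.1.1.lab, c) ∈ a.2} a.1.1.dat⟩))

theorem Realizable.grow {B : ℕ} (hB : 1 ≤ B) (hW : Nat.card W ≤ 2 ^ (1 * B)) (k R L : ℕ) :
    Realizable B (k * 2 + 2 * R * (L * 3)) (grow (W := W) k R L) :=
  (Realizable.voronoi hB hW k).andThen
    ((Realizable.flood hB hW hW _ _ 1 L id (2 * R)).andThen (ofLocal _ 0))

/-- A pending cluster that meets a region is renamed to the source label of that region. The relays
of the new label are those of the source cluster, those of the absorbed clusters, and the region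
that links them. A walk from the leader crosses the source cluster and the region (`R + k`) and then
the absorbed cluster via its leader (`2 * R`). In `G^k` crossing the region is a single edge, hence
`3 * ρ + 1`. -/
theorem grow_config {V : Type} {G : SimpleGraph V} {k R R' ρ L L' : ℕ} {ldr : W → V}
    {me lab : V → W} {rel : V → Set W} (h : ClusterInv G k R ρ L ldr lab rel) (hR : R ≤ R')
    (hL : L ≤ L') (K : W → Status) :
    ∃ (nl : W → W) (rel' : V → Set W),
      grow k R' L' V G (config me lab rel K) = config me (fun v => nl (lab v)) rel' K ∧
      ClusterInv G k (3 * R + k) (3 * ρ + 1) (L + 1) ldr (fun v => nl (lab v)) rel' ∧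
      (∀ A, nl A ≠ A → (∃ c, K A = .pending c) ∧ K (nl A) = .source) ∧
      (∀ v w c, K (lab v) = .pending c → G.edist v w ≤ k → K (lab w) = .source →
        K (nl (lab v)) = .source) ∧
      ∀ v, ∃ w, nl (lab v) = lab w := by
  classical
  obtain ⟨reg, h1, h2, h3, h4⟩ := voronoi_apply G (config me lab rel K) k
  simp only [config] at h3 h4
  -- All relays of `l` compute the same set of at most one candidate, so they rename `l`
  -- consistently.
  set J : W → Set W := fun l =>
    trunc 1 id {c | (∃ c', K l = .pending c') ∧ ∃ u, lab u = l ∧ c ∈ reg u} with hJ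
  set nl : W → W := fun l => pick (J l) l with hnl
  have hjoin : ∀ l, nl l ≠ l → (∃ c, K l = .pending c) ∧ ∃ u, lab u = l ∧ nl l ∈ reg u := by
    intro l hl
    have hne : (J l).Nonempty := by
      by_contra hne
      exact hl (pick_of_not hne l)
    have := (pick_mem hne l).1
    exact this
  have hsrc : ∀ u c, c ∈ reg u → K c = .source := by
    intro u c hc
    obtain ⟨w, hw1, hw2, -⟩ := h3 u c hc
    rw [← hw2]; exact hw1
  have hfix : ∀ c, K c = .source → nl c = c := by
    intro c hc
    by_contra hne
    obtain ⟨⟨c', hc'⟩, -⟩ := hjoin c hne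
    rw [hc] at hc'
    cases hc'
  have hrelreg : ∀ u c, c ∈ reg u → lab (ldr c) = c ∧
      Within G {w | c ∈ nl '' rel w ∪ reg w} (R + k) (ldr c) u := by
    intro u c hc
    have hcs := hsrc u c hc
    obtain ⟨w, hw1, hw2, hw3⟩ := h3 u c hc
    have hw4 : c ∈ rel w := by rw [← hw2]; exact h.lab_mem w
    refine ⟨h.lab_ldr w c hw4, Within.trans ((h.relay w c hw4).mono ?_ le_rfl)
      (hw3.mono ?_ le_rfl)⟩
    · exact fun a ha => Or.inl ⟨c, ha, hfix c hcs⟩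
    · exact fun a ha => Or.inr ha
  refine ⟨nl, fun v => nl '' rel v ∪ reg v, ?_, ⟨?_, ?_, ?_, ?_, ?_⟩, ?_, ?_, ?_⟩
  · funext v
    simp only [grow, NetMap.andThen, NetMap.ofLocal]
    rw [flood_apply G _ _ 1 L' id (2 * R') _
      (fun v => by rw [h1, Nat.mul_one]; exact (h.card_le v).trans hL)]
    simp only [h1]
    simp only [config, Set.mem_ofPred_eq]
    have e1 : ∀ l ∈ rel v, {c | l ∈ rel v ∧ c ∈ trunc 1 id {e | ∃ u,
        Within G {w | l ∈ rel w} (2 * R') v u ∧ l = lab u ∧ (∃ c, K (lab u) = .pending c) ∧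
          e ∈ reg u}} = J l := by
      intro l hl
      have : {e | ∃ u, Within G {w | l ∈ rel w} (2 * R') v u ∧ l = lab u ∧
          (∃ c, K (lab u) = .pending c) ∧ e ∈ reg u} =
          {c | (∃ c', K l = .pending c') ∧ ∃ u, lab u = l ∧ c ∈ reg u} := by
        ext e
        constructor
        · rintro ⟨u, -, rfl, h5, h6⟩
          exact ⟨h5, u, rfl, h6⟩
        · rintro ⟨h5, u, rfl, h6⟩
          exact ⟨u, ((h.mono hR le_rfl le_rfl).within_iff hl).2 (h.lab_mem u), rfl, h5, h6⟩
      rw [this]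
      simp only [hl, true_and]
      rfl
    rw [e1 _ (h.lab_mem v)]
    have e2 : (fun l => pick {c | l ∈ rel v ∧ c ∈ trunc 1 id {e | ∃ u,
        Within G {w | l ∈ rel w} (2 * R') v u ∧ l = lab u ∧ (∃ c, K (lab u) = .pending c) ∧
          e ∈ reg u}} l) '' rel v = nl '' rel v :=
      Set.image_congr fun l hl => by rw [e1 l hl]
    rw [e2]
    simp only [Node.mk.injEq, true_and]
    refine ⟨rfl, ?_⟩
    unfold absorb
    split_ifs with hne
    · obtain ⟨-, u, -, hu⟩ := trunc_subset _ _ _ (pick_mem hne (lab v))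
      exact (hsrc u _ hu).symm
    · simp only [hnl, pick_of_not hne]
  · exact fun v => Or.inl ⟨_, h.lab_mem v, rfl⟩
  · rintro v l (⟨l, hl, rfl⟩ | hl)
    · by_cases hne : nl l = l
      · rw [hne, h.lab_ldr v l hl, hne]
      · obtain ⟨-, u, -, hu⟩ := hjoin l hne
        rw [(hrelreg u _ hu).1]
        exact hfix _ (hsrc u _ hu)
    · rw [(hrelreg v _ hl).1]
      exact hfix _ (hsrc v _ hl)
  · rintro v l (⟨l, hl, rfl⟩ | hl)
    · by_cases hne : nl l = l
      · rw [hne]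
        refine (h.relay v l hl).mono (fun w hw => Or.inl ⟨l, hw, hne⟩) (by omega)
      · obtain ⟨-, u, rfl, hu⟩ := hjoin l hne
        have hsub : ∀ w, w ∈ {w | lab u ∈ rel w} → w ∈ {w | nl (lab u) ∈ nl '' rel w ∪ reg w} :=
          fun w hw => Or.inl ⟨_, hw, rfl⟩
        have := ((hrelreg u _ hu).2.trans
          ((h.relay u _ (h.lab_mem u)).symm.mono hsub le_rfl)).trans
          ((h.relay v _ hl).mono hsub le_rfl)
        exact this.mono (fun _ h => h) (by omega)
    · exact (hrelreg v _ hl).2.mono (fun _ h => h) (by omega)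
  · intro v
    by_cases hne : nl (lab v) = lab v
    · rw [hne]
      exact (h.strong v).mono (fun w hw => show nl (lab w) = lab v by
        rw [show lab w = lab v from hw, hne]) (by omega)
    · obtain ⟨⟨c', hp⟩, u, hu1, hu2⟩ := hjoin _ hne
      obtain ⟨w, hw1, hw2, hw3⟩ := h3 u _ hu2
      set c := nl (lab v) with hc
      have hnc : nl c = c := hfix c (hsrc u _ hu2)
      have hwu : (powerGraph G k).Adj w u := by
        refine ⟨?_, ?_⟩
        · rintro rfl
          rw [hu1, hp] at hw1
          cases hw1
        · rw [← Within.univ_iff_edist_le]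
          exact hw3.mono (fun _ _ => trivial) le_rfl
      have hsub : ∀ a, a ∈ {a | lab a = lab v} → a ∈ {a | nl (lab a) = c} := fun a ha =>
        show nl (lab a) = c by rw [show lab a = lab v from ha]
      have s1 := (h.strong w).mono (U' := {a | nl (lab a) = c}) (fun a ha =>
        show nl (lab a) = c by rw [show lab a = lab w from ha, hw2, hnc]) le_rfl
      have s2 := (h.strong u)
      rw [hu1] at s2
      have s2' := (s2.mono hsub le_rfl)
      have s3 := (h.strong v).mono hsub le_rfl
      rw [hw2] at s1
      have := (s1.trans (Within.cons hwu s1.right_mem s2'.symm)).trans s3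
      exact this.mono (fun _ h => h) (by omega)
  -- Renaming does not increase the number of labels at a node, and the regions are disjoint, so at
  -- most one label is added.
  · intro v
    refine (Set.ncard_union_le _ _).trans (Nat.add_le_add ?_ (h2 v))
    exact (Set.ncard_image_le (Set.toFinite _)).trans (h.card_le v)
  · intro A hA
    obtain ⟨hp, u, -, hu⟩ := hjoin A hA
    exact ⟨hp, hsrc u _ hu⟩
  · intro v w c hv hvw hw
    obtain ⟨c', hc'⟩ := h4 v w hw hvw
    have hne : (J (lab v)).Nonempty := by
      have : 1 ≤ {c | (∃ c', K (lab v) = .pending c') ∧ ∃ u, lab u = lab v ∧ c ∈ reg u}.ncard :=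
        (Set.ncard_pos (Set.toFinite _)).2 ⟨c', ⟨c, hv⟩, v, rfl, hc'⟩
      exact (Set.ncard_pos (Set.toFinite _)).1 (le_ncard_trunc this)
    obtain ⟨-, u, -, hu⟩ := trunc_subset _ _ _ (pick_mem hne (lab v))
    exact hsrc u _ hu
  · intro v
    by_cases hne : nl (lab v) = lab v
    · exact ⟨v, hne⟩
    · obtain ⟨-, u, -, hu⟩ := hjoin _ hne
      obtain ⟨w, -, hw, -⟩ := h3 u _ hu
      exact ⟨w, hw.symm⟩

end grow

/-! ### Color reduction -/

open Polynomial in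
/-- The polynomial whose coefficients are the first `b` bits of `c`. -/
noncomputable def bitPoly (q b c : ℕ) : (ZMod q)[X] :=
  ∑ i ∈ Finset.range b, C (if c.testBit i then 1 else 0) * X ^ i

theorem coeff_bitPoly (q b c i : ℕ) :
    (bitPoly q b c).coeff i = if i < b ∧ c.testBit i then 1 else 0 := by
  simp only [bitPoly, Polynomial.finsetSum_coeff, Polynomial.coeff_C_mul_X_pow]
  rw [Finset.sum_ite_eq]
  simp only [Finset.mem_range]
  split_ifs <;> simp_all

theorem bitPoly_injOn {q b c c' : ℕ} (hq : q.Prime) (hc : c < 2 ^ b) (hc' : c' < 2 ^ b)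
    (h : bitPoly q b c = bitPoly q b c') : c = c' := by
  have := Fact.mk hq
  refine Nat.eq_of_testBit_eq fun i => ?_
  by_cases hi : i < b
  · have h1 := congrArg (fun p => p.coeff i) h
    simp only [coeff_bitPoly, hi, true_and] at h1
    by_cases h2 : c.testBit i <;> by_cases h3 : c'.testBit i <;> simp_all
  · have hb : 2 ^ b ≤ 2 ^ i := Nat.pow_le_pow_right (by norm_num) (not_lt.1 hi)
    rw [Nat.testBit_lt_two_pow (hc.trans_le hb), Nat.testBit_lt_two_pow (hc'.trans_le hb)]

theorem card_agree_le {q b c c' : ℕ} [Fact q.Prime] (hc : c < 2 ^ b) (hc' : c' < 2 ^ b)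
    (hne : c ≠ c') :
    (Finset.univ.filter fun x : ZMod q =>
      (bitPoly q b c).eval x = (bitPoly q b c').eval x).card ≤ b := by
  classical
  have hp : bitPoly q b c - bitPoly q b c' ≠ 0 := fun h =>
    hne (bitPoly_injOn Fact.out hc hc' (sub_eq_zero.1 h))
  have hdeg : (bitPoly q b c - bitPoly q b c').natDegree ≤ b := by
    rw [Polynomial.natDegree_le_iff_coeff_eq_zero]
    intro N hN
    simp [coeff_bitPoly, not_lt.2 hN.le]
  refine le_trans ?_ ((Polynomial.card_roots' _).trans hdeg)
  refine le_trans (Finset.card_le_card ?_) (Multiset.toFinset_card_le _)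
  intro x hx
  rw [Finset.mem_filter] at hx
  rw [Multiset.mem_toFinset, Polynomial.mem_roots hp]
  simp [hx.2]

/-- Linial's step: a color is read as a polynomial of degree at most `b`. It agrees with each of at
most `Δ` others in at most `b` points, so `Δ * b < q` leaves a point `x` where it differs from all
of them. The new color is the pair of `x` and the value at `x`, so equal new colors would force the
same point and the same value there. -/
theorem exists_recolor {b Δ q : ℕ} (hq : q.Prime) (hΔ : Δ * b < q) :
    ∃ φ : ℕ → Set ℕ → ℕ, (∀ c s, φ c s < q ^ 2) ∧ ∀ c c' s s', c < 2 ^ b →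
      (∀ a ∈ s, a < 2 ^ b) → s.ncard ≤ Δ → c' ∈ s → c ≠ c' → φ c s ≠ φ c' s' := by
  classical
  have := Fact.mk hq
  have hgood : ∀ c (s : Set ℕ), c < 2 ^ b → (∀ a ∈ s, a < 2 ^ b) → s.ncard ≤ Δ →
      ∃ x : ZMod q, ∀ a ∈ s, c ≠ a → (bitPoly q b c).eval x ≠ (bitPoly q b a).eval x := by
    intro c s hc hs hcard
    have hfin : s.Finite := (Set.finite_Iio (2 ^ b)).subset hs
    let bad : Finset (ZMod q) := (hfin.toFinset.filter (c ≠ ·)).biUnion fun a =>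
      Finset.univ.filter fun x : ZMod q => (bitPoly q b c).eval x = (bitPoly q b a).eval x
    have hbad : bad.card < (Finset.univ : Finset (ZMod q)).card := by
      rw [Finset.card_univ, ZMod.card]
      refine lt_of_le_of_lt ?_ hΔ
      refine (Finset.card_biUnion_le_card_mul _ _ b fun a ha => ?_).trans ?_
      · rw [Finset.mem_filter, Set.Finite.mem_toFinset] at ha
        exact card_agree_le hc (hs a ha.1) ha.2
      · refine Nat.mul_le_mul_right _ ((Finset.card_filter_le _ _).trans ?_)
        rwa [← Set.ncard_eq_toFinset_card s hfin]
    obtain ⟨x, -, hx⟩ := Finset.exists_mem_notMem_of_card_lt_card hbad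
    refine ⟨x, fun a ha hne h => hx ?_⟩
    rw [Finset.mem_biUnion]
    exact ⟨a, by simp [ha, hne], by simp [h]⟩
  choose! x hx using hgood
  have hval : ∀ y : ZMod q, y.val < q := fun y => ZMod.val_lt y
  -- The pair is written as a two-digit number in base `q`.
  refine ⟨fun c s => (x c s).val * q + ((bitPoly q b c).eval (x c s)).val, fun c s => ?_, ?_⟩
  · have h1 := hval (x c s)
    have h2 := hval ((bitPoly q b c).eval (x c s))
    nlinarith
  · intro c c' s s' hc hs hcard hc' hne h
    have h1 : (x c s).val = (x c' s').val := by
      have := congrArg (· / q) h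
      simpa [Nat.add_div_of_dvd_right, Nat.div_eq_of_lt (hval _), hq.pos,
        Nat.mul_div_cancel] using this
    have h2 : ((bitPoly q b c).eval (x c s)).val = ((bitPoly q b c').eval (x c' s')).val := by
      dsimp only at h
      rw [h1] at h
      simpa using h
    have h3 := ZMod.val_injective q h1
    have h4 := ZMod.val_injective q h2
    rw [← h3] at h4
    exact hx c s hc hs hcard c' hc' hne h4

/-- The number of bits of a color after one step of color reduction that starts with `b` bits, in a
graph of degree at most `2 ^ e`. -/
def nextBits (e b : ℕ) : ℕ := 2 * (e + 1) + 2 * Nat.clog 2 b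

theorem exists_recolor_bits (e b : ℕ) (hb : 1 ≤ b) :
    ∃ φ : ℕ → Set ℕ → ℕ, (∀ c s, φ c s < 2 ^ nextBits e b) ∧ ∀ c c' s s', c < 2 ^ b →
      (∀ a ∈ s, a < 2 ^ b) → s.ncard ≤ 2 ^ e → c' ∈ s → c ≠ c' → φ c s ≠ φ c' s' := by
  -- Bertrand's postulate keeps `q` within a factor of two of `2^e * b`.
  obtain ⟨q, hq, h1, h2⟩ := Nat.exists_prime_lt_and_le_two_mul (2 ^ e * b) (by positivity)
  obtain ⟨φ, h3, h4⟩ := exists_recolor hq h1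
  refine ⟨φ, fun c s => (h3 c s).trans_le ?_, h4⟩
  have h5 : b ≤ 2 ^ Nat.clog 2 b := Nat.le_pow_clog (by norm_num) b
  have h6 : q ≤ 2 ^ (e + 1 + Nat.clog 2 b) := by
    calc q ≤ 2 * (2 ^ e * b) := h2
      _ ≤ 2 * (2 ^ e * 2 ^ Nat.clog 2 b) := by gcongr
      _ = _ := by ring
  calc q ^ 2 ≤ (2 ^ (e + 1 + Nat.clog 2 b)) ^ 2 := by gcongr
    _ = 2 ^ nextBits e b := by rw [← pow_mul, nextBits]; ring_nf

/-- A bound for the number of bits of the final colors. -/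
def finalBits (e : ℕ) : ℕ := 22 * e + 102

theorem four_mul_clog_le {x : ℕ} (hx : 20 ≤ x) : 4 * Nat.clog 2 x ≤ x := by
  have key : ∀ m, 5 ≤ m → 4 * m + 3 ≤ 2 ^ m := by
    intro m hm
    induction m, hm using Nat.le_induction with
    | base => norm_num
    | succ m hm ih => rw [pow_succ]; omega
  have : Nat.clog 2 x ≤ x / 4 := Nat.clog_le_of_le_pow ((by omega : x ≤ 4 * (x / 4) + 3).trans
    (key _ (by omega)))
  omega

theorem clog_le_self (x : ℕ) : Nat.clog 2 x ≤ x := Nat.clog_le_of_le_pow Nat.lt_two_pow_self.le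

/-- One step leaves `2 * clog b` plus a term linear in `e`; a second step absorbs the factor `2`,
unless `clog b` is already below `4 * (e + 1) + 20`. In that case the bound is `6 * (e + 1) + 4 * (4
* (e + 1) + 20)`, which is `finalBits e`. -/
theorem nextBits_nextBits_le (e b : ℕ) :
    nextBits e (nextBits e b) ≤ max (Nat.clog 2 b) (finalBits e) := by
  set x := Nat.clog 2 b with hx
  have e1 : nextBits e (nextBits e b) = 2 * (e + 1) + 2 * Nat.clog 2 (2 * (e + 1) + 2 * x) := rfl
  rw [e1, finalBits]
  by_cases h : 4 * (e + 1) + 20 ≤ x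
  · have h1 : Nat.clog 2 (2 * (e + 1) + 2 * x) ≤ 2 + Nat.clog 2 x := by
      refine Nat.clog_le_of_le_pow ?_
      have := Nat.le_pow_clog (b := 2) (by norm_num) x
      rw [pow_add]
      omega
    have h2 := four_mul_clog_le (x := x) (by omega)
    exact le_max_of_le_left (by omega)
  · have := clog_le_self (2 * (e + 1) + 2 * x)
    exact le_max_of_le_right (by omega)

theorem nextBits_le (e b : ℕ) : nextBits e b ≤ max b (finalBits e) := by
  rw [nextBits, finalBits]
  by_cases h : 4 * (e + 1) + 20 ≤ b
  · have h2 := four_mul_clog_le (x := b) (by omega)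
    exact le_max_of_le_left (by omega)
  · have := clog_le_self b
    exact le_max_of_le_right (by omega)

/-- The number of bits of the colors after `t` steps of color reduction. -/
def bitSeq (e S : ℕ) : ℕ → ℕ
  | 0 => S
  | t + 1 => nextBits e (bitSeq e S t)

theorem bitSeq_le (e S t : ℕ) : bitSeq e S t ≤ max S (finalBits e) := by
  induction t with
  | zero => exact le_max_left _ _
  | succ t ih => exact (nextBits_le _ _).trans (max_le ih (le_max_right _ _))

theorem one_le_bitSeq {e S : ℕ} (hS : 1 ≤ S) (t : ℕ) : 1 ≤ bitSeq e S t := by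
  cases t with
  | zero => exact hS
  | succ t => rw [bitSeq, nextBits]; omega

/-- Two steps replace the bound `n` by `clog n`, the recursion that defines `logStar`, as long as
`n` exceeds `finalBits e`; below that value the bound persists. -/
theorem bitSeq_two_mul_logStar_le_aux (e S n : ℕ) :
    ∀ t, bitSeq e S t ≤ max n (finalBits e) → bitSeq e S (t + 2 * logStar n) ≤ finalBits e := by
  induction n using Nat.strong_induction_on with
  | _ n ih =>
    intro t ht
    rw [logStar]
    split_ifs with h
    · refine ht.trans (max_le ?_ le_rfl)
      rw [finalBits]; omega
    · have hlt : Nat.clog 2 n < n := by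
        have h : Nat.clog 2 n ≤ n - 1 :=
          Nat.clog_le_of_le_pow (by have := @Nat.lt_two_pow_self (n - 1); omega)
        omega
      have e1 : t + 2 * (logStar (Nat.clog 2 n) + 1) = t + 2 + 2 * logStar (Nat.clog 2 n) := by
        ring
      rw [e1]
      refine ih _ hlt _ ?_
      refine (nextBits_nextBits_le e (bitSeq e S t)).trans (max_le ?_ (le_max_right _ _))
      have := Nat.clog_mono_right 2 ht
      rcases le_total n (finalBits e) with h | h
      · rw [max_eq_right h] at this
        exact le_max_of_le_right (this.trans (clog_le_self _))
      · rw [max_eq_left h] at this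
        exact le_max_of_le_left this

theorem bitSeq_two_mul_logStar_le (e S : ℕ) : bitSeq e S (2 * logStar S) ≤ finalBits e := by
  have := bitSeq_two_mul_logStar_le_aux e S S 0 (le_max_left _ _)
  rwa [Nat.zero_add] at this

/-! ### The conflict graph of the clusters -/

/-- What a cluster knows about its neighborhood in the cluster graph. -/
structure Base (W : Type) where
  old : Status
  th : W
  high : Prop
  heavy : Prop
  free : Prop

/-- The working data of a cluster. -/
structure Work (W Q : Type) where
  base : Base W
  inn : Set (W × Q)
  pay : Q

/-! ### Thresholds that describe the out-neighbors. -/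

section threshold

variable {W : Type} [LinearOrder W] [OrderTop W]

open Classical in
/-- The largest of the `d` elements of `z`, or `⊤` if there are fewer than `d`. -/
noncomputable def threshold (d : ℕ) (z : Set W) : W :=
  if h : d ≤ z.ncard ∧ ∃ m, IsGreatest z m then h.2.choose else ⊤

theorem threshold_eq_top {d : ℕ} {z : Set W} (h : ¬ d ≤ z.ncard) : threshold d z = ⊤ := by
  rw [threshold, dif_neg fun h' => h h'.1]

variable [Finite W]

theorem isGreatest_threshold {d : ℕ} (hd : 1 ≤ d) {z : Set W} (h : d ≤ z.ncard) :
    IsGreatest z (threshold d z) := by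
  have hne : z.Nonempty := (Set.ncard_pos (Set.toFinite _)).1 (by omega)
  obtain ⟨m, hm, hmax⟩ := Set.exists_max_image z id (Set.toFinite _) hne
  have h' : d ≤ z.ncard ∧ ∃ m, IsGreatest z m := ⟨h, m, hm, fun a ha => hmax a ha⟩
  rw [threshold, dif_pos h']
  exact h'.2.choose_spec

/-- Membership in the list of the `d` smallest labels becomes one comparison with a threshold. A
cluster can thus announce its out-neighborhood by a single label. -/
theorem sep_le_threshold_eq {d : ℕ} (hd : 1 ≤ d) {N : Set W} (h : d ≤ (trunc d id N).ncard) :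
    {u | u ∈ N ∧ u ≤ threshold d (trunc d id N)} = trunc d id N := by
  have hg := isGreatest_threshold hd h
  ext u
  constructor
  · rintro ⟨h1, h2⟩
    rcases h2.eq_or_lt with h3 | h3
    · rw [h3]; exact hg.1
    · exact mem_trunc_of_rank_lt h1 hg.1 (Prod.Lex.lt_iff.2 (Or.inl h3))
  · exact fun hu => ⟨hu.1, hg.2 hu⟩

theorem ncard_le_threshold_le {d : ℕ} (hd : 1 ≤ d) (N : Set W) :
    {u | u ∈ N ∧ u ≤ threshold d (trunc d id N)}.ncard ≤ d := by
  by_cases h : d ≤ (trunc d id N).ncard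
  · rw [sep_le_threshold_eq hd h]; exact ncard_trunc_le _ _ _
  · have h1 : ¬ d ≤ N.ncard := fun h2 => h (le_ncard_trunc h2)
    refine (Set.ncard_le_ncard (fun u hu => hu.1) (Set.toFinite _)).trans (not_le.1 h1).le

end threshold

/-! ### Recovering in-neighbors from announced thresholds. -/

section incoming

variable {W Q : Type} [LinearOrder W]

/-- The set of pairs that `u` extracts from the `D` triples of largest threshold. -/
def incoming (u : W) (z : Set (W × W × Q)) : Set (W × Q) := {p | ∃ θ, u ≤ θ ∧ (θ, p) ∈ z}

/-- The triples that are announced by the members of `Y`. -/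
def announced (Y : Set W) (th : W → W) (pay : W → Q) : Set (W × W × Q) :=
  {e | ∃ A ∈ Y, e = (th A, A, pay A)}

/-- The order by decreasing threshold. -/
def thKey (e : W × W × Q) : Wᵒᵈ := OrderDual.toDual e.1

theorem thKey_le {u : W} : ∀ a b : W × W × Q, thKey a ≤ thKey b → u ≤ b.1 → u ≤ a.1 :=
  fun _ _ h h' => le_trans h' (OrderDual.toDual_le_toDual.1 h)

variable [Finite W] [Finite Q] {D : ℕ} {u : W} {Y : Set W} {th : W → W} {pay : W → Q}

theorem exists_of_mem_incoming {p : W × Q}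
    (hp : p ∈ incoming u (trunc D thKey (announced Y th pay))) :
    ∃ A ∈ Y, u ≤ th A ∧ p = (A, pay A) := by
  obtain ⟨θ, hθ, ⟨A, hA, he⟩, -⟩ := hp
  rw [Prod.mk.injEq] at he
  exact ⟨A, hA, he.1 ▸ hθ, he.2⟩

theorem ncard_incoming_le : (incoming u (trunc D thKey (announced Y th pay))).ncard ≤ D := by
  have : incoming u (trunc D thKey (announced Y th pay)) ⊆
      Prod.snd '' trunc D thKey (announced Y th pay) := by
    rintro p ⟨θ, -, h⟩
    exact ⟨_, h, rfl⟩
  exact (Set.ncard_le_ncard this (Set.toFinite _)).trans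
    ((Set.ncard_image_le (Set.toFinite _)).trans (ncard_trunc_le _ _ _))

/-- Together with the next lemma: the received list saturates at `D`, so a cluster can decide
whether it has `D` in-neighbors even when it cannot list all of them. -/
theorem le_ncard_of_le_incoming
    (h : D ≤ (incoming u (trunc D thKey (announced Y th pay))).ncard) :
    D ≤ {A | A ∈ Y ∧ u ≤ th A}.ncard := by
  have : incoming u (trunc D thKey (announced Y th pay)) ⊆
      (fun A => (A, pay A)) '' {A | A ∈ Y ∧ u ≤ th A} := by
    intro p hp
    obtain ⟨A, h1, h2, rfl⟩ := exists_of_mem_incoming hp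
    exact ⟨A, ⟨h1, h2⟩, rfl⟩
  exact h.trans ((Set.ncard_le_ncard this (Set.toFinite _)).trans
    (Set.ncard_image_le (Set.toFinite _)))

theorem ncard_lt_of_incoming_lt
    (h : (incoming u (trunc D thKey (announced Y th pay))).ncard < D) :
    {A | A ∈ Y ∧ u ≤ th A}.ncard < D := by
  have h1 : {e | e ∈ trunc D thKey (announced Y th pay) ∧ u ≤ e.1}.ncard < D := by
    refine lt_of_le_of_lt (Set.ncard_le_ncard_of_injOn Prod.snd (fun e he => ?_) ?_
      (Set.toFinite _)) h
    · exact ⟨e.1, he.2, he.1⟩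
    · rintro e ⟨⟨⟨A, -, rfl⟩, -⟩, -⟩ e' ⟨⟨⟨A', -, rfl⟩, -⟩, -⟩ hee
      simp only [Prod.mk.injEq] at hee
      rw [hee.1]
  refine lt_of_le_of_lt (Set.ncard_le_ncard_of_injOn (fun A => (A, pay A)) (fun A hA => ?_) ?_
      (Set.toFinite _)) h
  · exact ⟨th A, hA.2, mem_trunc_of_ncard_lt (P := fun e => u ≤ e.1) thKey_le h1
      ⟨A, hA.1, rfl⟩ hA.2⟩
  · intro A _ A' _ h
    exact congrArg Prod.fst h

/-- Triples are kept by decreasing threshold, so those with `u ≤ θ` come first. If at most `D` of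
them exist, truncation loses none. -/
theorem mem_incoming (h : {A | A ∈ Y ∧ u ≤ th A}.ncard ≤ D) {A : W} (hA : A ∈ Y)
    (hu : u ≤ th A) : (A, pay A) ∈ incoming u (trunc D thKey (announced Y th pay)) := by
  refine ⟨th A, hu, mem_trunc_of_ncard_le (P := fun e => u ≤ e.1) thKey_le ?_ ⟨A, hA, rfl⟩ hu⟩
  have : {e | e ∈ announced Y th pay ∧ u ≤ e.1} ⊆
      (fun A => (th A, A, pay A)) '' {A | A ∈ Y ∧ u ≤ th A} := by
    rintro e ⟨⟨A, hA, rfl⟩, h2⟩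
    exact ⟨A, ⟨hA, h2⟩, rfl⟩
  exact (Set.ncard_le_ncard this (Set.toFinite _)).trans
    ((Set.ncard_image_le (Set.toFinite _)).trans h)

end incoming

/-! ### Communication between clusters in conflict. -/

section conflict

variable {V W Q : Type}

/-- The out-neighbors of `A`: the active clusters near to `A` whose labels do not exceed the
threshold of `A`. -/
def Out [LE W] (G : SimpleGraph V) (k : ℕ) (lab : V → W) (base : W → Base W) (A u : W) : Prop :=
  Near G k lab A u ∧ (base A).old = .source ∧ (base u).old = .source ∧ u ≤ (base A).th

/-- `A'` is free and has a common out-neighbor with `A`. -/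
def Conflict [LE W] (G : SimpleGraph V) (k : ℕ) (lab : V → W) (base : W → Base W) (A A' : W) :
    Prop :=
  (base A').free ∧ ∃ u, Out G k lab base A u ∧ Out G k lab base A' u

/-- The data in `base` are correct. -/
structure GoodBase [LE W] (G : SimpleGraph V) (k : ℕ) (lab : V → W) (d : ℕ) (base : W → Base W) :
    Prop where
  out_le : ∀ A, {u | Out G k lab base A u}.ncard ≤ d
  high_out : ∀ A, (base A).old = .source → (base A).high → d ≤ {u | Out G k lab base A u}.ncard
  low_out : ∀ A u, ¬ (base A).high → Near G k lab A u → (base A).old = .source →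
    (base u).old = .source → Out G k lab base A u
  heavy_in : ∀ u, (base u).heavy → (base u).old = .source ∧
    d ^ 2 ≤ {A | Out G k lab base A u}.ncard
  light_in : ∀ u, (base u).old = .source → ¬ (base u).heavy →
    {A | Out G k lab base A u}.ncard < d ^ 2
  free_iff : ∀ A, (base A).free ↔ ¬ ∃ u, Near G k lab A u ∧ (base u).heavy

variable [Finite W] [LinearOrder W] [Finite Q]

/-- Every cluster learns the free clusters of which it is an out-neighbor. -/
noncomputable def inStep (k R L d : ℕ) : NetMap (Node W (Work W Q)) (Node W (Work W Q)) :=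
  clusterRound k R L (d ^ 2) thKey
    (fun A s => {e | s.base.old = .source ∧ s.base.free ∧ e = (s.base.th, A, s.pay)})
    fun A s z => ⟨s.base, incoming A z, s.pay⟩

/-- A cluster is heavy if it is an out-neighbor of many clusters. -/
noncomputable def heavyStep (d : ℕ) : NetMap (Node W (Work W Q)) (Node W (Work W Q)) :=
  NetMap.ofLocal fun a => a.setDat ⟨⟨a.dat.base.old, a.dat.base.th, a.dat.base.high,
    a.dat.base.old = .source ∧ d ^ 2 ≤ a.dat.inn.ncard, a.dat.base.free⟩, a.dat.inn, a.dat.pay⟩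

/-- A cluster is free if no heavy cluster is near. -/
noncomputable def freeStep (k R L : ℕ) : NetMap (Node W (Work W Q)) (Node W (Work W Q)) :=
  clusterRound k R L 1 (id : Unit → Unit) (fun _ s => {_e | s.base.heavy})
    fun _ s z => ⟨⟨s.base.old, s.base.th, s.base.high, s.base.heavy, ¬ z.Nonempty⟩, s.inn, s.pay⟩

/-- Every cluster learns about the clusters with which it is in conflict. -/
noncomputable def outStep (k R L d : ℕ) (h : W → Base W → Q → Set (W × Q) → Q) :
    NetMap (Node W (Work W Q)) (Node W (Work W Q)) :=
  clusterRound k R L (d ^ 3) (fun e : W × W × Q => e.1)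
    (fun A s => {e | s.base.old = .source ∧ e.1 = A ∧ e.2 ∈ s.inn})
    fun A s z => ⟨s.base, s.inn, h A s.base s.pay {p | ∃ u, u ≤ s.base.th ∧ (u, p) ∈ z}⟩

/-- A round of communication in the conflict graph. -/
noncomputable def confRound (k R L d : ℕ) (h : W → Base W → Q → Set (W × Q) → Q) :
    NetMap (Node W (Work W Q)) (Node W (Work W Q)) :=
  (inStep k R L d).andThen (outStep k R L d h)

variable {G : SimpleGraph V} {k R ρ L d : ℕ} {ldr : W → V} {me lab : V → W} {rel : V → Set W}

/-- Messages travel to the common out-neighbor `u` and back. Since the receiving cluster is free,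
`u` is light and hears all its free in-neighbors. On the way back items are ordered by `u`, so those
with `u` below the threshold, at most `d * d^2`, survive the truncation. -/
theorem confRound_config (inv : ClusterInv G k R ρ L ldr lab rel) {base : W → Base W}
    (good : GoodBase G k lab d base) (h : W → Base W → Q → Set (W × Q) → Q)
    (inn : W → Set (W × Q)) (pay : W → Q) :
    ∃ (inn' cf : W → Set (W × Q)),
      confRound k R L d h V G (config me lab rel (fun A => ⟨base A, inn A, pay A⟩)) =
        config me lab rel (fun A => ⟨base A, inn' A, h A (base A) (pay A) (cf A)⟩) ∧
      ∀ A, (base A).old = .source → (base A).free → (cf A).ncard ≤ d ^ 3 ∧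
        ∀ p, p ∈ cf A ↔ ∃ A', p = (A', pay A') ∧ Conflict G k lab base A A' := by
  set Y : W → Set W := fun u =>
    {A | Near G k lab u A ∧ (base A).old = .source ∧ (base A).free} with hY
  set inn' : W → Set (W × Q) := fun u =>
    incoming u (trunc (d ^ 2) thKey (announced (Y u) (fun A => (base A).th) pay)) with hinn
  set s : W → Set (W × W × Q) := fun A => {e | ∃ A', Near G k lab A A' ∧
    e ∈ {e : W × W × Q | (base A').old = .source ∧ e.1 = A' ∧ e.2 ∈ inn' A'}} with hs
  refine ⟨inn', fun A => {p | ∃ u, u ≤ (base A).th ∧ (u, p) ∈ trunc (d ^ 3) (fun e => e.1) (s A)},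
    ?_, fun A hA hfree => ?_⟩
  · simp only [confRound, NetMap.andThen, inStep, outStep]
    rw [clusterRound_config inv]
    have e2 : ∀ A, {e : W × W × Q | ∃ A', Near G k lab A A' ∧
        e ∈ {e : W × W × Q | (base A').old = .source ∧ (base A').free ∧
          e = ((base A').th, A', pay A')}} = announced (Y A) (fun A => (base A).th) pay := by
      intro A
      ext e
      constructor
      · rintro ⟨A', h1, h2, h3, rfl⟩
        exact ⟨A', ⟨h1, h2, h3⟩, rfl⟩
      · rintro ⟨A', ⟨h1, h2, h3⟩, rfl⟩
        exact ⟨A', h1, h2, h3, rfl⟩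
    simp only [e2]
    rw [clusterRound_config inv]
  · have hcard : {e | e ∈ s A ∧ e.1 ≤ (base A).th}.ncard ≤ d ^ 3 := by
      have hsub : {e | e ∈ s A ∧ e.1 ≤ (base A).th} ⊆
          {e | e.1 ∈ {u | Out G k lab base A u} ∧ e.2 ∈ inn' e.1} := by
        rintro e ⟨⟨A', h1, h2, h3, h4⟩, h5⟩
        subst h3
        exact ⟨⟨h1, hA, h2, h5⟩, h4⟩
      refine (Set.ncard_le_ncard hsub (Set.toFinite _)).trans
        ((ncard_labelled_le {u | Out G k lab base A u} inn' (D := d ^ 2)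
          fun u _ => ncard_incoming_le).trans ?_)
      calc _ ≤ d * d ^ 2 := Nat.mul_le_mul_right _ (good.out_le A)
        _ = d ^ 3 := by ring
    have hkey : ∀ p, p ∈ {p | ∃ u, u ≤ (base A).th ∧ (u, p) ∈ trunc (d ^ 3) (fun e => e.1) (s A)} ↔
        ∃ u, Out G k lab base A u ∧ p ∈ inn' u := by
      intro p
      constructor
      · rintro ⟨u, hu, ⟨A', h1, h2, h3, h4⟩, -⟩
        simp only at h3 h4
        subst h3
        exact ⟨_, ⟨h1, hA, h2, hu⟩, h4⟩
      · rintro ⟨u, ⟨h1, h2, h3, h4⟩, h5⟩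
        exact ⟨u, h4, mem_trunc_of_ncard_le (P := fun e : W × W × Q => e.1 ≤ (base A).th)
          (fun a b hab hb => le_trans hab hb) hcard ⟨u, h1, h3, rfl, h5⟩ h4⟩
    constructor
    · refine le_trans ?_ (ncard_trunc_le (d ^ 3) (fun e : W × W × Q => e.1) (s A))
      refine le_trans (Set.ncard_le_ncard ?_ (Set.toFinite _))
        (Set.ncard_image_le (f := Prod.snd) (Set.toFinite _))
      rintro p ⟨u, -, h⟩
      exact ⟨_, h, rfl⟩
    · intro p
      rw [hkey]
      constructor
      · rintro ⟨u, hu, hp⟩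
        obtain ⟨A', hA', h1, rfl⟩ := exists_of_mem_incoming hp
        exact ⟨A', rfl, hA'.2.2, u, hu, hA'.1.symm, hA'.2.1, hu.2.2.1, h1⟩
      · rintro ⟨A', rfl, hf, u, hu, hu'⟩
        refine ⟨u, hu, mem_incoming ?_ ⟨hu'.1.symm, hu'.2.1, hf⟩ hu'.2.2.2⟩
        have hlight : ¬ (base u).heavy := fun hh => (good.free_iff A).1 hfree ⟨u, hu.1, hh⟩
        refine le_trans (Set.ncard_le_ncard ?_ (Set.toFinite _))
          (good.light_in u hu.2.2.1 hlight).le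
        rintro A'' ⟨⟨h1, h2, h3⟩, h4⟩
        exact ⟨h1.symm, h2, hu.2.2.1, h4⟩

variable [OrderTop W]

/-- Compute thresholds. -/
noncomputable def degreeStep (k R L d : ℕ) (p0 : W → Q) :
    NetMap (Node W Status) (Node W (Work W Q)) :=
  clusterRound k R L d id (fun A s => {u | u = A ∧ s = .source}) fun A s z =>
    -- Every cluster is provisionally free, so that the first `inStep` counts all active
    -- in-neighbors; heaviness is decided from this count.
    ⟨⟨s, threshold d z, d ≤ z.ncard, False, True⟩, ∅, p0 A⟩

/-- All of `base`. -/
noncomputable def prepare (k R L d : ℕ) (p0 : W → Q) :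
    NetMap (Node W Status) (Node W (Work W Q)) :=
  (degreeStep k R L d p0).andThen ((inStep k R L d).andThen
    ((heavyStep d).andThen (freeStep k R L)))

theorem prepare_config (inv : ClusterInv G k R ρ L ldr lab rel) (hd : 1 ≤ d) (p0 : W → Q)
    (K : W → Status) :
    ∃ (base : W → Base W) (inn : W → Set (W × Q)),
      prepare k R L d p0 V G (config me lab rel K) =
        config me lab rel (fun A => ⟨base A, inn A, p0 A⟩) ∧
      (∀ A, (base A).old = K A) ∧ GoodBase G k lab d base := by
  set N : W → Set W := fun A => {u | Near G k lab A u ∧ K u = .source} with hN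
  set th : W → W := fun A => threshold d (trunc d id (N A)) with hth
  set Y : W → Set W := fun u => {A | Near G k lab u A ∧ K A = .source} with hY
  set inn : W → Set (W × Q) := fun u =>
    incoming u (trunc (d ^ 2) thKey (announced (Y u) th p0)) with hinn
  set heavy : W → Prop := fun u => K u = .source ∧ d ^ 2 ≤ (inn u).ncard with hheavy
  set base : W → Base W := fun A => ⟨K A, th A, d ≤ (trunc d id (N A)).ncard, heavy A,
    ¬ ∃ u, Near G k lab A u ∧ heavy u⟩ with hbase
  have houtset : ∀ u, K u = .source →
      {A | Out G k lab base A u} = {A | A ∈ Y u ∧ u ≤ th A} := by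
    intro u hu
    ext A
    constructor
    · rintro ⟨h1, h2, -, h4⟩
      exact ⟨⟨h1.symm, h2⟩, h4⟩
    · rintro ⟨⟨h1, h2⟩, h3⟩
      exact ⟨h1.symm, h2, hu, h3⟩
  refine ⟨base, inn, ?_, fun A => rfl, ⟨fun A => ?_, fun A hA hh => ?_, fun A u hh h1 h2 h3 => ?_,
    fun u hu => ?_, fun u hu hh => ?_, fun A => Iff.rfl⟩⟩
  · have e1 : ∀ A, {e | ∃ A', Near G k lab A A' ∧ e ∈ {u | u = A' ∧ K A' = .source}} = N A := by
      intro A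
      ext e
      constructor
      · rintro ⟨A', h1, rfl, h2⟩
        exact ⟨h1, h2⟩
      · rintro ⟨h1, h2⟩
        exact ⟨e, h1, rfl, h2⟩
    have e2 : ∀ A, {e : W × W × Q | ∃ A', Near G k lab A A' ∧
        e ∈ {e : W × W × Q | K A' = .source ∧ True ∧ e = (th A', A', p0 A')}} =
          announced (Y A) th p0 := by
      intro A
      ext e
      constructor
      · rintro ⟨A', h1, h2, -, rfl⟩
        exact ⟨A', ⟨h1, h2⟩, rfl⟩
      · rintro ⟨A', ⟨h1, h2⟩, rfl⟩
        exact ⟨A', h1, h2, trivial, rfl⟩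
    have e3 : ∀ A, (trunc 1 id {e : Unit | ∃ A', Near G k lab A A' ∧
        e ∈ {_e : Unit | heavy A'}}).Nonempty ↔ ∃ u, Near G k lab A u ∧ heavy u := by
      intro A
      constructor
      · rintro ⟨e, he⟩
        exact he.1
      · rintro ⟨u, hu⟩
        have : 1 ≤ {e : Unit | ∃ A', Near G k lab A A' ∧ e ∈ {_e : Unit | heavy A'}}.ncard :=
          (Set.ncard_pos (Set.toFinite _)).2 ⟨(), u, hu⟩
        exact (Set.ncard_pos (Set.toFinite _)).1 (le_ncard_trunc this)
    simp only [prepare, NetMap.andThen, degreeStep, inStep, freeStep]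
    rw [clusterRound_config inv]
    simp only [e1]
    rw [clusterRound_config inv]
    have hloc : ∀ (K' : W → Work W Q), heavyStep d V G (config me lab rel K') =
      config me lab rel (fun A => ⟨⟨(K' A).base.old, (K' A).base.th, (K' A).base.high,
        (K' A).base.old = .source ∧ d ^ 2 ≤ (K' A).inn.ncard, (K' A).base.free⟩, (K' A).inn,
        (K' A).pay⟩) := fun K' => rfl
    rw [hloc, clusterRound_config inv]
    congr 1
    funext A
    simp only [hth] at e2
    simp only [e2]
    simp only [hheavy, hinn, hth] at e3
    simp only [e3]
    rfl
  · refine (Set.ncard_le_ncard ?_ (Set.toFinite _)).trans (ncard_le_threshold_le hd (N A))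
    rintro u ⟨h1, -, h3, h4⟩
    exact ⟨⟨h1, h3⟩, h4⟩
  · refine le_trans hh (Set.ncard_le_ncard ?_ (Set.toFinite _))
    rw [← sep_le_threshold_eq hd hh]
    rintro u ⟨⟨h1, h2⟩, h3⟩
    exact ⟨h1, hA, h2, h3⟩
  · refine ⟨h1, h2, h3, ?_⟩
    change u ≤ threshold d (trunc d id (N A))
    rw [threshold_eq_top hh]
    exact le_top
  · refine ⟨hu.1, ?_⟩
    rw [houtset u hu.1]
    exact le_ncard_of_le_incoming hu.2
  · rw [houtset u hu]
    exact ncard_lt_of_incoming_lt (not_le.1 fun h => hh ⟨hu, h⟩)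

end conflict

/-! ### Coloring and independent sets in the conflict graph -/

/-- A color and the membership in the independent set. -/
abbrev Payload (m : ℕ) := Fin (2 ^ m) × Prop

open Classical in
/-- A step of color reduction for colors of `b` bits. -/
noncomputable def recolor (e b : ℕ) : ℕ → Set ℕ → ℕ :=
  if h : 1 ≤ b then (exists_recolor_bits e b h).choose else fun _ _ => 0

theorem recolor_lt (e : ℕ) {b : ℕ} (hb : 1 ≤ b) (c : ℕ) (s : Set ℕ) :
    recolor e b c s < 2 ^ nextBits e b := by
  rw [recolor, dif_pos hb]
  exact (exists_recolor_bits e b hb).choose_spec.1 c s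

theorem recolor_ne {e b : ℕ} (hb : 1 ≤ b) {c c' : ℕ} {s : Set ℕ} (s' : Set ℕ) (hc : c < 2 ^ b)
    (hs : ∀ a ∈ s, a < 2 ^ b) (hcard : s.ncard ≤ 2 ^ e) (hc' : c' ∈ s) (hne : c ≠ c') :
    recolor e b c s ≠ recolor e b c' s' := by
  rw [recolor, dif_pos hb]
  exact (exists_recolor_bits e b hb).choose_spec.2 c c' s s' hc hs hcard hc' hne

section coloring

variable {V W : Type}

/-- The initial colors are the labels. -/
noncomputable def initialPayload [Finite W] (m : ℕ) (A : W) : Payload m :=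
  (Fin.ofNat (2 ^ m) (Finite.equivFin W A), False)

/-- The colors of the other clusters in a set. -/
def otherColors {m : ℕ} (A : W) (cf : Set (W × Payload m)) : Set ℕ :=
  {c | ∃ p ∈ cf, p.1 ≠ A ∧ c = p.2.1}

/-- Color reduction. -/
noncomputable def recolorUpd (e b m : ℕ) (A : W) (_ : Base W) (p : Payload m)
    (cf : Set (W × Payload m)) : Payload m :=
  (Fin.ofNat (2 ^ m) (recolor e b p.1 (otherColors A cf)), p.2)

/-- The clusters of color `i` join the independent set if possible. -/
def joinUpd (i : ℕ) {m : ℕ} (_ : W) (b : Base W) (p : Payload m) (cf : Set (W × Payload m)) :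
    Payload m :=
  (p.1, p.2 ∨ (b.old = .source ∧ b.high ∧ b.free ∧ (p.1 : ℕ) = i ∧ ¬ ∃ p' ∈ cf, p'.2.2))

theorem ncard_otherColors_le [Finite W] {m D : ℕ} {A : W} {cf : Set (W × Payload m)} (h : cf.ncard ≤ D) :
    (otherColors A cf).ncard ≤ D := by
  refine le_trans (Set.ncard_le_ncard (t := (fun p : W × Payload m => (p.2.1 : ℕ)) '' cf) ?_
    ((Set.toFinite _).image _)) ((Set.ncard_image_le (Set.toFinite _)).trans h)
  rintro c ⟨p, hp, -, rfl⟩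
  exact ⟨p, hp, rfl⟩

variable {G : SimpleGraph V} {k R ρ L d e m B : ℕ} {ldr : W → V} {me lab : V → W}
  {rel : V → Set W} {base : W → Base W} [LinearOrder W]

theorem Conflict.symm {A A' : W} (h : Conflict G k lab base A A') (hA : (base A).free) :
    Conflict G k lab base A' A := by
  obtain ⟨-, u, h1, h2⟩ := h
  exact ⟨hA, u, h2, h1⟩

/-- The colors form a proper coloring of the conflict graph. -/
def ProperPayload (G : SimpleGraph V) (k : ℕ) (lab : V → W) (base : W → Base W) {m : ℕ}
    (pay : W → Payload m) : Prop :=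
  ∀ A A', (base A).free → Conflict G k lab base A A' → A ≠ A' → (pay A).1 ≠ (pay A').1

variable [Finite W]

/-- The labels are a proper coloring with `B` bits to start from. The uniform bound `m` on the bit
lengths makes the reductions modulo `2^m` in `Fin.ofNat` harmless. -/
theorem coloring_config (inv : ClusterInv G k R ρ L ldr lab rel) (good : GoodBase G k lab d base)
    (hde : d ^ 3 = 2 ^ e) (hB : 1 ≤ B) (hW : Nat.card W ≤ 2 ^ B)
    (hm : ∀ t, bitSeq e B t ≤ m) (inn0 : W → Set (W × Payload m)) (t : ℕ) :
    ∃ (inn : W → Set (W × Payload m)) (pay : W → Payload m),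
      NetMap.chain (fun t => confRound k R L d (recolorUpd e (bitSeq e B t) m)) t V G
        (config me lab rel (fun A => ⟨base A, inn0 A, initialPayload m A⟩)) =
          config me lab rel (fun A => ⟨base A, inn A, pay A⟩) ∧
      (∀ A, ¬ (pay A).2) ∧ (∀ A, ((pay A).1 : ℕ) < 2 ^ bitSeq e B t) ∧
      ProperPayload G k lab base pay := by
  induction t with
  | zero =>
    have hv : ∀ A : W, ((initialPayload m A).1 : ℕ) = Finite.equivFin W A := by
      intro A
      simp only [initialPayload, Fin.ofNat]
      refine Nat.mod_eq_of_lt ((Fin.is_lt _).trans_le (hW.trans ?_))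
      exact Nat.pow_le_pow_right (by norm_num) (hm 0)
    refine ⟨inn0, initialPayload m, rfl, fun A h => h, fun A => ?_, fun A A' _ _ hne h => ?_⟩
    · rw [hv]
      exact (Fin.is_lt _).trans_le hW
    · have h' := congrArg Fin.val h
      rw [hv, hv] at h'
      exact hne ((Finite.equivFin W).injective (Fin.ext h'))
  | succ t ih =>
    obtain ⟨inn, pay, h1, h2, h3, h4⟩ := ih
    obtain ⟨inn', cf, h5, h6⟩ := confRound_config (me := me) inv good
      (recolorUpd e (bitSeq e B t) m) inn pay
    have hb := one_le_bitSeq (e := e) hB t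
    have hv : ∀ A, ((recolorUpd e (bitSeq e B t) m A (base A) (pay A) (cf A)).1 : ℕ) =
        recolor e (bitSeq e B t) (pay A).1 (otherColors A (cf A)) := by
      intro A
      simp only [recolorUpd, Fin.ofNat]
      refine Nat.mod_eq_of_lt ((recolor_lt e hb _ _).trans_le ?_)
      exact Nat.pow_le_pow_right (by norm_num) (hm (t + 1))
    refine ⟨inn', fun A => recolorUpd e (bitSeq e B t) m A (base A) (pay A) (cf A), ?_,
      fun A => h2 A, fun A => ?_, fun A A' hA hAA' hne h => ?_⟩
    · rw [NetMap.chain, NetMap.andThen, h1, h5]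
    · rw [hv]
      exact recolor_lt e hb _ _
    · have h' := congrArg Fin.val h
      rw [hv, hv] at h'
      obtain ⟨-, u, hu, -⟩ := id hAA'
      obtain ⟨hcard, hcf⟩ := h6 A hu.2.1 hA
      refine recolor_ne hb (otherColors A' (cf A')) (h3 A) ?_
        (hde ▸ ncard_otherColors_le hcard) ?_ ?_ h'
      · rintro a ⟨p, hp, -, rfl⟩
        obtain ⟨A'', rfl, -⟩ := (hcf p).1 hp
        exact h3 A''
      · exact ⟨(A', pay A'), (hcf _).2 ⟨A', rfl, hAA'⟩, hne.symm, rfl⟩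
      · exact fun h => h4 A A' hA hAA' hne (Fin.ext h)

/-- The clusters that have joined form an independent set of the conflict graph that is maximal
among the clusters of color less than `i`. -/
structure IsGreedySet (G : SimpleGraph V) (k : ℕ) (lab : V → W) (base : W → Base W) {m : ℕ}
    (i : ℕ) (pay : W → Payload m) : Prop where
  mem : ∀ A, (pay A).2 → (base A).old = .source ∧ (base A).high ∧ (base A).free ∧
    ((pay A).1 : ℕ) < i
  indep : ∀ A A', (pay A).2 → (pay A').2 → Conflict G k lab base A A' → A = A'
  maximal : ∀ A, (base A).old = .source → (base A).high → (base A).free → ((pay A).1 : ℕ) < i →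
    (pay A).2 ∨ ∃ A', (pay A').2 ∧ Conflict G k lab base A A'

theorem join_config (inv : ClusterInv G k R ρ L ldr lab rel) (good : GoodBase G k lab d base)
    (inn0 : W → Set (W × Payload m)) (pay0 : W → Payload m) (hpay : ∀ A, ¬ (pay0 A).2)
    (hproper : ProperPayload G k lab base pay0) (i : ℕ) :
    ∃ (inn : W → Set (W × Payload m)) (pay : W → Payload m),
      NetMap.chain (fun i => confRound k R L d (joinUpd i)) i V G
        (config me lab rel (fun A => ⟨base A, inn0 A, pay0 A⟩)) =
          config me lab rel (fun A => ⟨base A, inn A, pay A⟩) ∧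
      (∀ A, (pay A).1 = (pay0 A).1) ∧ IsGreedySet G k lab base i pay := by
  induction i with
  | zero =>
    exact ⟨inn0, pay0, rfl, fun A => rfl, fun A h => absurd h (hpay A),
      fun A A' h => absurd h (hpay A), fun A _ _ _ h => absurd h (Nat.not_lt_zero _)⟩
  | succ i ih =>
    obtain ⟨inn, pay, h1, h2, h3⟩ := ih
    obtain ⟨inn', cf, h5, h6⟩ := confRound_config (me := me) inv good (joinUpd i) inn pay
    have hcf : ∀ A, (base A).old = .source → (base A).free →
        ((∃ p' ∈ cf A, p'.2.2) ↔ ∃ A', (pay A').2 ∧ Conflict G k lab base A A') := by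
      intro A hA hf
      constructor
      · rintro ⟨p, hp, hj⟩
        obtain ⟨A', rfl, hc⟩ := ((h6 A hA hf).2 p).1 hp
        exact ⟨A', hj, hc⟩
      · rintro ⟨A', hj, hc⟩
        exact ⟨_, ((h6 A hA hf).2 _).2 ⟨A', rfl, hc⟩, hj⟩
    refine ⟨inn', fun A => joinUpd i A (base A) (pay A) (cf A), ?_, fun A => h2 A,
      ⟨fun A hA => ?_, fun A A' hA hA' hc => ?_, fun A hA hh hf hi => ?_⟩⟩
    · rw [NetMap.chain, NetMap.andThen, h1, h5]
    · rcases hA with hA | ⟨g1, g2, g3, g4, -⟩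
      · obtain ⟨g1, g2, g3, g4⟩ := h3.mem A hA
        exact ⟨g1, g2, g3, Nat.lt_succ_of_lt g4⟩
      · exact ⟨g1, g2, g3, Nat.lt_succ_of_le g4.le⟩
    · rcases hA with hA | ⟨g1, g2, g3, g4, g5⟩
      · rcases hA' with hA' | ⟨g1, g2, g3, g4, g5⟩
        · exact h3.indep A A' hA hA' hc
        · exact absurd ((hcf A' g1 g3).2 ⟨A, hA, hc.symm (h3.mem A hA).2.2.1⟩) g5
      · rcases hA' with hA' | ⟨g1', g2', g3', g4', g5'⟩
        · exact absurd ((hcf A g1 g3).2 ⟨A', hA', hc⟩) g5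
        -- Two clusters that join in the same step have the same color, so properness excludes a
        -- conflict.
        · by_contra hne
          refine hproper A A' g3 hc hne (Fin.ext ?_)
          rw [← h2, ← h2, g4, g4']
    · change ((pay A).1 : ℕ) < i + 1 at hi
      by_cases hj : ∃ A', (pay A').2 ∧ Conflict G k lab base A A'
      · obtain ⟨A', h, h'⟩ := hj
        exact Or.inr ⟨A', Or.inl h, h'⟩
      · left
        rcases Nat.lt_succ_iff_lt_or_eq.1 hi with hi | hi
        · exact Or.inl ((h3.maximal A hA hh hf hi).resolve_right hj)
        · exact Or.inr ⟨hA, hh, hf, hi, fun h => hj ((hcf A hA hf).1 h)⟩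

end coloring

/-! ### One level of the construction -/

theorem mul_le_ncard_labelled {W X : Type} [Finite W] [Finite X] {D : ℕ} (Λ : Set W)
    (F : W → Set X) (hF : ∀ l ∈ Λ, D ≤ (F l).ncard) :
    Λ.ncard * D ≤ {p : W × X | p.1 ∈ Λ ∧ p.2 ∈ F p.1}.ncard := by
  classical
  have := Fintype.ofFinite W
  have := Fintype.ofFinite X
  have e : {p : W × X | p.1 ∈ Λ ∧ p.2 ∈ F p.1} =
      (Λ.toFinset.biUnion fun l => (F l).toFinset.image fun a => (l, a) : Finset (W × X)) := by
    ext ⟨l, a⟩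
    simp [and_comm]
  rw [e, Set.ncard_coe_finset, Set.ncard_eq_toFinset_card', Finset.card_biUnion]
  · rw [← smul_eq_mul]
    refine Finset.card_nsmul_le_sum _ _ _ fun l hl => ?_
    rw [Finset.card_image_of_injective _ fun a b h => (Prod.mk.injEq _ _ _ _ ▸ h).2,
      ← Set.ncard_eq_toFinset_card']
    exact hF l (Set.mem_toFinset.1 hl)
  · intro l _ l' _ hne
    rw [Function.onFun, Finset.disjoint_left]
    intro p hp hp'
    rw [Finset.mem_image] at hp hp'
    obtain ⟨a, -, rfl⟩ := hp
    obtain ⟨a', -, h⟩ := hp'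
    exact hne (congrArg Prod.fst h).symm

section level

variable {V W : Type} [LinearOrder W]

/-- The labels of the active clusters. -/
def activeLabels (lab : V → W) (K : W → Status) : Set W := {A | (∃ v, lab v = A) ∧ K A = .source}

variable {G : SimpleGraph V} {k R ρ L d e m B : ℕ} {ldr : W → V} {me lab : V → W}
  {rel : V → Set W} {base : W → Base W}

theorem Out.mem_activeLabels {K : W → Status} (hK : ∀ A, (base A).old = K A) {A u : W}
    (h : Out G k lab base A u) : A ∈ activeLabels lab K ∧ u ∈ activeLabels lab K := by
  obtain ⟨⟨v, w, h1, h2, -⟩, h3, h4, -⟩ := h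
  exact ⟨⟨⟨v, h1⟩, hK A ▸ h3⟩, ⟨w, h2⟩, hK u ▸ h4⟩

variable [Finite W]

/-- Double counting of the out-edges: each heavy cluster receives at least `d^2` and each active
cluster sends at most `d`. -/
theorem ncard_heavy_mul_le {K : W → Status} (hK : ∀ A, (base A).old = K A)
    (good : GoodBase G k lab d base) (hd : 1 ≤ d) :
    {A | (base A).heavy}.ncard * d ≤ (activeLabels lab K).ncard := by
  have h1 := mul_le_ncard_labelled {A | (base A).heavy} (fun u => {A | Out G k lab base A u})
    fun u hu => (good.heavy_in u hu).2
  have h2 := ncard_labelled_le (activeLabels lab K) (fun A => {u | Out G k lab base A u})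
    fun A _ => good.out_le A
  have h3 := Set.ncard_le_ncard_of_injOn Prod.swap
    (s := {p : W × W | p.1 ∈ {A | (base A).heavy} ∧ p.2 ∈ {A | Out G k lab base A p.1}})
    (t := {p : W × W | p.1 ∈ activeLabels lab K ∧ p.2 ∈ {u | Out G k lab base p.1 u}})
    (fun p hp => ⟨(Out.mem_activeLabels hK hp.2).1, hp.2⟩)
    (Prod.swap_injective.injOn) (Set.toFinite _)
  have h4 := h1.trans (h3.trans h2)
  have h5 : {A | (base A).heavy}.ncard * d * d ≤ (activeLabels lab K).ncard * d := by
    refine le_trans (le_of_eq ?_) h4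
    ring
  exact Nat.le_of_mul_le_mul_right h5 hd

/-- Each chosen cluster has at least `d` out-neighbors, and a common out-neighbor of two chosen
clusters would be a conflict. -/
theorem ncard_joined_mul_le {K : W → Status} (hK : ∀ A, (base A).old = K A)
    (good : GoodBase G k lab d base) {i : ℕ} {pay : W → Payload m}
    (hpay : IsGreedySet G k lab base i pay) :
    {A | (pay A).2}.ncard * d ≤ (activeLabels lab K).ncard := by
  refine (mul_le_ncard_labelled {A | (pay A).2} (fun A => {u | Out G k lab base A u})
    fun A hA => good.high_out A (hpay.mem A hA).1 (hpay.mem A hA).2.1).trans ?_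
  refine Set.ncard_le_ncard_of_injOn Prod.snd
    (fun p hp => (Out.mem_activeLabels hK hp.2).2) ?_ (Set.toFinite _)
  rintro ⟨A, u⟩ ⟨h1, h2⟩ ⟨A', u'⟩ ⟨h1', h2'⟩ h
  simp only at h h1 h2 h1' h2'
  subst h
  rw [hpay.indep A A' h1 h1' ⟨(hpay.mem A' h1').2.2.1, u, h2, h2'⟩]

open Classical in
/-- The status of a cluster after the selection of the new centers. -/
noncomputable def select {m : ℕ} (i q : ℕ) (w : Work W (Payload m)) : Status :=
  if w.base.old = .source then
    if w.base.heavy ∨ w.pay.2 then .source else .pending (i * q + w.pay.1)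
  else w.base.old

/-- Pending clusters are finished. -/
def finish : Status → Status
  | .source => .source
  | .pending c => .done c
  | .done c => .done c

variable [OrderTop W]

/-- One level of the construction of the network decomposition. -/
noncomputable def level (k R L d e m B T q : ℕ) (i : ℕ) : NetMap (Node W Status) (Node W Status) :=
  (prepare k R L d (initialPayload m)).andThen
    ((NetMap.chain (fun t => confRound k R L d (recolorUpd e (bitSeq e B t) m)) T).andThen
      ((NetMap.chain (fun i => confRound k R L d (joinUpd i)) q).andThen
        ((NetMap.ofLocal fun a => a.setDat (select i q a.dat)).andThen
          ((grow k R L).andThen ((grow k R L).andThen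
            (NetMap.ofLocal fun a => a.setDat (finish a.dat)))))))

theorem level_config {R' L' s T q : ℕ} (inv : ClusterInv G k R ρ L ldr lab rel)
    (hR : 3 * R + k ≤ R') (hL : L + 1 ≤ L') (hd : d = 2 ^ (s + 1)) (hde : d ^ 3 = 2 ^ e)
    (hB : 1 ≤ B) (hW : Nat.card W ≤ 2 ^ B) (hm : ∀ t, bitSeq e B t ≤ m)
    (hq : 2 ^ bitSeq e B T ≤ q) (K : W → Status) (i : ℕ)
    (hK : ∀ A, K A = .source ∨ ∃ c, K A = .done c) :
    ∃ (nl : W → W) (rel' : V → Set W) (K' : W → Status),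
      level k R' L' d e m B T q i V G (config me lab rel K) =
        config me (fun v => nl (lab v)) rel' K' ∧
      ClusterInv G k (9 * R + 4 * k) (9 * ρ + 4) (L + 2) ldr (fun v => nl (lab v)) rel' ∧
      (∀ A, K' A = .source ∨ ∃ c, K' A = .done c) ∧
      (∀ A c, K A = .done c → nl A = A ∧ K' A = .done c) ∧
      (∀ A c, K A = .source → K' (nl A) = .done c → i * q ≤ c ∧ c < (i + 1) * q) ∧
      (∀ v w c, K (lab v) = .source → K (lab w) = .source → K' (nl (lab v)) = .done c →
        K' (nl (lab w)) = .done c → G.edist v w ≤ k → lab v = lab w) ∧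
      (activeLabels (fun v => nl (lab v)) K').ncard * 2 ^ s ≤ (activeLabels lab K).ncard ∧
      ∀ v, ∃ w, nl (lab v) = lab w := by
  have hd1 : 1 ≤ d := hd ▸ Nat.one_le_two_pow
  have inv' := inv.mono (show R ≤ R' by omega) le_rfl (show L ≤ L' by omega)
  obtain ⟨base, inn0, e1, hbK, good⟩ := prepare_config (me := me) inv' hd1 (initialPayload m) K
  obtain ⟨inn1, pay1, e2, p1, p2, p3⟩ :=
    coloring_config (me := me) inv' good hde hB hW hm inn0 T
  obtain ⟨inn2, pay, e3, p4, p5⟩ := join_config (me := me) inv' good inn1 pay1 p1 p3 q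
  have hcol : ∀ A, ((pay A).1 : ℕ) < q := fun A => by
    rw [p4]; exact (p2 A).trans_le hq
  have hproper : ProperPayload G k lab base pay := fun A A' h1 h2 h3 => by
    rw [p4, p4]; exact p3 A A' h1 h2 h3
  set K2 : W → Status := fun A => select i q ⟨base A, inn2 A, pay A⟩ with hK2
  have k2_done : ∀ A c, K A = .done c → K2 A = .done c := by
    intro A c hA
    have h : (base A).old = .done c := (hbK A).trans hA
    simp [hK2, select, h]
  have k2_src : ∀ A, K A = .source → ((base A).heavy ∨ (pay A).2) → K2 A = .source := by
    intro A hA h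
    simp only [hK2, select, hbK, hA, h, if_true]
  have k2_pend : ∀ A, K A = .source → ¬ ((base A).heavy ∨ (pay A).2) →
      K2 A = .pending (i * q + (pay A).1) := by
    intro A hA h
    simp only [hK2, select, hbK, hA, h, if_true, if_false]
  obtain ⟨nl1, rel1, e4, inv1, g1, g2, w1⟩ := grow_config (me := me) inv (R' := R') (L' := L')
    (by omega) (by omega) K2
  obtain ⟨nl2, rel2, e5, inv2, g3, g4, w2⟩ := grow_config (me := me) inv1 (R' := R') (L' := L')
    (by omega) (by omega) K2
  -- a cluster that is not a source at the end has not been absorbed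
  have hstay : ∀ A, K2 (nl2 (nl1 A)) ≠ .source → nl1 A = A ∧ nl2 A = A := by
    intro A hA
    have h1 : nl1 A = A := by
      by_contra h
      have hs := (g1 A h).2
      refine hA ?_
      by_contra h'
      have : nl2 (nl1 A) ≠ nl1 A := fun h'' => h' (by rw [h'', hs])
      obtain ⟨⟨c, hc⟩, -⟩ := g3 _ this
      rw [hs] at hc
      cases hc
    refine ⟨h1, ?_⟩
    by_contra h
    rw [h1] at hA
    exact hA (g3 A h).2
  have hfin_src : ∀ A, finish (K2 A) = .source ↔ K2 A = .source := by
    intro A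
    rcases K2 A with _ | c | c <;> simp [finish]
  -- a cluster that gets a color is free and has low degree
  have hpend : ∀ A c, K A = .source → finish (K2 (nl2 (nl1 A))) = .done c →
      nl1 A = A ∧ nl2 A = A ∧ c = i * q + (pay A).1 ∧ (base A).free ∧ ¬ (base A).high := by
    intro A c hA hc
    have hns : K2 (nl2 (nl1 A)) ≠ .source := fun h => by
      rw [(hfin_src _).2 h] at hc
      cases hc
    obtain ⟨h1, h2⟩ := hstay A hns
    rw [h1, h2] at hns hc
    have h3 : ¬ ((base A).heavy ∨ (pay A).2) := fun h => hns (k2_src A hA h)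
    have h4 := k2_pend A hA h3
    rw [h4] at hc
    have hc' : c = i * q + (pay A).1 := by
      simp only [finish, Status.done.injEq] at hc
      exact hc.symm
    have hfree : (base A).free := by
      rw [good.free_iff]
      rintro ⟨u, ⟨v, w, hv, hw, hvw⟩, hu⟩
      have hus : K2 u = .source := k2_src u (hbK u ▸ (good.heavy_in u hu).1) (Or.inl hu)
      have := g2 v w _ (hv ▸ h4) hvw (hw ▸ hus)
      rw [hv, h1] at this
      exact hns this
    refine ⟨h1, h2, hc', hfree, fun hhigh => ?_⟩
    -- By maximality a high free cluster is chosen or shares an out-neighbor `u` with a chosen one.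
    -- In the latter case `u` belongs to a source cluster after the first growth, so `A` is absorbed
    -- in the second.
    rcases p5.maximal A (hbK A ▸ hA) hhigh hfree (hcol A) with h | ⟨A', hA', -, u, hu, hu'⟩
    · exact h3 (Or.inr h)
    · have hA's : K2 A' = .source := k2_src A' (hbK A' ▸ hu'.2.1) (Or.inr hA')
      have hu1 : K2 (nl1 u) = .source := by
        by_cases h : (base u).heavy ∨ (pay u).2
        · have hus := k2_src u (hbK u ▸ hu.2.2.1) h
          by_cases h' : nl1 u = u
          · rw [h', hus]
          · exact (g1 u h').2
        · have hup := k2_pend u (hbK u ▸ hu.2.2.1) h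
          obtain ⟨x, y, hx, hy, hxy⟩ := hu'.1.symm
          have := g2 x y _ (hx ▸ hup) hxy (hy ▸ hA's)
          rwa [hx] at this
      obtain ⟨v, w, hv, hw, hvw⟩ := hu.1
      have := g4 v w (i * q + (pay A).1) (by rw [hv, h1, h4]) hvw (by rw [hw, hu1])
      rw [hv, h1, h2] at this
      exact hns this
  refine ⟨fun A => nl2 (nl1 A), rel2, fun A => finish (K2 A), ?_, inv2.mono (by omega) (by omega)
    (by omega), fun A => ?_, fun A c hA => ?_, fun A c hA hc => ?_,
    fun v w c hv hw hvc hwc hvw => ?_, ?_, fun v => ?_⟩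
  · simp only [level, NetMap.andThen]
    rw [e1, e2, e3]
    have hloc : NetMap.ofLocal (fun a : Node W (Work W (Payload m)) =>
        a.setDat (select i q a.dat)) V G
        (config me lab rel (fun A => ⟨base A, inn2 A, pay A⟩)) = config me lab rel K2 := rfl
    rw [hloc, e4, e5]
    rfl
  · dsimp only
    rcases K2 A with _ | c | c <;> simp [finish]
  · have hd := k2_done A c hA
    have h1 : nl1 A = A := by
      by_contra h
      obtain ⟨⟨c, hc⟩, -⟩ := g1 A h
      rw [hd] at hc
      cases hc
    have h2 : nl2 A = A := by
      by_contra h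
      obtain ⟨⟨c, hc⟩, -⟩ := g3 A h
      rw [hd] at hc
      cases hc
    exact ⟨by dsimp only; rw [h1, h2], by dsimp only; rw [hd]; rfl⟩
  · obtain ⟨-, -, rfl, -, -⟩ := hpend A c hA hc
    have := hcol A
    refine ⟨by omega, ?_⟩
    rw [Nat.succ_mul]
    omega
  · obtain ⟨-, -, h1, h2, h3⟩ := hpend _ c hv hvc
    obtain ⟨-, -, h1', h2', h3'⟩ := hpend _ c hw hwc
    by_contra hne
    -- The cluster of `w` is itself a common out-neighbor, being near to both low clusters.
    refine hproper (lab v) (lab w) h2 ⟨h2', lab w, ?_, ?_⟩ hne (Fin.ext (by omega))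
    · exact good.low_out _ _ h3 ⟨v, w, rfl, rfl, hvw⟩ (hbK _ ▸ hv) (hbK _ ▸ hw)
    · exact good.low_out _ _ h3' (near_self w) (hbK _ ▸ hw) (hbK _ ▸ hw)
  · have hsub : activeLabels (fun v => nl2 (nl1 (lab v))) (fun A => finish (K2 A)) ⊆
        {A | (base A).heavy} ∪ {A | (pay A).2} := by
      rintro A ⟨-, hA⟩
      rw [hfin_src] at hA
      rcases hK A with h | ⟨c, h⟩
      · by_contra h'
        rw [k2_pend A h h'] at hA
        cases hA
      · rw [k2_done A c h] at hA
        cases hA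
    have h1 := (Set.ncard_le_ncard hsub (Set.toFinite _)).trans (Set.ncard_union_le _ _)
    have h2 := ncard_heavy_mul_le hbK good hd1
    have h3 := ncard_joined_mul_le hbK good p5
    have h4 := Nat.mul_le_mul_right d h1
    rw [add_mul] at h4
    -- Heavy and chosen clusters together number at most `2 / d` times the active ones; the extra
    -- factor in `d = 2^(s+1)` absorbs this `2`.
    have h5 : d = 2 ^ s * 2 := by rw [hd, pow_succ]
    rw [h5, ← mul_assoc] at h4
    rw [h5] at h2 h3
    dsimp only
    omega
  · obtain ⟨w, hw⟩ := w2 v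
    obtain ⟨w', hw'⟩ := w1 w
    exact ⟨w', hw.trans hw'⟩

end level

/-! ### The number of rounds -/

section rounds

variable {W : Type} [Finite W] {B k R L d β : ℕ}

theorem roundCost_le {k R L D D' b c : ℕ} (hk : k ≤ R) (hL : 1 ≤ L) (hD : D ≤ D')
    (hb : b + 2 ≤ c) :
    k * (D * (b + 2)) + 2 * R * (L * D * (b + 2)) ≤ 3 * (R * (L * (D' * c))) := by
  have h1 : k * (D * (b + 2)) ≤ R * (L * (D' * c)) := by
    calc k * (D * (b + 2)) ≤ R * (D' * c) := by gcongr
      _ ≤ R * (L * (D' * c)) := Nat.mul_le_mul_left _ (Nat.le_mul_of_pos_left _ hL)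
  have h2 : R * (L * D * (b + 2)) ≤ R * (L * (D' * c)) := by
    rw [mul_assoc]
    gcongr
  rw [mul_assoc 2]
  omega

theorem card_payload_le (hB : 1 ≤ B) (β : ℕ) :
    Nat.card (Payload (β * B)) ≤ 2 ^ ((β + 1) * B) := by
  rw [Nat.card_prod, Nat.card_eq_fintype_card, Nat.card_eq_fintype_card, Fintype.card_fin,
    Fintype.card_prop, add_mul, pow_add, one_mul]
  have : 2 ^ 1 ≤ 2 ^ B := Nat.pow_le_pow_right (by norm_num) hB
  exact Nat.mul_le_mul_left _ this

theorem card_triple_le (hB : 1 ≤ B) (hW : Nat.card W ≤ 2 ^ (1 * B)) (β : ℕ) :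
    Nat.card (W × W × Payload (β * B)) ≤ 2 ^ ((β + 3) * B) := by
  have := card_prod_le hW (card_prod_le hW (card_payload_le hB β))
  rwa [show 1 + (1 + (β + 1)) = β + 3 by ring] at this

/-- A bound for the number of rounds that are needed for one exchange between the clusters. -/
def roundCost (R L d β : ℕ) : ℕ := 3 * (R * (L * (d ^ 3 * (β + 5))))

variable [LinearOrder W]

theorem Realizable.inStep (hB : 1 ≤ B) (hW : Nat.card W ≤ 2 ^ (1 * B)) (hk : k ≤ R) (hL : 1 ≤ L)
    (hd : 1 ≤ d) :
    Realizable B (roundCost R L d β) (inStep (W := W) (Q := Payload (β * B)) k R L d) :=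
  (Realizable.clusterRound hB hW (card_triple_le hB hW β) k R L (d ^ 2) _ _ _).mono
    (roundCost_le hk hL (Nat.pow_le_pow_right hd (by norm_num)) (by omega))

theorem Realizable.confRound (hB : 1 ≤ B) (hW : Nat.card W ≤ 2 ^ (1 * B)) (hk : k ≤ R)
    (hL : 1 ≤ L) (hd : 1 ≤ d) (h : W → Base W → Payload (β * B) →
      Set (W × Payload (β * B)) → Payload (β * B)) :
    Realizable B (2 * roundCost R L d β) (confRound k R L d h) := by
  rw [two_mul]
  exact (Realizable.inStep hB hW hk hL hd).andThen
    ((Realizable.clusterRound hB hW (card_triple_le hB hW β) k R L (d ^ 3) _ _ _).mono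
      (roundCost_le hk hL le_rfl (by omega)))

theorem Realizable.grow_roundCost (hB : 1 ≤ B) (hW : Nat.card W ≤ 2 ^ (1 * B)) (hk : k ≤ R)
    (hL : 1 ≤ L) (hd : 1 ≤ d) : Realizable B (roundCost R L d β) (_root_.grow (W := W) k R L) := by
  refine (Realizable.grow hB hW k R L).mono ?_
  have h1 : R ≤ R * L := Nat.le_mul_of_pos_right _ hL
  have h2 : R * L * 3 ≤ R * L * (d ^ 3 * (β + 5)) := by
    refine Nat.mul_le_mul_left _ ?_
    have : 1 ≤ d ^ 3 := Nat.one_le_pow _ _ hd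
    nlinarith
  have h3 : 2 * R * (L * 3) = 6 * (R * L) := by ring
  have h4 : roundCost R L d β = 3 * (R * L * (d ^ 3 * (β + 5))) := by rw [roundCost]; ring
  rw [h3, h4]
  omega

theorem Realizable.level [OrderTop W] (hB : 1 ≤ B) (hW : Nat.card W ≤ 2 ^ (1 * B)) (hk : k ≤ R)
    (hL : 1 ≤ L) (hd : 1 ≤ d) (e T q i : ℕ) :
    Realizable B ((5 + 2 * T + 2 * q) * roundCost R L d β)
      (level (W := W) k R L d e (β * B) B T q i) := by
  have hdeg : Realizable B (roundCost R L d β)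
      (degreeStep (W := W) k R L d (initialPayload (β * B))) :=
    (Realizable.clusterRound hB hW hW k R L d _ _ _).mono
      (roundCost_le hk hL (Nat.le_self_pow (by norm_num) d) (by omega))
  have hfree : Realizable B (roundCost R L d β)
      (freeStep (W := W) (Q := Payload (β * B)) k R L) :=
    (Realizable.clusterRound (b := 0) hB hW (by simp) k R L 1 _ _ _).mono
      (roundCost_le hk hL (Nat.one_le_pow _ _ hd) (by omega))
  have hprep : Realizable B _ (prepare (W := W) k R L d (initialPayload (β * B))) :=
    hdeg.andThen ((Realizable.inStep (β := β) hB hW hk hL hd).andThen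
      ((Realizable.ofLocal _ 0).andThen hfree))
  have hg := Realizable.grow_roundCost (β := β) hB hW hk hL hd
  have := hprep.andThen
    ((Realizable.chain (fun t => Realizable.confRound hB hW hk hL hd
      (recolorUpd e (bitSeq e B t) (β * B))) T).andThen
    ((Realizable.chain (fun i => Realizable.confRound hB hW hk hL hd
      (joinUpd i)) q).andThen
    ((Realizable.ofLocal (fun a : Node W (Work W (Payload (β * B))) =>
      a.setDat (select i q a.dat)) 0).andThen
    (hg.andThen (hg.andThen (Realizable.ofLocal (fun a => a.setDat (finish a.dat)) 0))))))
  refine this.mono (le_of_eq ?_)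
  ring

end rounds

/-! ### All levels -/

section levels

variable {V W : Type} [Finite W] [LinearOrder W] [OrderTop W] {G : SimpleGraph V}
  {k R ρ d e m B T q s : ℕ} {ldr : W → V} {me lab : V → W} {rel : V → Set W}

/-- The palettes `[j * q, (j + 1) * q)` of different levels are disjoint, so colors need to be
compared only within one level. With `k ≤ R` and `1 ≤ ρ`, both `9 * R + 4 * k` and `9 * ρ + 4` are
at most `13` times the old radius; `16` is a convenient power of two. The program uses the final
bounds on every level. -/
theorem levels_config (inv : ClusterInv G k R ρ 1 ldr lab rel) (hk : k ≤ R) (hρ : 1 ≤ ρ)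
    (hd : d = 2 ^ (s + 1)) (hde : d ^ 3 = 2 ^ e) (hB : 1 ≤ B) (hW : Nat.card W ≤ 2 ^ B)
    (hm : ∀ t, bitSeq e B t ≤ m) (hq : 2 ^ bitSeq e B T ≤ q) (j : ℕ) (hj : j ≤ s) :
    ∃ (nl : W → W) (rel' : V → Set W) (K : W → Status),
      NetMap.chain (level k (R * 16 ^ s) (1 + 2 * s) d e m B T q) j V G
        (config me lab rel fun _ => .source) = config me (fun v => nl (lab v)) rel' K ∧
      ClusterInv G k (R * 16 ^ j) (ρ * 16 ^ j) (1 + 2 * j) ldr (fun v => nl (lab v)) rel' ∧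
      (∀ A, K A = .source ∨ ∃ c, K A = .done c) ∧
      (∀ v c, K (nl (lab v)) = .done c → c < j * q) ∧
      (∀ v w c, K (nl (lab v)) = .done c → K (nl (lab w)) = .done c → G.edist v w ≤ k →
        nl (lab v) = nl (lab w)) ∧
      (activeLabels (fun v => nl (lab v)) K).ncard * 2 ^ (s * j) ≤
        (activeLabels lab fun _ => .source).ncard ∧
      ∀ v, ∃ w, nl (lab v) = lab w := by
  induction j with
  | zero =>
    refine ⟨fun A => A, rel, fun _ => .source, rfl, inv.mono (by simp) (by simp) (by simp),
      fun A => Or.inl rfl, fun v c h => (by cases h), fun v w c h => (by cases h), by simp,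
      fun v => ⟨v, rfl⟩⟩
  | succ j ih =>
    obtain ⟨nl, rel', K, h1, h2, h3, h4, h5, h6, h7⟩ := ih (by omega)
    have hpow : 1 ≤ 16 ^ j := Nat.one_le_pow _ _ (by norm_num)
    have hkR : k ≤ R * 16 ^ j := hk.trans (Nat.le_mul_of_pos_right _ hpow)
    have hρ' : 1 ≤ ρ * 16 ^ j := Nat.mul_pos hρ hpow
    have hle : R * 16 ^ (j + 1) ≤ R * 16 ^ s :=
      Nat.mul_le_mul_left _ (Nat.pow_le_pow_right (by norm_num) hj)
    have hR16 : R * 16 ^ (j + 1) = 16 * (R * 16 ^ j) := by ring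
    have hρ16 : ρ * 16 ^ (j + 1) = 16 * (ρ * 16 ^ j) := by ring
    obtain ⟨nl', rel'', K', g1, g2, g3, g4, g5, g6, g7, g8⟩ := level_config (me := me) (m := m)
      (T := T) (q := q) (R' := R * 16 ^ s) (L' := 1 + 2 * s) h2 (by omega) (by omega) hd hde hB hW
      hm hq K j h3
    have hold : ∀ A c, K' (nl' A) = .done c → K A = .source ∨ (K A = .done c ∧ nl' A = A) := by
      intro A c hc
      rcases h3 A with h | ⟨c', h⟩
      · exact Or.inl h
      · obtain ⟨e1, e2⟩ := g4 A c' h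
        rw [e1, e2] at hc
        exact Or.inr ⟨h.trans hc, e1⟩
    refine ⟨fun A => nl' (nl A), rel'', K', ?_, g2.mono ?_ ?_ ?_, g3, fun v c hc => ?_,
      fun v w c hv hw hvw => ?_, ?_, fun v => ?_⟩
    · rw [NetMap.chain, NetMap.andThen, h1, g1]
    · omega
    · omega
    · omega
    · rcases hold _ c hc with h | ⟨h, -⟩
      · exact (g5 _ c h hc).2
      · exact (h4 v c h).trans_le (Nat.mul_le_mul_right _ (by omega))
    · rcases hold _ c hv with h | ⟨h, e1⟩ <;> rcases hold _ c hw with h' | ⟨h', e1'⟩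
      · exact congrArg nl' (g6 v w c h h' hv hw hvw)
      · have := (g5 _ c h hv).1
        have := h4 w c h'
        omega
      · have := (g5 _ c h' hw).1
        have := h4 v c h
        omega
      · exact congrArg nl' (h5 v w c h h' hvw)
    · rw [Nat.mul_succ, pow_add, mul_comm (2 ^ (s * j)), ← mul_assoc]
      exact (Nat.mul_le_mul_right _ g7).trans h6
    · obtain ⟨w, hw⟩ := g8 v
      obtain ⟨w', hw'⟩ := h7 w
      exact ⟨w', hw.trans hw'⟩

end levels

/-! ### The output -/

theorem Within.mono_graph {V : Type} {G G' : SimpleGraph V} {U : Set V}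
    (h : ∀ u v, u ∈ U → v ∈ U → G.Adj u v → G'.Adj u v) {T : ℕ} {u v : V}
    (huv : Within G U T u v) : Within G' U T u v := by
  induction T generalizing u with
  | zero => rw [zero_iff] at huv ⊢; exact huv
  | succ T ih =>
    rw [succ_iff] at huv ⊢
    obtain ⟨hu, h' | ⟨w, hw, h'⟩⟩ := huv
    · exact ⟨hu, Or.inl (ih h')⟩
    · exact ⟨hu, Or.inr ⟨w, h u w hu h'.left_mem hw, ih h'⟩⟩

section output

variable {V W : Type} {G : SimpleGraph V} {k R ρ L : ℕ} {ldr : W → V} {lab : V → W}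
  {rel : V → Set W}

/-- An edge inside a block joins near clusters of equal color, so it never leaves a label class.
Conversely, a label class is connected inside its block by walks through the leader. -/
theorem sameCluster_iff (inv : ClusterInv G k R ρ L ldr lab rel) {col : W → ℕ}
    (hsep : ∀ u v, col (lab u) = col (lab v) → G.edist u v ≤ k → lab u = lab v) (u v : V) :
    (SameCluster (powerGraph G k) (fun v => col (lab v)) u v ↔ lab u = lab v) ∧
      (lab u = lab v →
        (blockGraph (powerGraph G k) fun v => col (lab v)).dist u v ≤ 2 * ρ) := by
  have hw : lab u = lab v →
      Within (blockGraph (powerGraph G k) fun v => col (lab v)) {w | lab w = lab v} (2 * ρ) u v := by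
    intro h
    have h1 := inv.strong u
    rw [h] at h1
    have h2 := h1.symm.trans (inv.strong v)
    rw [two_mul]
    refine Within.mono_graph (fun a b ha hb hab => ?_) h2
    exact ⟨hab, congrArg col (Eq.trans ha (Eq.symm hb))⟩
  refine ⟨⟨?_, fun h => ?_⟩, fun h => ?_⟩
  · rintro ⟨p⟩
    clear hw
    induction p with
    | nil => rfl
    | cons hab _ ih => exact (hsep _ _ hab.2 hab.1.2).trans ih
  · obtain ⟨p, -⟩ := hw h
    exact ⟨p⟩
  · obtain ⟨p, hp, -⟩ := hw h
    exact (SimpleGraph.dist_le p).trans hp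

theorem outputsDecomposition {S c D : ℕ} (inv : ClusterInv G k R ρ L ldr lab rel) {col : W → ℕ}
    (hsep : ∀ u v, col (lab u) = col (lab v) → G.edist u v ≤ k → lab u = lab v)
    (hc : ∀ v, col (lab v) < c) (hD : 2 * ρ ≤ D) {name : W → BitVec S}
    (hname : Function.Injective name) {ident : V → BitVec S}
    (hident : ∀ v, ident (ldr (lab v)) = name (lab v)) :
    OutputsDecomposition (powerGraph G k) c D ident fun v => (col (lab v), name (lab v)) where
  decomposition :=
    { color_lt := hc
      diam_le := fun u v h => ((sameCluster_iff inv hsep u v).2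
        ((sameCluster_iff inv hsep u v).1.1 h)).trans hD }
  label_eq_iff u v := hname.eq_iff.trans (sameCluster_iff inv hsep u v).1.symm
  label_mem v := ⟨ldr (lab v), (sameCluster_iff inv hsep _ _).1.2
    (inv.lab_ldr v _ (inv.lab_mem v)).symm, (hident v).symm⟩

end output

/-! ### Convergecast and broadcast in the clusters -/

/-- The data of a node in the aggregation: for every label that it relays, its depth in the tree of
the label together with the identifier of its parent, and the product of the values that it has
collected. -/
structure TreeNode (W M : Type) where
  me : W
  lab : W
  rel : Set W
  dep : W → Option (ℕ × W)
  acc : W → M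

section tree

variable {V W M : Type}

open Classical in
/-- The initial data. -/
noncomputable def treeInit {κ : Type} [One M] (a : Node W κ × M) : TreeNode W M :=
  ⟨a.1.me, a.1.lab, a.1.rel, fun l => if l = a.1.me ∧ l ∈ a.1.rel then some (0, a.1.me) else none,
    fun l => if l = a.1.lab then a.2 else 1⟩

open Classical in
/-- The nodes at depth `j` recruit children. -/
noncomputable def bfsStep (L j : ℕ) : NetMap (TreeNode W M) (TreeNode W M) :=
  NetMap.gather L
    (fun a => {p : W × W | p.1 ∈ a.rel ∧ p.2 = a.me ∧ ∃ q, a.dep p.1 = some (j, q)})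
    fun a r => ⟨a.me, a.lab, a.rel, fun l =>
      if h : a.dep l = none ∧ l ∈ a.rel ∧ ∃ u, (l, u) ∈ r then some (j + 1, h.2.2.choose)
      else a.dep l, a.acc⟩

/-- The nodes at depth `R - i` send their values to their parents. -/
noncomputable def convergeStep [CommMonoid M] (R L i : ℕ) : NetMap (TreeNode W M) (TreeNode W M) :=
  NetMap.gather L
    (fun a => {e : W × W × W × M | e.1 ∈ a.rel ∧ e.2.1 = a.me ∧
      a.dep e.1 = some (R - i, e.2.2.1) ∧ e.2.2.2 = a.acc e.1})
    fun a r => ⟨a.me, a.lab, a.rel, a.dep, fun l =>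
      a.acc l * ∏ᶠ e ∈ {e | e ∈ r ∧ e.1 = l ∧ e.2.2.1 = a.me}, e.2.2.2⟩

/-- Every node learns the product of the values in its cluster. -/
noncomputable def aggregate {κ : Type} [CommMonoid M] [Finite M] (R L : ℕ) :
    NetMap (Node W κ × M) M :=
  (NetMap.ofLocal treeInit).andThen ((NetMap.chain (bfsStep L) R).andThen
    ((NetMap.chain (convergeStep R L) R).andThen
      ((flood (fun a => a.rel) (fun a => {p | p.1 = a.me ∧ p.1 ∈ a.rel ∧ p.2 = a.acc p.1}) 1 L
        (fun _ : M => ()) R).andThen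
        (NetMap.ofLocal fun a => pick {m | (a.1.lab, m) ∈ a.2} 1))))

theorem Realizable.aggregate {κ : Type} [Finite W] [CommMonoid M] [Finite M] {B a : ℕ}
    (hB : 1 ≤ B) (hW : Nat.card W ≤ 2 ^ (1 * B)) (hM : Nat.card M ≤ 2 ^ (a * B)) (R L : ℕ) :
    Realizable B (R * L * (9 + 2 * a)) (aggregate (W := W) (M := M) (κ := κ) R L) := by
  have h1 : ∀ j, Realizable B (L * 3) (bfsStep (W := W) (M := M) L j) := fun j =>
    (Realizable.gather hB (card_prod_le hW hW) _ _).mono (by omega)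
  have h2 : ∀ i, Realizable B (L * (a + 4)) (convergeStep (W := W) (M := M) R L i) := fun i =>
    (Realizable.gather hB (card_prod_le hW (card_prod_le hW (card_prod_le hW hM))) _ _).mono
      (Nat.mul_le_mul_left _ (by omega))
  refine ((Realizable.ofLocal treeInit 0).andThen ((Realizable.chain h1 R).andThen
    ((Realizable.chain h2 R).andThen ((Realizable.flood hB hW hM _ _ 1 L _ R).andThen
      (Realizable.ofLocal _ 0))))).mono (le_of_eq ?_)
  ring

variable {G : SimpleGraph V} {k R ρ L : ℕ} {ldr : W → V} {me lab : V → W} {rel : V → Set W}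

/-- `dep` describes the breadth first search trees of depth `j` around the leaders. -/
structure IsBfs (G : SimpleGraph V) (ldr : W → V) (me : V → W) (rel : V → Set W) (j : ℕ)
    (dep : V → W → Option (ℕ × W)) : Prop where
  le : ∀ v l n q, dep v l = some (n, q) → n ≤ j ∧ l ∈ rel v
  start : ∀ l, l ∈ rel (ldr l) → ∃ q, dep (ldr l) l = some (0, q)
  root : ∀ v l q, dep v l = some (0, q) → v = ldr l
  parent : ∀ v l n q, dep v l = some (n + 1, q) →
    ∃ u q', me u = q ∧ G.Adj u v ∧ dep u l = some (n, q')
  reached : ∀ v l, Within G {w | l ∈ rel w} j v (ldr l) → dep v l ≠ none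
  closed : ∀ u v l n q, dep u l = some (n, q) → n < j → G.Adj v u → l ∈ rel v → dep v l ≠ none

/-- The field `closed` drives the induction: neighbors of a node of depth below `j` have already
been recruited, so only nodes of depth exactly `j` need to send. A root recognizes itself by
comparing the label with its own identifier, which is why `me` must be injective here. -/
theorem exists_bfs [Finite W] (inv : ClusterInv G k R ρ L ldr lab rel)
    (hme : Function.Injective me) (hldr : ∀ v, ∀ l ∈ rel v, me (ldr l) = l) (acc : V → W → M)
    {dep0 : V → W → Option (ℕ × W)}
    (hdep0 : ∀ v l, dep0 v l = open Classical in
      if l = me v ∧ l ∈ rel v then some (0, me v) else none) (j : ℕ) :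
    ∃ dep : V → W → Option (ℕ × W),
      (∀ v, NetMap.chain (bfsStep L) j V G
        (fun v => (⟨me v, lab v, rel v, dep0 v, acc v⟩ : TreeNode W M)) v =
          ⟨me v, lab v, rel v, dep v, acc v⟩) ∧ IsBfs G ldr me rel j dep := by
  classical
  induction j with
  | zero =>
    refine ⟨dep0, fun v => rfl, ⟨?_, fun l hl => ⟨me (ldr l), ?_⟩, ?_, ?_, ?_, ?_⟩⟩
    · intro v l n q h
      rw [hdep0] at h
      split_ifs at h with h'
      simp only [Option.some.injEq, Prod.mk.injEq] at h
      exact ⟨by omega, h'.2⟩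
    · rw [hdep0, if_pos ⟨(hldr _ l hl).symm, hl⟩]
    · intro v l q h
      rw [hdep0] at h
      split_ifs at h with h'
      exact hme (h'.1.symm.trans (hldr v l h'.2).symm)
    · intro v l n q h
      rw [hdep0] at h
      split_ifs at h with h'
      simp at h
    · intro v l h
      rw [Within.zero_iff] at h
      have h1 : l ∈ rel v := h.2
      have h2 := hldr v l h1
      rw [← h.1] at h2
      rw [hdep0, if_pos ⟨h2.symm, h1⟩]
      simp
    · intro u v l n q _ h
      omega
  | succ j ih =>
    obtain ⟨dep, h1, h2⟩ := ih
    set snd : V → Set (W × W) := fun u =>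
      {p | p.1 ∈ rel u ∧ p.2 = me u ∧ ∃ q, dep u p.1 = some (j, q)} with hsnd
    have hcap : ∀ u, cap L (snd u) = snd u := fun u => cap_of_le (by
      refine le_trans (Set.ncard_le_ncard (t := (fun l => (l, me u)) '' rel u) ?_ (Set.toFinite _))
        ((Set.ncard_image_le (Set.toFinite _)).trans (inv.card_le u))
      rintro ⟨l, w⟩ ⟨hl, hw, -⟩
      exact ⟨l, hl, by rw [show w = me u from hw]⟩)
    set rcv : V → Set (W × W) := fun v => {e | ∃ u, G.Adj v u ∧ e ∈ snd u} with hrcv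
    set dep' : V → W → Option (ℕ × W) := fun v l =>
      if h : dep v l = none ∧ l ∈ rel v ∧ ∃ u, (l, u) ∈ rcv v then some (j + 1, h.2.2.choose)
      else dep v l with hdep'
    have hkeep : ∀ v l p, dep v l = some p → dep' v l = some p := by
      intro v l p hp
      have : ¬ (dep v l = none ∧ l ∈ rel v ∧ ∃ u, (l, u) ∈ rcv v) := by simp [hp]
      simp only [hdep', dif_neg this, hp]
    have hnew : ∀ v l p, dep' v l = some p → dep v l = some p ∨
        (p.1 = j + 1 ∧ l ∈ rel v ∧ (l, p.2) ∈ rcv v) := by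
      intro v l p hp
      by_cases h : dep v l = none ∧ l ∈ rel v ∧ ∃ u, (l, u) ∈ rcv v
      · simp only [hdep', dif_pos h, Option.some.injEq] at hp
        subst hp
        exact Or.inr ⟨rfl, h.2.1, h.2.2.choose_spec⟩
      · simp only [hdep', dif_neg h] at hp
        exact Or.inl hp
    have hset : ∀ v l, l ∈ rel v → (dep v l ≠ none ∨ ∃ u, (l, u) ∈ rcv v) → dep' v l ≠ none := by
      intro v l hl h
      by_cases h' : dep v l = none ∧ l ∈ rel v ∧ ∃ u, (l, u) ∈ rcv v
      · simp only [hdep', dif_pos h']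
        simp
      · simp only [hdep', dif_neg h']
        rcases h with h | h
        · exact h
        · exact fun h'' => h' ⟨h'', hl, h⟩
    have hsent : ∀ u v l n q, dep u l = some (n, q) → n ≤ j → G.Adj v u → l ∈ rel v →
        dep' v l ≠ none := by
      intro u v l n q hu hn hadj hl
      rcases hn.lt_or_eq with hn | hn
      · exact hset v l hl (Or.inl (h2.closed u v l n q hu hn hadj hl))
      · subst hn
        exact hset v l hl (Or.inr ⟨me u, u, hadj, (h2.le u l n q hu).2, rfl, q, hu⟩)
    refine ⟨dep', fun v => ?_, ⟨?_, fun l hl => ?_, ?_, ?_, ?_, ?_⟩⟩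
    · rw [NetMap.chain, NetMap.andThen, funext h1]
      simp only [bfsStep, NetMap.gather]
      have : ∀ u, cap L {p | p.1 ∈ rel u ∧ p.2 = me u ∧ ∃ q, dep u p.1 = some (j, q)} = snd u := hcap
      simp only [this]
      rfl
    · intro v l n q h
      rcases hnew v l _ h with h | ⟨h, h', -⟩
      · have := h2.le v l n q h
        exact ⟨by omega, this.2⟩
      · exact ⟨le_of_eq h, h'⟩
    · obtain ⟨q, hq⟩ := h2.start l hl
      exact ⟨q, hkeep _ _ _ hq⟩
    · intro v l q h
      rcases hnew v l _ h with h | ⟨h, -⟩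
      · exact h2.root v l q h
      · simp at h
    · intro v l n q h
      rcases hnew v l _ h with h | ⟨h, -, u, hadj, -, h3, q', h4⟩
      · obtain ⟨u, q', h3, h4, h5⟩ := h2.parent v l n q h
        exact ⟨u, q', h3, h4, hkeep _ _ _ h5⟩
      · simp only [Nat.add_right_cancel_iff] at h
        subst h
        exact ⟨u, q', h3.symm, hadj.symm, hkeep _ _ _ h4⟩
    · intro v l h
      rw [Within.succ_iff] at h
      obtain ⟨hl, h | ⟨w, hw, h⟩⟩ := h
      · exact hset v l hl (Or.inl (h2.reached v l h))
      · obtain ⟨⟨n, q⟩, hp⟩ := Option.ne_none_iff_exists'.1 (h2.reached w l h)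
        exact hsent w v l n q hp (h2.le w l n q hp).1 hw hl
    · intro u v l n q h hn hadj hl
      rcases hnew u l _ h with h | ⟨h, -⟩
      · exact hsent u v l n q h (by omega) hadj hl
      · simp only at h
        omega

open Classical in
/-- The nodes of depth at most `n` in the tree of `l`. -/
noncomputable def shallow [Fintype V] (dep : V → W → Option (ℕ × W)) (l : W) (n : ℕ) : Finset V :=
  Finset.univ.filter fun v => ∃ i q, dep v l = some (i, q) ∧ i ≤ n

/-- Every node of depth `n + 1` names exactly one parent, and this parent has depth `n`. Its value
is thus moved to the shallower nodes exactly once. -/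
theorem prod_shallow_succ [Fintype V] [CommMonoid M] {dep : V → W → Option (ℕ × W)}
    (hbfs : IsBfs G ldr me rel R dep) (hme : Function.Injective me) (l : W) (n : ℕ)
    (acc : V → M) (kids : V → Finset V)
    (hkids : ∀ u c, c ∈ kids u ↔ G.Adj u c ∧ dep c l = some (n + 1, me u)) :
    ∏ u ∈ shallow dep l n, (acc u * ∏ c ∈ kids u, acc c) = ∏ u ∈ shallow dep l (n + 1), acc u := by
  classical
  rw [Finset.prod_mul_distrib]
  have hdisj : Disjoint (shallow dep l n) ((shallow dep l n).biUnion kids) := by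
    rw [Finset.disjoint_left]
    intro c hc hc'
    rw [Finset.mem_biUnion] at hc'
    obtain ⟨u, -, hu⟩ := hc'
    obtain ⟨i, q, h1, h2⟩ := (Finset.mem_filter.1 hc).2
    rw [((hkids u c).1 hu).2] at h1
    simp only [Option.some.injEq, Prod.mk.injEq] at h1
    omega
  have hunion : shallow dep l (n + 1) = shallow dep l n ∪ (shallow dep l n).biUnion kids := by
    ext c
    simp only [shallow, Finset.mem_union, Finset.mem_biUnion, Finset.mem_filter, Finset.mem_univ,
      true_and, hkids]
    constructor
    · rintro ⟨i, q, h1, h2⟩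
      rcases h2.lt_or_eq with h2 | rfl
      · exact Or.inl ⟨i, q, h1, by omega⟩
      · obtain ⟨u, q', rfl, h3, h4⟩ := hbfs.parent c l n q h1
        exact Or.inr ⟨u, ⟨n, q', h4, le_rfl⟩, h3, h1⟩
    · rintro (⟨i, q, h1, h2⟩ | ⟨u, -, -, h1⟩)
      · exact ⟨i, q, h1, by omega⟩
      · exact ⟨n + 1, _, h1, le_rfl⟩
  rw [hunion, Finset.prod_union hdisj, Finset.prod_biUnion]
  intro u _ u' _ hne
  rw [Function.onFun, Finset.disjoint_left]
  intro c hc hc'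
  have h1 := ((hkids u c).1 hc).2
  rw [((hkids u' c).1 hc').2] at h1
  simp only [Option.some.injEq, Prod.mk.injEq, true_and] at h1
  exact hne (hme h1).symm

/-- The invariant is the product over the nodes of depth at most `R - i`. Each step empties the
deepest layer, until only the root carries the product. -/
theorem exists_converge [Fintype V] [Finite W] [CommMonoid M] [Finite M]
    (inv : ClusterInv G k R ρ L ldr lab rel) (hme : Function.Injective me)
    {dep : V → W → Option (ℕ × W)} (hbfs : IsBfs G ldr me rel R dep) (acc0 : V → W → M) (i : ℕ)
    (hi : i ≤ R) :
    ∃ acc : V → W → M,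
      (∀ v, NetMap.chain (convergeStep R L) i V G
        (fun v => (⟨me v, lab v, rel v, dep v, acc0 v⟩ : TreeNode W M)) v =
          ⟨me v, lab v, rel v, dep v, acc v⟩) ∧
      ∀ l, ∏ v ∈ shallow dep l (R - i), acc v l = ∏ v ∈ shallow dep l R, acc0 v l := by
  classical
  induction i with
  | zero => exact ⟨acc0, fun v => rfl, fun l => rfl⟩
  | succ i ih =>
    obtain ⟨acc, h1, h2⟩ := ih (by omega)
    set snd : V → Set (W × W × W × M) := fun u => {e | e.1 ∈ rel u ∧ e.2.1 = me u ∧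
      dep u e.1 = some (R - i, e.2.2.1) ∧ e.2.2.2 = acc u e.1} with hsnd
    have hcap : ∀ u, cap L (snd u) = snd u := fun u => cap_of_le (by
      refine le_trans (Set.ncard_le_ncard_of_injOn (fun e => e.1) (fun e he => he.1) ?_
        (Set.toFinite _)) (inv.card_le u)
      rintro ⟨l, a, b, c⟩ ⟨-, h2, h3, h4⟩ ⟨l', a', b', c'⟩ ⟨-, h2', h3', h4'⟩ h
      simp only at h h2 h3 h4 h2' h3' h4'
      subst h
      rw [h3] at h3'
      simp only [Option.some.injEq, Prod.mk.injEq, true_and] at h3'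
      rw [h2, h2', h3', h4, h4'])
    set kids : W → V → Finset V := fun l u =>
      Finset.univ.filter fun c => G.Adj u c ∧ dep c l = some (R - i, me u) with hkids
    refine ⟨fun v l => acc v l * ∏ c ∈ kids l v, acc c l, fun v => ?_, fun l => ?_⟩
    · rw [NetMap.chain, NetMap.andThen, funext h1]
      simp only [convergeStep, NetMap.gather]
      have : ∀ u, cap L {e : W × W × W × M | e.1 ∈ rel u ∧ e.2.1 = me u ∧
        dep u e.1 = some (R - i, e.2.2.1) ∧ e.2.2.2 = acc u e.1} = snd u := hcap
      simp only [this]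
      rw [TreeNode.mk.injEq]
      refine ⟨rfl, rfl, rfl, rfl, funext fun l => ?_⟩
      congr 1
      have himg : {e : W × W × W × M | e ∈ {e | ∃ u, G.Adj v u ∧ e ∈ snd u} ∧ e.1 = l ∧
          e.2.2.1 = me v} = (fun c => (l, me c, me v, acc c l)) '' (kids l v : Set V) := by
        ext ⟨l', a, b, c⟩
        constructor
        · rintro ⟨⟨u, hu, -, g2, g3, g4⟩, g5, g6⟩
          simp only at g2 g3 g4 g5 g6
          subst g5 g6 g2 g4
          exact ⟨u, by simp [hkids, hu, g3], rfl⟩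
        · rintro ⟨u, hu, he⟩
          simp only [Prod.mk.injEq] at he
          obtain ⟨rfl, rfl, rfl, rfl⟩ := he
          have hu' : G.Adj v u ∧ dep u l = some (R - i, me v) := by simpa [hkids] using hu
          exact ⟨⟨u, hu'.1, (hbfs.le u l _ _ hu'.2).2, rfl, hu'.2, rfl⟩, rfl, rfl⟩
      rw [himg, finprod_mem_image, finprod_mem_coe_finset]
      intro c _ c' _ h
      simp only [Prod.mk.injEq] at h
      exact hme h.2.1
    · have hn : R - i = R - (i + 1) + 1 := by omega
      rw [← h2 l, hn]
      refine prod_shallow_succ hbfs hme l _ (fun v => acc v l) (kids l) fun u c => ?_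
      simp [hkids, ← hn]

theorem aggregate_apply {κ : Type} [Fintype V] [Finite W] [CommMonoid M] [Finite M]
    (inv : ClusterInv G k R ρ L ldr lab rel) (hme : Function.Injective me)
    (hldr : ∀ v, ∀ l ∈ rel v, me (ldr l) = l) (K : W → κ) (x : V → M) (v : V) :
    aggregate R L V G (fun v => (config me lab rel K v, x v)) v =
      open Classical in ∏ u ∈ Finset.univ.filter (fun u => lab v = lab u), x u := by
  classical
  simp only [aggregate, NetMap.andThen]
  have hinit : NetMap.ofLocal treeInit V G (fun v => (config me lab rel K v, x v)) =
      fun v => (⟨me v, lab v, rel v,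
        fun l => if l = me v ∧ l ∈ rel v then some (0, me v) else none,
        fun l => if l = lab v then x v else 1⟩ : TreeNode W M) := by
    funext v
    simp only [NetMap.ofLocal, treeInit, config, TreeNode.mk.injEq, true_and]
    constructor <;> (funext l; congr)
  rw [hinit]
  obtain ⟨dep, h1, hbfs⟩ := exists_bfs inv hme hldr (fun v l => if l = lab v then x v else 1)
    (dep0 := fun v l => if l = me v ∧ l ∈ rel v then some (0, me v) else none)
    (fun v l => by congr) R
  rw [funext h1]
  obtain ⟨acc, h2, h3⟩ := exists_converge inv hme hbfs
    (fun v l => if l = lab v then x v else 1) R le_rfl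
  rw [funext h2]
  have hall : ∀ l u, l ∈ rel u → u ∈ shallow dep l R := by
    intro l u hl
    obtain ⟨⟨n, q⟩, hp⟩ := Option.ne_none_iff_exists'.1 (hbfs.reached u l (inv.relay u l hl).symm)
    simp only [shallow, Finset.mem_filter, Finset.mem_univ, true_and]
    exact ⟨n, q, hp, (hbfs.le u l n q hp).1⟩
  have hroot : shallow dep (lab v) (R - R) = {ldr (lab v)} := by
    ext u
    simp only [shallow, Finset.mem_filter, Finset.mem_univ, true_and, Finset.mem_singleton,
      Nat.sub_self]
    constructor
    · rintro ⟨n, q, hn, h0⟩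
      obtain rfl : n = 0 := by omega
      exact hbfs.root u _ q hn
    · rintro rfl
      have hl : lab v ∈ rel (ldr (lab v)) := (inv.relay v _ (inv.lab_mem v)).left_mem
      obtain ⟨q, hq⟩ := hbfs.start _ hl
      exact ⟨0, q, hq, le_rfl⟩
  -- Nodes that merely relay the label contribute `1`, so the product at the root runs over the
  -- cluster only.
  have hval : acc (ldr (lab v)) (lab v) =
      ∏ u ∈ Finset.univ.filter (fun u => lab v = lab u), x u := by
    have := h3 (lab v)
    rw [hroot, Finset.prod_singleton] at this
    rw [this, Finset.prod_filter]
    refine Finset.prod_subset (Finset.subset_univ _) fun u _ hu => ?_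
    rw [if_neg]
    intro h
    exact hu (hall _ _ (h ▸ inv.lab_mem u))
  simp only [NetMap.ofLocal]
  rw [flood_apply G _ _ 1 L _ R _ (fun v => by rw [Nat.mul_one]; exact inv.card_le v)]
  simp only [Set.mem_ofPred_eq, inv.lab_mem, true_and]
  have hset : {e | ∃ u, Within G {w | lab v ∈ rel w} R v u ∧ lab v = me u ∧ lab v ∈ rel u ∧
      e = acc u (lab v)} = {acc (ldr (lab v)) (lab v)} := by
    ext e
    constructor
    · rintro ⟨u, -, h4, h5, rfl⟩
      have : u = ldr (lab v) := hme (h4.symm.trans (hldr u _ h5).symm)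
      rw [this]
      rfl
    · rintro rfl
      have hw := inv.relay v _ (inv.lab_mem v)
      exact ⟨_, hw.symm, (hldr v _ (inv.lab_mem v)).symm, hw.left_mem, rfl⟩
  rw [hset, trunc_eq_self (by simp), ← hval]
  exact pick_mem (Set.singleton_nonempty _) 1

end tree

/-! ### The parameters of the algorithm -/

/-- An integer version of `√(log₂ N)`. -/
def scale (N : ℕ) : ℕ := Nat.sqrt (Nat.clog 2 N) + 1

/-- The bound for the number of colors, the diameters, and the number of rounds. -/
def decompositionBound (N : ℕ) : ℕ := 2 ^ (300 * scale N)

theorem one_le_scale (N : ℕ) : 1 ≤ scale N := Nat.le_add_left _ _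

theorem lt_two_pow_scale_mul_scale (N : ℕ) : N < 2 ^ (scale N * scale N) := by
  have h1 : N ≤ 2 ^ Nat.clog 2 N := Nat.le_pow_clog (by norm_num) N
  have h2 : Nat.clog 2 N < scale N * scale N := by
    rw [← pow_two]
    exact Nat.lt_succ_sqrt' _
  exact h1.trans_lt (Nat.pow_lt_pow_right (by norm_num) h2)

theorem isTwoPowBigOSqrtLog_decompositionBound :
    IsTwoPowBigOSqrtLog decompositionBound := by
  -- The constant is `300 * 3`, since `scale N ≤ 3 * √(log₂ N)` for `N ≥ 2`.
  refine ⟨900, Filter.eventually_atTop.2 ⟨2, fun N hN => ?_⟩⟩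
  have hN0 : (0 : ℝ) < N := by exact_mod_cast (by omega : 0 < N)
  have hlog : 1 ≤ Real.logb 2 N := by
    rw [Real.le_logb_iff_rpow_le (by norm_num) hN0, Real.rpow_one]
    exact_mod_cast hN
  have hclog : (Nat.clog 2 N : ℝ) ≤ Real.logb 2 N + 1 := by
    have h1 := Nat.pow_pred_clog_lt_self (b := 2) (by norm_num) (x := N) (by omega)
    have h2 : ((Nat.clog 2 N).pred : ℝ) ≤ Real.logb 2 N := by
      rw [Real.le_logb_iff_rpow_le (by norm_num) hN0, Real.rpow_natCast]
      exact_mod_cast h1.le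
    have h3 : Nat.clog 2 N ≤ (Nat.clog 2 N).pred + 1 := by
      rw [Nat.pred_eq_sub_one]
      omega
    have h4 : (Nat.clog 2 N : ℝ) ≤ (Nat.clog 2 N).pred + 1 := by exact_mod_cast h3
    linarith
  have hsqrt : (1 : ℝ) ≤ √(Real.logb 2 N) := Real.one_le_sqrt.2 hlog
  have hs : (scale N : ℝ) ≤ 3 * √(Real.logb 2 N) := by
    have h1 : ((Nat.clog 2 N).sqrt : ℝ) ≤ √(Nat.clog 2 N) := Real.nat_sqrt_le_real_sqrt
    have h2 : √(Nat.clog 2 N : ℝ) ≤ 2 * √(Real.logb 2 N) := by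
      rw [Real.sqrt_le_left (by positivity), mul_pow, Real.sq_sqrt (by linarith)]
      linarith
    rw [scale]
    push_cast
    linarith
  rw [decompositionBound, Nat.cast_pow, Nat.cast_ofNat, ← Real.rpow_natCast]
  refine Real.rpow_le_rpow_of_exponent_le (by norm_num) ?_
  push_cast
  linarith

section numerics

variable {s : ℕ}

theorem le_two_pow_mul {a b : ℕ} (hs : 1 ≤ s) (h : a ≤ 2 ^ b) : a ≤ 2 ^ (b * s) :=
  h.trans (Nat.pow_le_pow_right (by norm_num) (Nat.le_mul_of_pos_right _ hs))

theorem one_add_two_mul_le (s : ℕ) : 1 + 2 * s ≤ 2 ^ (2 * s) := by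
  have h : s < 2 ^ s := Nat.lt_two_pow_self
  rw [two_mul, pow_add]
  nlinarith

theorem colors_le (hs : 1 ≤ s) : 2 ^ finalBits (3 * (s + 1)) ≤ 2 ^ (234 * s) :=
  Nat.pow_le_pow_right (by norm_num) (by rw [finalBits]; omega)

theorem mul_colors_le (hs : 1 ≤ s) : s * 2 ^ finalBits (3 * (s + 1)) ≤ 2 ^ (300 * s) := by
  calc s * 2 ^ finalBits (3 * (s + 1)) ≤ 2 ^ s * 2 ^ (234 * s) :=
        Nat.mul_le_mul Nat.lt_two_pow_self.le (colors_le hs)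
    _ = 2 ^ (s + 234 * s) := by rw [pow_add]
    _ ≤ 2 ^ (300 * s) := Nat.pow_le_pow_right (by norm_num) (by omega)

theorem diameter_le (hs : 1 ≤ s) (r : ℕ) : 2 * (r * 16 ^ s) ≤ r * 2 ^ (300 * s) := by
  have h : 2 * 16 ^ s ≤ 2 ^ (300 * s) := by
    calc 2 * 16 ^ s ≤ 2 ^ s * 2 ^ (4 * s) := by
          refine Nat.mul_le_mul ?_ (le_of_eq ?_)
          · exact (Nat.pow_le_pow_right (by norm_num) hs : 2 ^ 1 ≤ 2 ^ s)
          · rw [pow_mul]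
            norm_num
      _ = 2 ^ (s + 4 * s) := by rw [pow_add]
      _ ≤ 2 ^ (300 * s) := Nat.pow_le_pow_right (by norm_num) (by omega)
  calc 2 * (r * 16 ^ s) = r * (2 * 16 ^ s) := by ring
    _ ≤ _ := Nat.mul_le_mul_left _ h

/-- The dominant term is the greedy pass over the colors, at most `2^(234 * s)` on each level. The
exponents add up to `262 * s`: one for the levels, `238` for the exchanges of a level, and `2 + 4 +
2 + 6 + 9` for the cost of an exchange. -/
theorem rounds_le (hs : 1 ≤ s) {l : ℕ} (hl : 1 ≤ l) (K : ℕ) :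
    s * ((5 + 2 * (2 * l) + 2 * 2 ^ finalBits (3 * (s + 1))) *
      roundCost (K * 16 ^ s) (1 + 2 * s) (2 ^ (s + 1)) (finalBits (3 * (s + 1)))) ≤
      K * 2 ^ (300 * s) * l := by
  have h1 : 5 + 2 * (2 * l) + 2 * 2 ^ finalBits (3 * (s + 1)) ≤ l * 2 ^ (238 * s) := by
    have hq := colors_le hs
    have hq1 : 1 ≤ 2 ^ (234 * s) := Nat.one_le_two_pow
    have h16 : 16 ≤ 2 ^ (4 * s) := le_two_pow_mul hs (b := 4) (by norm_num)
    have e1 : 2 ^ (238 * s) = 2 ^ (4 * s) * 2 ^ (234 * s) := by rw [← pow_add]; ring_nf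
    rw [e1]
    calc 5 + 2 * (2 * l) + 2 * 2 ^ finalBits (3 * (s + 1)) ≤ l * (16 * 2 ^ (234 * s)) := by
          nlinarith
      _ ≤ _ := by gcongr
  have h2 : (2 ^ (s + 1)) ^ 3 ≤ 2 ^ (6 * s) := by
    rw [← pow_mul]
    exact Nat.pow_le_pow_right (by norm_num) (by omega)
  have h3 : finalBits (3 * (s + 1)) + 5 ≤ 2 ^ (9 * s) := by
    have e1 : 2 ^ (9 * s) = 2 ^ (8 * s) * 2 ^ s := by rw [← pow_add]; ring_nf
    have e2 : 256 ≤ 2 ^ (8 * s) := le_two_pow_mul hs (b := 8) (by norm_num)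
    have e3 : s ≤ 2 ^ s := Nat.lt_two_pow_self.le
    rw [finalBits, e1]
    calc 22 * (3 * (s + 1)) + 102 + 5 ≤ 256 * s := by omega
      _ ≤ _ := Nat.mul_le_mul e2 e3
  have h4 : 3 ≤ 2 ^ (2 * s) := le_two_pow_mul hs (b := 2) (by norm_num)
  have h5 : 16 ^ s = 2 ^ (4 * s) := by rw [pow_mul]; norm_num
  have h6 : s ≤ 2 ^ s := Nat.lt_two_pow_self.le
  rw [roundCost, h5]
  calc _ ≤ 2 ^ s * ((l * 2 ^ (238 * s)) * (2 ^ (2 * s) * ((K * 2 ^ (4 * s)) *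
        (2 ^ (2 * s) * (2 ^ (6 * s) * 2 ^ (9 * s)))))) := by
        gcongr
        exact one_add_two_mul_le s
    _ = K * 2 ^ (262 * s) * l := by
        have : 2 ^ (262 * s) = 2 ^ s * 2 ^ (238 * s) * 2 ^ (2 * s) * 2 ^ (4 * s) * 2 ^ (2 * s) *
            2 ^ (6 * s) * 2 ^ (9 * s) := by
          simp only [← pow_add]
          ring_nf
        rw [this]
        ring
    _ ≤ K * 2 ^ (300 * s) * l :=
        Nat.mul_le_mul_right _ (Nat.mul_le_mul_left _
          (Nat.pow_le_pow_right (by norm_num) (by omega)))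

theorem aggregate_rounds_le (hs : 1 ≤ s) {a : ℕ} (ha : 1 ≤ a) (K : ℕ) :
    K * 16 ^ s * (1 + 2 * s) * (9 + 2 * a) ≤ a * K * 2 ^ (300 * s) := by
  have h4 : 11 ≤ 2 ^ (4 * s) := le_two_pow_mul hs (b := 4) (by norm_num)
  have h5 : 16 ^ s = 2 ^ (4 * s) := by rw [pow_mul]; norm_num
  have h6 : 9 + 2 * a ≤ 2 ^ (4 * s) * a := by nlinarith
  rw [h5]
  calc _ ≤ K * 2 ^ (4 * s) * 2 ^ (2 * s) * (2 ^ (4 * s) * a) := by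
        gcongr
        exact one_add_two_mul_le s
    _ = a * K * 2 ^ (10 * s) := by
        have : 2 ^ (10 * s) = 2 ^ (4 * s) * 2 ^ (2 * s) * 2 ^ (4 * s) := by
          simp only [← pow_add]
          ring_nf
        rw [this]
        ring
    _ ≤ a * K * 2 ^ (300 * s) := by
        gcongr
        · norm_num
        · norm_num

end numerics

/-! ### The algorithm -/

/-- The computation of the network decomposition. -/
noncomputable def decompose (N S k r : ℕ) : NetMap (BitVec S × Bool) (Node (Fin (2 ^ S)) Status) :=
  (NetMap.ofLocal fun x => ⟨x.1.toFin, x.1.toFin, {x.1.toFin}, .source⟩).andThen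
    (NetMap.chain (level k (k * r * 16 ^ scale N) (1 + 2 * scale N) (2 ^ (scale N + 1))
      (3 * (scale N + 1)) (finalBits (3 * (scale N + 1)) * S) S (2 * logStar S)
      (2 ^ finalBits (3 * (scale N + 1)))) (scale N))

theorem one_le_logStar {S : ℕ} (hS : 2 ≤ S) : 1 ≤ logStar S := by
  rw [logStar, if_neg (by omega)]
  omega

theorem card_fin_le (S : ℕ) : Nat.card (Fin (2 ^ S)) ≤ 2 ^ (1 * S) := by simp

theorem Realizable.decompose (N k : ℕ) {S r : ℕ} (hS : 2 ≤ S) (hr : 1 ≤ r) :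
    Realizable S (k * r * decompositionBound N * logStar S) (decompose N S k r) := by
  have hk : k ≤ k * r * 16 ^ scale N := by
    rw [mul_assoc]
    exact Nat.le_mul_of_pos_right _ (Nat.mul_pos hr (by positivity))
  refine ((Realizable.ofLocal _ 0).andThen (Realizable.chain (fun i => Realizable.level
    (by omega) (card_fin_le S) hk (by omega) Nat.one_le_two_pow _ _ _ i) (scale N))).mono ?_
  rw [Nat.zero_add]
  exact rounds_le (one_le_scale N) (one_le_logStar hS) (k * r)

/-- The color of a finished cluster. -/
def Status.color : Status → ℕ
  | .done c => c
  | _ => 0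

section decompose

variable {V : Type} {G : SimpleGraph V} {N S k r : ℕ} {center : V → V} {ident : V → BitVec S}

/-- Edges of `G` are edges of `G^k`, so the initial radius `r` is also a radius in `G^k`. The relay
radius is enlarged to `k * r` in order to dominate `k`. Labels that do not occur get an arbitrary
leader. -/
theorem exists_initial_inv [Nonempty V] (hk : 1 ≤ k) (hc : IsClustering G r center)
    (hident : Set.InjOn ident (Set.range center)) :
    ∃ ldr : Fin (2 ^ S) → V, (∀ v, ldr (ident (center v)).toFin = center v) ∧
      ClusterInv G k (k * r) r 1 ldr (fun v => (ident (center v)).toFin)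
        (fun v => {(ident (center v)).toFin}) := by
  classical
  have hinj : ∀ u v, (ident (center u)).toFin = (ident (center v)).toFin → center u = center v :=
    fun u v h => hident ⟨u, rfl⟩ ⟨v, rfl⟩ (BitVec.toFin_inj.1 h)
  have hldr : ∀ l : Fin (2 ^ S), ∃ c, ∀ v, (ident (center v)).toFin = l → c = center v := by
    intro l
    by_cases h : ∃ v, (ident (center v)).toFin = l
    · obtain ⟨v, hv⟩ := h
      exact ⟨center v, fun u hu => hinj v u (hv.trans hu.symm)⟩
    · exact ⟨Classical.arbitrary V, fun v hv => absurd ⟨v, hv⟩ h⟩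
  choose ldr hldr using hldr
  have hl : ∀ v, ldr (ident (center v)).toFin = center v := fun v => hldr _ v rfl
  have hwalk : ∀ v, Within G {w | center w = center v} r (center v) v := hc.radius_le
  refine ⟨ldr, hl, ⟨fun v => rfl, ?_, ?_, fun v => ?_, fun v => by simp⟩⟩
  · rintro v l rfl
    rw [hl, hc.center_center]
  · rintro v l rfl
    rw [hl]
    refine (hwalk v).mono (fun w hw => ?_) (Nat.le_mul_of_pos_left _ hk)
    exact congrArg (fun c => (ident c).toFin) (Eq.symm hw)
  · rw [hl]
    have : Within G {w | (ident (center w)).toFin = (ident (center v)).toFin} r (center v) v :=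
      (hwalk v).mono (fun w hw => congrArg (fun c => (ident c).toFin) hw) le_rfl
    refine Within.mono_graph (fun a b _ _ hab => ?_) this
    refine ⟨hab.ne, ?_⟩
    have h1 : G.edist a b ≤ 1 := by
      simpa using SimpleGraph.Walk.edist_le hab.toWalk
    exact h1.trans (by exact_mod_cast hk)

theorem decompose_apply [Finite V] [Nonempty V] (hS : 1 ≤ S) (hk : 1 ≤ k) (hr : 1 ≤ r)
    (hc : IsClustering G r center) (hN : (Set.range center).ncard = N)
    (hident : Set.InjOn ident (Set.range center)) :
    ∃ (ldr : Fin (2 ^ S) → V) (lab : V → Fin (2 ^ S)) (rel : V → Set (Fin (2 ^ S)))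
      (K : Fin (2 ^ S) → Status),
      decompose N S k r V G (clusterInput ident center) =
        config (fun v => (ident (center v)).toFin) lab rel K ∧
      ClusterInv G k (k * r * 16 ^ scale N) (r * 16 ^ scale N) (1 + 2 * scale N) ldr lab rel ∧
      (∀ v, (K (lab v)).color < decompositionBound N) ∧
      (∀ u v, (K (lab u)).color = (K (lab v)).color → G.edist u v ≤ k → lab u = lab v) ∧
      (∀ v, lab (center v) = lab v) ∧
      ∀ v, ∀ l ∈ rel v, (ident (center (ldr l))).toFin = l := by
  obtain ⟨ldr, hldr, inv⟩ := exists_initial_inv (k := k) hk hc hident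
  set s := scale N with hs
  set lab0 : V → Fin (2 ^ S) := fun v => (ident (center v)).toFin with hlab0
  have hβ : 1 ≤ finalBits (3 * (s + 1)) := by rw [finalBits]; omega
  obtain ⟨nl, rel, K, h1, h2, h3, h4, h5, h6, h7⟩ := levels_config (me := lab0)
    (m := finalBits (3 * (s + 1)) * S) (T := 2 * logStar S) (q := 2 ^ finalBits (3 * (s + 1)))
    inv (Nat.le_mul_of_pos_right _ hr) hr (rfl : 2 ^ (s + 1) = 2 ^ (s + 1))
    (by rw [← pow_mul, mul_comm]) hS (by simp)
    (fun t => (bitSeq_le (3 * (s + 1)) S t).trans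
      (max_le (Nat.le_mul_of_pos_left _ hβ) (Nat.le_mul_of_pos_right _ hS)))
    (Nat.pow_le_pow_right (by norm_num) (bitSeq_two_mul_logStar_le _ _)) s le_rfl
  have hact : (activeLabels lab0 fun _ => .source).ncard ≤ N := by
    have hsub : activeLabels lab0 (fun _ => .source) ⊆
        (fun c => (ident c).toFin) '' Set.range center := by
      rintro A ⟨⟨v, rfl⟩, -⟩
      exact ⟨center v, ⟨v, rfl⟩, rfl⟩
    rw [← hN]
    exact (Set.ncard_le_ncard hsub (Set.toFinite _)).trans (Set.ncard_image_le (Set.toFinite _))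
  -- One remaining active cluster would give `2^(s * s) ≤ N`.
  have hnone : ∀ v, ∃ c, K (nl (lab0 v)) = .done c := by
    intro v
    rcases h3 (nl (lab0 v)) with h | h
    · have hpos : 1 ≤ (activeLabels (fun v => nl (lab0 v)) K).ncard :=
        (Set.ncard_pos (Set.toFinite _)).2 ⟨_, ⟨v, rfl⟩, h⟩
      have h8 := (Nat.mul_le_mul_right (2 ^ (s * s)) hpos).trans (h6.trans hact)
      have h9 := lt_two_pow_scale_mul_scale N
      rw [one_mul] at h8
      exact absurd h9 (not_lt.2 h8)
    · exact h
  refine ⟨ldr, fun v => nl (lab0 v), rel, K, h1, h2, fun v => ?_, fun u v huv hd => ?_,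
    fun v => ?_, fun v l hl => ?_⟩
  · obtain ⟨c, hc⟩ := hnone v
    rw [hc]
    exact (h4 v c hc).trans_le (mul_colors_le (one_le_scale N))
  · obtain ⟨c, hc⟩ := hnone u
    obtain ⟨c', hc'⟩ := hnone v
    rw [hc, hc'] at huv
    obtain rfl : c = c' := huv
    exact h5 u v c hc hc' hd
  · simp only [hlab0, hc.center_center]
  · obtain ⟨w, hw⟩ := h7 (ldr l)
    have h8 := h2.lab_ldr v l hl
    rw [show nl (lab0 (ldr l)) = l from h8] at hw
    rw [hw, hldr w, hc.center_center]

end decompose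

/-! ### The main theorem -/

theorem outputsDecomposition_of_isEmpty {V : Type} [IsEmpty V] {S : ℕ} (H : SimpleGraph V)
    (c d : ℕ) (ident : V → BitVec S) (out : V → ℕ × BitVec S) :
    OutputsDecomposition H c d ident out :=
  ⟨⟨fun v => isEmptyElim v, fun v => isEmptyElim v⟩, fun v => isEmptyElim v,
    fun v => isEmptyElim v⟩

/-- `A` computes network decompositions of the `k`-th powers of networks with `N` clusters of radius
at most `r`. -/
def DecomposesPower {B : ℕ} (g : ℕ → ℕ) (N S k r : ℕ)
    (A : CongestAlgorithm (BitVec S × Bool) (ℕ × BitVec S) B) : Prop :=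
  ∀ (V : Type) [Fintype V] (G : SimpleGraph V) (P : PortNumbering G) (center : V → V)
    (ident : V → BitVec S), IsClustering G r center → (Set.range center).ncard = N →
    Set.InjOn ident (Set.range center) →
    OutputsDecomposition (powerGraph G k) (g N) (r * g N) (fun v => ident (center v))
      (A.result P (clusterInput ident center) (k * r * g N * logStar S)) ∧
    ∀ v, SameCluster (powerGraph G k)
      (fun w => (A.result P (clusterInput ident center) (k * r * g N * logStar S) w).1) (center v) v

/-- After `A` has been run, products of values of `a * S` bits can be computed in all clusters. -/
def AggregatesAfter {B : ℕ} (g : ℕ → ℕ) (N S k r a : ℕ)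
    (A : CongestAlgorithm (BitVec S × Bool) (ℕ × BitVec S) B) : Prop :=
  ∀ (M : Type) [CommMonoid M] [Finite M], Nat.card M ≤ 2 ^ (a * S) →
    ∃ R : CongestAlgorithm (A.State × M) M B,
    ∀ (V : Type) [Fintype V] (G : SimpleGraph V) (P : PortNumbering G) (ident : V → BitVec S),
      Fintype.card V = N → Function.Injective ident → ∀ (x : V → M) (v : V),
      R.result P
        (fun u => (A.run P (fun w => (ident w, true)) (k * r * g N * logStar S) u, x u))
        (a * (k * r) * g N) v =
      ∏ u ∈ clusterOf (powerGraph G k)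
        (fun w => (A.result P (fun w => (ident w, true)) (k * r * g N * logStar S) w).1) v, x u

theorem clusterInput_id {V : Type} {S : ℕ} (ident : V → BitVec S) :
    clusterInput ident id = fun v => (ident v, true) := by
  funext v
  simp [clusterInput]

theorem isClustering_id {V : Type} (G : SimpleGraph V) (r : ℕ) : IsClustering G r id :=
  ⟨fun _ => rfl, fun v => ⟨.nil, by simp, by simp⟩⟩

theorem ncard_range_id {V : Type} [Fintype V] {N : ℕ} (h : Fintype.card V = N) :
    (Set.range (id : V → V)).ncard = N := by
  rw [Set.range_id, Set.ncard_univ, Nat.card_eq_fintype_card, h]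

theorem prod_clusterOf {V W M : Type} [Fintype V] [CommMonoid M] {G : SimpleGraph V}
    {k R ρ L : ℕ} {ldr : W → V} {lab : V → W} {rel : V → Set W}
    (inv : ClusterInv G k R ρ L ldr lab rel) {col : W → ℕ}
    (hsep : ∀ u v, col (lab u) = col (lab v) → G.edist u v ≤ k → lab u = lab v) (x : V → M)
    (v : V) :
    ∏ u ∈ clusterOf (powerGraph G k) (fun v => col (lab v)) v, x u =
      open Classical in ∏ u ∈ Finset.univ.filter (fun u => lab v = lab u), x u := by
  classical
  refine Finset.prod_congr ?_ fun _ _ => rfl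
  ext u
  simp only [clusterOf, Finset.mem_filter, Finset.mem_univ, true_and]
  exact (sameCluster_iff inv hsep v u).1

/-- For identifiers of at most one bit, the identifiers are used as colors. -/
theorem exists_algorithm_of_le_one {S : ℕ} (hS : S ≤ 1) (N : ℕ) {k : ℕ} (r : ℕ) (hk : 1 ≤ k) :
    ∃ A : CongestAlgorithm (BitVec S × Bool) (ℕ × BitVec S) S,
      DecomposesPower decompositionBound N S k r A ∧
      ∀ a, AggregatesAfter decompositionBound N S k r a A := by
  have hsep : ∀ {V : Type} (G : SimpleGraph V) (lab : V → Fin (2 ^ S)) (u v : V),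
      (fun l : Fin (2 ^ S) => (l : ℕ)) (lab u) = (fun l : Fin (2 ^ S) => (l : ℕ)) (lab v) →
      G.edist u v ≤ k → lab u = lab v := fun _ _ _ _ h _ => Fin.ext h
  refine ⟨.idle fun x => (x.1.toFin.val, x.1), ?_, ?_⟩
  · intro V _ G P center ident hc hN hident
    rw [CongestAlgorithm.result_idle]
    rcases isEmpty_or_nonempty V with hV | hV
    · exact ⟨outputsDecomposition_of_isEmpty _ _ _ _ _, fun v => isEmptyElim v⟩
    obtain ⟨ldr, hldr, inv⟩ := exists_initial_inv (k := k) hk hc hident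
    refine ⟨outputsDecomposition inv (hsep G _) (fun v => ?_) ?_ (name := BitVec.ofFin)
      (fun a b h => BitVec.ofFin.inj h) (fun v => ?_), fun v => ?_⟩
    · refine (Fin.is_lt _).trans_le (Nat.pow_le_pow_right (by norm_num) (hS.trans ?_))
      have := one_le_scale N
      omega
    · have := diameter_le (one_le_scale N) r
      have h16 : r ≤ r * 16 ^ scale N := Nat.le_mul_of_pos_right _ (by positivity)
      rw [decompositionBound]
      omega
    · rw [hldr, hc.center_center]
    · refine (sameCluster_iff inv (hsep G _) _ _).1.2 ?_
      rw [hc.center_center]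
  · intro a M _ _ _
    refine ⟨.idle Prod.snd, fun V _ G P ident hN hinj x v => ?_⟩
    have : Nonempty V := ⟨v⟩
    rw [CongestAlgorithm.result_idle, CongestAlgorithm.result_idle]
    obtain ⟨ldr, hldr, inv⟩ := exists_initial_inv (k := k) hk (isClustering_id G r)
      (hinj.injOn (s := Set.range id))
    refine Eq.trans ?_ (prod_clusterOf inv (hsep G _) x v).symm
    rw [Finset.prod_eq_single v]
    · intro u hu hne
      simp only [Finset.mem_filter] at hu
      exact absurd (hinj (BitVec.toFin_inj.1 hu.2)).symm hne
    · intro hv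
      simp at hv

theorem exists_algorithm_of_two_le {S : ℕ} (hS : 2 ≤ S) (N : ℕ) {k r : ℕ} (hk : 1 ≤ k)
    (hr : 1 ≤ r) :
    ∃ A : CongestAlgorithm (BitVec S × Bool) (ℕ × BitVec S) S,
      DecomposesPower decompositionBound N S k r A ∧
      ∀ a, AggregatesAfter decompositionBound N S k r a A := by
  obtain ⟨A, hA⟩ := Realizable.decompose N k hS hr
  refine ⟨A.dimap id fun a => (a.dat.color, BitVec.ofFin a.lab), ?_, ?_⟩
  · intro V _ G P center ident hc hN hident
    rw [CongestAlgorithm.result_dimap]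
    simp only [id, hA]
    rcases isEmpty_or_nonempty V with hV | hV
    · exact ⟨outputsDecomposition_of_isEmpty _ _ _ _ _, fun v => isEmptyElim v⟩
    obtain ⟨ldr, lab, rel, K, h1, inv, hcol, hsep, hcen, hldr⟩ :=
      decompose_apply (by omega) hk hr hc hN hident
    rw [h1]
    refine ⟨outputsDecomposition inv (col := fun l => (K l).color) hsep hcol
      (diameter_le (one_le_scale N) r) (fun a b h => BitVec.ofFin.inj h) fun v => ?_, fun v => ?_⟩
    · exact congrArg BitVec.ofFin (hldr v _ (inv.lab_mem v))
    · exact (sameCluster_iff inv (col := fun l => (K l).color) hsep _ _).1.2 (hcen v)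
  · intro a M _ _ hM
    -- For `a = 0` no rounds are available, but then `M` is trivial.
    rcases Nat.eq_zero_or_pos a with rfl | ha
    · rw [Nat.zero_mul, pow_zero, Finite.card_le_one_iff_subsingleton] at hM
      exact ⟨.idle Prod.snd, fun V _ G P ident hN hinj x v => Subsingleton.elim _ _⟩
    have hcost : k * r * 16 ^ scale N * (1 + 2 * scale N) * (9 + 2 * a) ≤
        a * (k * r) * decompositionBound N := by
      rw [decompositionBound]
      exact aggregate_rounds_le (one_le_scale N) ha (k * r)
    obtain ⟨R, hR⟩ := (Realizable.aggregate (κ := Status) (by omega) (card_fin_le S) hM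
      (k * r * 16 ^ scale N) (1 + 2 * scale N)).mono hcost
    -- The final state is used only through the output of `A`, which includes the relayed labels;
    -- the visible color and cluster identifier alone would not suffice.
    refine ⟨R.dimap (fun p => (A.output p.1, p.2)) id, fun V _ G P ident hN hinj x v => ?_⟩
    have : Nonempty V := ⟨v⟩
    obtain ⟨ldr, lab, rel, K, h1, inv, hcol, hsep, hcen, hldr⟩ :=
      decompose_apply (k := k) (by omega) hk hr (isClustering_id G r) (ncard_range_id hN)
        (hinj.injOn (s := Set.range id))
    rw [clusterInput_id] at h1
    have hres : A.result P (fun w => (ident w, true))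
        (k * r * decompositionBound N * logStar S) = config (fun v => (ident v).toFin) lab rel K :=
      (hA V G P _).trans h1
    rw [CongestAlgorithm.result_dimap, CongestAlgorithm.result_dimap]
    simp only [id, CongestAlgorithm.run_dimap, hres]
    have hin : (fun u => (A.output (A.run P (fun w => (ident w, true))
        (k * r * decompositionBound N * logStar S) u), x u)) =
        fun u => (config (fun v => (ident v).toFin) lab rel K u, x u) :=
      funext fun u => congrArg (fun c => (c, x u)) (congrFun hres u)
    have hagg := aggregate_apply inv (fun a b h => hinj (BitVec.toFin_inj.1 h)) hldr K x v
    refine Eq.trans ?_ (hagg.trans (prod_clusterOf inv (col := fun l => (K l).color) hsep x v).symm)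
    rw [hin, hR V G P]

theorem exists_algorithm (N S k r : ℕ) (hk : 1 ≤ k) (hr : 1 ≤ r) :
    ∃ A : CongestAlgorithm (BitVec S × Bool) (ℕ × BitVec S) (1 * S),
      DecomposesPower decompositionBound N S k r A ∧
      ∀ a, AggregatesAfter decompositionBound N S k r a A := by
  rw [one_mul]
  rcases Nat.lt_or_ge S 2 with hS | hS
  · exact exists_algorithm_of_le_one (by omega) N r hk
  · exact exists_algorithm_of_two_le hS N hk hr

theorem mainTheorem1 :
    ∃ (g : ℕ → ℕ) (c : ℕ)
      -- the algorithm; `N`, `S`, `k` and the radius `r` of the initial clusters are common knowledge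
      (A : ∀ _N S _k _r : ℕ, CongestAlgorithm (BitVec S × Bool) (ℕ × BitVec S) (c * S)),
      IsTwoPowBigOSqrtLog g ∧
      -- network decomposition of `G^k` on a network of `N` nodes with `S`-bit identifiers
      (∀ N S k : ℕ, 1 ≤ k →
        ∀ (V : Type) [Fintype V] (G : SimpleGraph V) (P : PortNumbering G) (ident : V → BitVec S),
          Fintype.card V = N → Function.Injective ident →
          OutputsDecomposition (powerGraph G k) (g N) (g N) ident
            ((A N S k 0).result P (fun v => (ident v, true)) (k * g N * logStar S))) ∧
      -- a round of communication within the clusters: every node contributes a value of `a * S`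
      -- bits, and every node learns the product of all values in its cluster. This is a
      -- convergecast and a broadcast in all clusters at once, for an arbitrary way of
      -- aggregating values. The nodes start from their final states in the above execution.
      (∀ N S k a : ℕ, 1 ≤ k →
        ∀ (M : Type) [CommMonoid M] [Finite M], Nat.card M ≤ 2 ^ (a * S) →
        ∃ R : CongestAlgorithm ((A N S k 0).State × M) M (c * S),
        ∀ (V : Type) [Fintype V] (G : SimpleGraph V) (P : PortNumbering G) (ident : V → BitVec S),
          Fintype.card V = N → Function.Injective ident →
          ∀ (x : V → M) (v : V),
            R.result P
              (fun u => ((A N S k 0).run P (fun w => (ident w, true)) (k * g N * logStar S) u, x u))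
              (a * k * g N) v =
            ∏ u ∈ clusterOf (powerGraph G k)
                (fun w => ((A N S k 0).result P (fun w => (ident w, true))
                  (k * g N * logStar S) w).1) v, x u) ∧
      -- the variant that starts from `N` clusters of radius at most `r`
      (∀ N S k r : ℕ, 1 ≤ k → 1 ≤ r →
        ∀ (V : Type) [Fintype V] (G : SimpleGraph V) (P : PortNumbering G) (center : V → V)
          (ident : V → BitVec S),
          IsClustering G r center → (Set.range center).ncard = N →
          Set.InjOn ident (Set.range center) →
          OutputsDecomposition (powerGraph G k) (g N) (r * g N) (fun v => ident (center v))
            ((A N S k r).result P (clusterInput ident center) (k * r * g N * logStar S)) ∧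
          -- initial clusters are not broken
          ∀ v, SameCluster (powerGraph G k)
            (fun w => ((A N S k r).result P (clusterInput ident center)
              (k * r * g N * logStar S) w).1) (center v) v) := by
  have key : ∀ N S k r : ℕ, ∃ A : CongestAlgorithm (BitVec S × Bool) (ℕ × BitVec S) (1 * S),
      1 ≤ k → 1 ≤ r → DecomposesPower decompositionBound N S k r A ∧
        ∀ a, AggregatesAfter decompositionBound N S k r a A := fun N S k r => by
    -- The maxima make the choice of an algorithm total in `k` and `r`.
    obtain ⟨A, hA⟩ := exists_algorithm N S (max k 1) (max r 1) (le_max_right _ _) (le_max_right _ _)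
    refine ⟨A, fun hk hr => ?_⟩
    rwa [max_eq_left hk, max_eq_left hr] at hA
  choose A hA using key
  -- The network without initial clusters, called with radius `0`, is treated as a clustering into
  -- single nodes with radius bound `1`.
  refine ⟨decompositionBound, 1, fun N S k r => A N S k (max r 1),
    isTwoPowBigOSqrtLog_decompositionBound, ?_, ?_, ?_⟩
  · intro N S k hk V _ G P ident hN hinj
    have := ((hA N S k 1 hk le_rfl).1 V G P id ident (isClustering_id G 1) (ncard_range_id hN)
      hinj.injOn).1
    simp only [clusterInput_id, mul_one, one_mul, id] at this
    exact this
  · intro N S k a hk M _ _ hM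
    obtain ⟨R, hR⟩ := (hA N S k 1 hk le_rfl).2 a M hM
    simp only [mul_one] at hR
    exact ⟨R, hR⟩
  · intro N S k r hk hr V _ G P center ident hc hN hident
    have := (hA N S k r hk hr).1 V G P center ident hc hN hident
    simp only [max_eq_left hr]
    exact this
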